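/- **Setting.** Let $R$ be a reduced irreducible root system in a Euclidean space of dimension $n$, normalized so that short roots satisfy $(\alpha,\alpha)=2$ (all roots are short if there is one length). Put $\nu_\alpha=(\alpha,\alpha)/2$, $\nu_{lng}=\max_\alpha\nu_\alpha$; let $R_+$ be the positive roots, $\alpha_1,\dots,\alpha_n$ the simple roots, $W$ the Weyl group, $P$ the weight lattice. Let $\tilde R=\{[\alpha,\nu_\alpha j]:\alpha\in R,\ j\in\mathbb Z\}$, $\tilde R_+=\{[\alpha,\nu_\alpha j]: j>0\}\cup\{[\alpha,0]:\alpha\in R_+\}$. An element $bw$ ($b\in P$, $w\in W$) of the extended affine Weyl group $\widehat W$ acts by $bw([z,\zeta])=[w(z),\zeta-(w(z),b)]$ and on points $x\in\mathbb C^n$ by $x\mapsto w(x)+b$; reflections $s_{\tilde\alpha}$, $\tilde\alpha\in\tilde R$, act by $s_{\tilde\alpha}(\tilde z)=\tilde z-(z,\alpha^\vee)\tilde\alpha$. For a set $\Psi$ of positive affine roots, $\Lambda_\Psi(g)=\{\tilde\alpha\in\Psi: -g(\tilde\alpha)\in\Psi\}$; $\Lambda=\Lambda_{\tilde R_+}$.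 For $b\in P$ let $u_b\in W$ be the element of minimal length with $u_b(b)$ antidominant, and $\pi_b=b\,u_b^{-1}$. Let $0<q<1$, $k_\nu\in\mathbb C$, $t_\alpha=t_{\nu_\alpha}=q^{\nu_\alpha k_{\nu_\alpha}}$, $t_i=t_{\alpha_i}$, $t_{sht}=t_1$, $t_{lng}=t_{\nu_{lng}}$, $\rho_k=\frac12\sum_{\alpha\in R_+}k_{\nu_\alpha}\alpha$, $X_{[\alpha,m]}(q^x)=q^{(x,\alpha)+m}$, and $$\mu=\prod_{\tilde\alpha\in\tilde R_+}\frac{1-X_{\tilde\alpha}}{1-t_\alpha X_{\tilde\alpha}}$$ (the product converges). For fixed $\xi$, $\mu(\widehat w)/\mu(0)$ is the value at $x=\xi$ of the meromorphic function $\mu(q^{\widehat w(x)})/\mu(q^x)$. Suppose that $f_i=1-t_iX_{\tilde\gamma_i}$ ($1\le i\le n$) vanish at $q^{x_0}$, where the $\tilde\gamma_i\in\tilde R$ have linearly independent nonaffine components, and that near $x_0$ a function has the form $h/\prod_i f_i$ with $h$ analytic. Here $t_i$ denotes $t_{\tilde\gamma_i}$. Its residue $\mathrm{Res}$ at $x_0$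 is $h(x_0)/\det(\partial f_i/\partial y_j)(x_0)$ in the coordinates $y_j=-\log X_{\tilde\gamma_j}$ (the form $\bigwedge dX_{\tilde\gamma_j}/X_{\tilde\gamma_j}$, clockwise loops). **Theorem.** Let $q$ be generic: $q^m\ne t_{sht}^{l_1}t_{lng}^{l_2}$ for all integers $m\neq0$, $l_1,l_2$. For $\xi\in\mathbb C^n$, the condition that the numerator of $\mu$ does not vanish at $q^\xi$, i.e. $X_{\tilde\alpha}(q^\xi)\ne1$ for all $\tilde\alpha\in\tilde R_+$, does not depend on the choice of the positivity in $\tilde R$. Assume this condition. (i) Let $\xi=-\rho_k$, let $t_{sht}^{\nu_{lng}}\ne1$, $t_{sht}^j\ne-1$ for $1\le j<n$ if $R$ is of type $C_n$, $t_{sht}^4\ne1$ and $t_{lng}t_{sht}^3\ne-1$ if $R$ is of type $F_4$, and $t_\alpha q^{(\alpha,\rho_k)}\neq1$ for all $\alpha\in R_+$. For $b\in P$, $w\in W$, exactly $n$ binomials of the denominator of $\mu$ vanish at $\widehat w=bw$, i.e. at $q^{b-w(\rho_k)}$, if and only if $\widehat w=\pi_b$, i.e. $w=u_b^{-1}$;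 at $\pi_b$ these binomials are $1-t_iX_{\pi_b(\alpha_i)}$, $1\le i\le n$. For all other $\widehat w$, fewer than $n$ vanish and $\mu(\widehat w)/\mu(0)=0$. (ii) Let $t_{sht}=t_{lng}$ or $t_{sht}^{\nu_{lng}}=t_{lng}$, and let exactly $n$ binomials of the denominator of $\mu$ vanish at $q^\xi$, those for $\tilde\beta_1,\dots,\tilde\beta_n\in\tilde R_+$; write $\tilde\beta_i=[\beta_i,\cdot]$. Then the $\beta_i$ are linearly independent, $R^\dagger=\tilde R\cap\bigoplus\mathbb Z\tilde\beta_i$ is a finite closed root subsystem of $\tilde R$ of rank $n$, and $\{\tilde\beta_i\}$ is a set of simple roots of it. Unless there are short $\tilde\beta_i,\tilde\beta_j$ with $\tilde\beta_i-\tilde\beta_j=[\beta,m]$, where $\beta\in R$ is long and $m$ is not divisible by $\nu_{lng}$, $\{\beta_i\}$ is a set of simple roots of $R'=R\cap\bigoplus\mathbb Z\beta_i$. (iii) Moreover, let $|t_{sht}|>1$ and $q<|t_{lng}|^{-h_\dagger}$, where $h_\dagger$ is the maximum of the Coxeter numbers of the irreducible components of $R^\dagger$. Put $\tilde R'=\{[\alpha,\nu_\alpha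 j]:\alpha\in R',j\in\mathbb Z\}$, with the positivity $\tilde R'_+=\tilde R'\cap\tilde R_+$, and $\widetilde W'=\langle s_{\tilde\alpha}:\tilde\alpha\in\tilde R'\rangle$. Then there is $\widetilde w'\in\widetilde W'$ such that all $(\widetilde w')^{-1}(\tilde\beta_i)$ are simple roots of $\tilde R'$ and, for every irreducible component of $R'$, exactly one simple root of its twisted affine extension is not among the $(\widetilde w')^{-1}(\tilde\beta_i)$. (iv) For $\xi=-\rho_k$ as in (i) and $b\in P$, the residues of $\mu$ at $q^\xi$ for $\tilde\gamma_i=\alpha_i$ and at $\pi_b$ for $\tilde\gamma_i=\pi_b(\alpha_i)$ satisfy $\mathrm{Res}(\mu,\pi_b)=\frac{\mu(\pi_b)}{\mu(0)}\,\mathrm{Res}(\mu,0)$, where $$\frac{\mu(\pi_b)}{\mu(0)}=\prod_{\tilde\alpha\in\Lambda(\pi_b)}t_\alpha^{-1}\prod_{[-\alpha,\nu_\alpha j]\in\Lambda(\pi_b)}\frac{1-t_\alpha q^{(\alpha,\rho_k)+\nu_\alpha j}}{1-t_\alpha^{-1}q^{(\alpha,\rho_k)+\nu_\alpha j}},\qquad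 \mathrm{Res}(\mu,0)=\prod_{i=1}^n(1-t_iX_{\alpha_i})\prod_{\tilde\alpha\in\tilde R_+}\frac{1-X_{\tilde\alpha}}{1-t_\alpha X_{\tilde\alpha}}\Big|_{q^{-\rho_k}},$$ the vanishing binomials being cancelled in the last product. In the setting of (iii), $\widetilde w'$ can be chosen so that, in addition, the following holds. Let $\mu'$ be the product $\mu$ taken over $\tilde R'_+$ instead of $\tilde R_+$, $\xi_0=(\widetilde w')^{-1}(\xi)$, $\tilde\gamma_i=(\widetilde w')^{-1}(\tilde\beta_i)$. Then $\mu/\mu'$ is regular and nonzero at $q^\xi$, and, with the residues at $\xi$ taken for the $\tilde\beta_i$ and the residue at $\xi_0$ for the $\tilde\gamma_i$, $$\mathrm{Res}(\mu,\xi)=\frac{\mu}{\mu'}(q^\xi)\,\mathrm{Res}(\mu',\xi),\qquad \mathrm{Res}(\mu',\xi)=\prod_{\tilde\alpha\in\Lambda_{\tilde R'_+}(\widetilde w')}\frac{t_\alpha^{-1}-X_{\tilde\alpha}(q^{\xi_0})}{1-t_\alpha^{-1}X_{\tilde\alpha}(q^{\xi_0})}\ \mathrm{Res}(\mu',\xi_0),$$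 $$\mathrm{Res}(\mu',\xi_0)=\prod_{i=1}^n(1-t_{\tilde\gamma_i}X_{\tilde\gamma_i})\prod_{\tilde\alpha\in\tilde R'_+}\frac{1-X_{\tilde\alpha}}{1-t_\alpha X_{\tilde\alpha}}\Big|_{q^{\xi_0}}$$ (after the same cancellation), the product over $\Lambda_{\tilde R'_+}(\widetilde w')$ being the value at $x=\xi_0$ of $\mu'(q^{\widetilde w'(x)})/\mu'(q^x)$. -/

import Mathlib

open scoped RealInnerProductSpace Topology

noncomputable section

namespace DoubleAffine

section

variable {V : Type*} [NormedAddCommGroup V] [InnerProductSpace ℝ V]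

/-! ### Affine roots -/

/-- `ν_α = (α, α) / 2`. -/
def nu (α : V) : ℝ := ⟪α, α⟫ / 2

/-- The twisted affine root system of `R`: all `[α, ν_α j]` with `α ∈ R`, `j ∈ ℤ`. -/
def affRoots (R : Set V) : Set (V × ℝ) :=
  {γ | γ.1 ∈ R ∧ ∃ j : ℤ, γ.2 = nu γ.1 * j}

/-- The positive affine roots: `[α, ν_α j]` with `j > 0`, or with `j = 0` and `α` positive. -/
def affPos (R Rpos : Set V) : Set (V × ℝ) :=
  {γ | γ ∈ affRoots R ∧ (0 < γ.2 ∨ (γ.2 = 0 ∧ γ.1 ∈ Rpos))}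

/-- The inner product of affine roots ignores the affine components. -/
def affInner (γ δ : V × ℝ) : ℝ := ⟪γ.1, δ.1⟫

/-- `s_γ(z) = z - (z, γ^∨) γ`. -/
def affReflect (γ z : V × ℝ) : V × ℝ := z - (2 * affInner z γ / affInner γ γ) • γ

/-- The group generated by the reflections in the affine roots from `Φ`. -/
def affWeyl (Φ : Set (V × ℝ)) : Subgroup ((V × ℝ) ≃ₗ[ℝ] (V × ℝ)) :=
  Subgroup.closure {g | ∃ γ ∈ Φ, ∀ z, g z = affReflect γ z}

/-- The weight lattice `P`. -/
def weights (R : Set V) : Set V :=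
  {c | ∀ α ∈ R, ∃ m : ℤ, 2 * ⟪c, α⟫ / ⟪α, α⟫ = m}

/-- The element `c w` of the extended affine Weyl group `W ⋉ P`, as the linear map
`[z, ζ] ↦ [w z, ζ - (w z, c)]`. -/
def extElt (c : V) (w : V ≃ₗ[ℝ] V) : (V × ℝ) ≃ₗ[ℝ] (V × ℝ) where
  toFun z := (w z.1, z.2 - ⟪w z.1, c⟫)
  invFun z := (w.symm z.1, z.2 + ⟪z.1, c⟫)
  map_add' x y := by
    ext
    · simp
    · simp [inner_add_left]; ring
  map_smul' r x := by
    ext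
    · simp
    · simp [inner_smul_left]; ring
  left_inv x := by simp
  right_inv x := by simp

/-- `Λ(g)`: the elements of the positive set `Ψ` that `g` makes negative. -/
def lambdaSet (Ψ : Set (V × ℝ)) (g : (V × ℝ) ≃ₗ[ℝ] (V × ℝ)) : Set (V × ℝ) :=
  {γ | γ ∈ Ψ ∧ -(g γ) ∈ Ψ}

/-- `Λ'(g) = {[-α, m] : [α, m] ∈ Λ(g)}`. -/
def lambdaSet' (Ψ : Set (V × ℝ)) (g : (V × ℝ) ≃ₗ[ℝ] (V × ℝ)) : Set (V × ℝ) :=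
  {γ | (-γ.1, γ.2) ∈ lambdaSet Ψ g}

/-- The length of an element of the finite Weyl group. -/
def finLength (Rpos : Set V) (u : V ≃ₗ[ℝ] V) : ℕ := {α | α ∈ Rpos ∧ -(u α) ∈ Rpos}.ncard

/-- `u = u_c`: the element of minimal length in `W` such that `u(c)` is antidominant. -/
def IsMinAntidominant (W : Subgroup (V ≃ₗ[ℝ] V)) (Rpos : Set V) (c : V) (u : V ≃ₗ[ℝ] V) : Prop :=
  (u ∈ W ∧ ∀ α ∈ Rpos, ⟪u c, α⟫ ≤ 0) ∧
    ∀ v ∈ W, (∀ α ∈ Rpos, ⟪v c, α⟫ ≤ 0) → finLength Rpos u ≤ finLength Rpos v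

/-! ### Subsystems, simple roots, components -/

/-- `Φ` is a closed root subsystem of `Φtot`. -/
def IsClosedSubsystem (Φtot Φ : Set (V × ℝ)) : Prop :=
  Φ ⊆ Φtot ∧ (∀ γ ∈ Φ, ∀ δ ∈ Φ, affReflect γ δ ∈ Φ) ∧
    ∀ γ ∈ Φ, ∀ δ ∈ Φ, γ + δ ∈ Φtot → γ + δ ∈ Φ

/-- `β` is a set of simple roots (a base) of the finite root system `Φ`. -/
def IsSimpleSystem {M κ : Type*} [AddCommGroup M] [Module ℝ M] [Fintype κ]
    (Φ : Set M) (β : κ → M) : Prop :=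
  LinearIndependent ℝ β ∧ (∀ i, β i ∈ Φ) ∧
    ∀ γ ∈ Φ, ∃ m : κ → ℕ, γ = ∑ i, m i • β i ∨ γ = -∑ i, m i • β i

/-- The simple roots of a set `Ψ` of positive roots: the elements of `Ψ` that are not sums of
other elements of `Ψ`. -/
def simpleRoots (Ψ : Set (V × ℝ)) : Set (V × ℝ) :=
  {γ | γ ∈ Ψ ∧ γ ∉ AddSubmonoid.closure (Ψ \ {γ})}

/-- `C` is an irreducible component of `Φ` with respect to the form `B`: a connected component
for the relation of being non-orthogonal. -/
def IsComponent {M : Type*} (B : M → M → ℝ) (Φ C : Set M) : Prop :=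
  ∃ α ∈ Φ, C = {β | Relation.ReflTransGen (fun x y => x ∈ Φ ∧ y ∈ Φ ∧ B x y ≠ 0) α β}

/-- The Coxeter number of an irreducible component `C` of the finite root system with simple roots
`β`: one plus the height of the highest root of `C`. -/
def coxeterNumber {κ : Type*} [Fintype κ] (β : κ → V × ℝ) (C : Set (V × ℝ)) : ℕ :=
  sSup {N : ℕ | ∃ m : κ → ℕ, ∑ i, m i • β i ∈ C ∧ N = ∑ i, m i} + 1

/-- The maximum of the Coxeter numbers of the irreducible components of the finite root system `Φ`
with simple roots `β`. -/
def maxCoxeterNumber {κ : Type*} [Fintype κ] (β : κ → V × ℝ) (Φ : Set (V × ℝ)) : ℕ :=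
  sSup {h : ℕ | ∃ C, IsComponent affInner Φ C ∧ h = coxeterNumber β C}

/-- The affine roots that are integral combinations of the `β i`. -/
def affSpanRoots {κ : Type*} (R : Set V) (β : κ → V × ℝ) : Set (V × ℝ) :=
  {γ | γ ∈ affRoots R ∧ γ ∈ Submodule.span ℤ (Set.range β)}

/-- The roots that are integral combinations of the nonaffine components of the `β i`. -/
def spanRoots {κ : Type*} (R : Set V) (β : κ → V × ℝ) : Set V :=
  {α | α ∈ R ∧ α ∈ Submodule.span ℤ (Set.range fun i => (β i).1)}

/-! ### Functions on the complexification

A point `x` of the complexification `ℂⁿ` of `V` is recorded by the real linear functional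
`a ↦ (x, a)` on `V`. -/

/-- `(x, [a, m]) = (x, a) + m`. -/
def affEval (x : V →L[ℝ] ℂ) (γ : V × ℝ) : ℂ := x γ.1 + γ.2

/-- The value at `q ^ x` of `X_γ`, that is `q ^ (x, γ)`. -/
def X (q : ℝ) (γ : V × ℝ) (x : V →L[ℝ] ℂ) : ℂ := (q : ℂ) ^ affEval x γ

/-- `t_ν = q ^ (ν k_ν)`. -/
def tOf (q : ℝ) (k : ℝ → ℂ) (ν : ℝ) : ℂ := (q : ℂ) ^ ((ν : ℂ) * k ν)

/-- `t_γ` for an affine root `γ = [α, m]` is `t_ν` for `ν = ν_α`. -/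
def tPar (q : ℝ) (k : ℝ → ℂ) (γ : V × ℝ) : ℂ := tOf q k (nu γ.1)

/-- `ρ_k`, one half of the sum of all `k_α α` over positive `α`. -/
def rho (k : ℝ → ℂ) (Rpos : Set V) : V →L[ℝ] ℂ :=
  (1 / 2 : ℂ) • ∑ᶠ α ∈ Rpos, k (nu α) • Complex.ofRealCLM.comp (innerSL ℝ α)

/-- The affine action on points, dual to the action on affine roots:
`(g((x)), a) = (x, g⁻¹[a, 0])`. For `g = c w` it is `x ↦ w(x) + c`. -/
def actPt [FiniteDimensional ℝ V] (g : (V × ℝ) ≃ₗ[ℝ] (V × ℝ)) (x : V →L[ℝ] ℂ) : V →L[ℝ] ℂ :=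
  LinearMap.toContinuousLinearMap
    { toFun := fun a => affEval x (g.symm (a, 0))
      map_add' := fun a a₂ => by
        have h : ((a + a₂, 0) : V × ℝ) = (a, 0) + (a₂, 0) := by simp
        rw [h, map_add]
        simp [affEval]; ring
      map_smul' := fun r a => by
        have h : ((r • a, 0) : V × ℝ) = r • (a, 0) := by simp
        rw [h, map_smul]
        simp [affEval] }

/-- The factor of the function `μ` at the affine root `γ`. -/
def muFactor (q : ℝ) (k : ℝ → ℂ) (x : V →L[ℝ] ℂ) (γ : V × ℝ) : ℂ :=
  (1 - X q γ x) / (1 - tPar q k γ * X q γ x)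

/-- The product of `(1 - X_γ) / (1 - t_γ X_γ)` over the set `Ψ` of positive affine roots. -/
def mu (q : ℝ) (k : ℝ → ℂ) (Ψ : Set (V × ℝ)) (x : V →L[ℝ] ℂ) : ℂ :=
  ∏' γ : Ψ, muFactor q k x γ

open Classical in
/-- The factor of `μ` at `γ`, with its denominator deleted if `γ ∈ S`. -/
def deletedFactor (q : ℝ) (k : ℝ → ℂ) (S : Set (V × ℝ)) (x : V →L[ℝ] ℂ) (γ : V × ℝ) : ℂ :=
  (1 - X q γ x) / (if γ ∈ S then 1 else 1 - tPar q k γ * X q γ x)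

/-- The `γ ∈ Ψ` whose binomials `1 - t_γ X_γ` in the denominator of `μ` vanish at `q ^ x`. -/
def vanishing (q : ℝ) (k : ℝ → ℂ) (Ψ : Set (V × ℝ)) (x : V →L[ℝ] ℂ) : Set (V × ℝ) :=
  {γ | γ ∈ Ψ ∧ 1 - tPar q k γ * X q γ x = 0}

/-- The points where no binomial `1 - X_γ`, `1 - t_γ X_γ`, for any affine root `γ`, vanishes. -/
def regularPts (q : ℝ) (k : ℝ → ℂ) (R : Set V) : Set (V →L[ℝ] ℂ) :=
  {x | ∀ γ ∈ affRoots R, 1 - X q γ x ≠ 0 ∧ 1 - tPar q k γ * X q γ x ≠ 0}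

/-- The function `F`, defined on `D`, extends analytically to a neighbourhood of `x₀`,
with the value `v` at `x₀`. -/
def HasValueAt {E : Type*} [NormedAddCommGroup E] [NormedSpace ℂ E]
    (D : Set E) (F : E → ℂ) (x₀ : E) (v : ℂ) : Prop :=
  x₀ ∈ closure D ∧ ∃ g : E → ℂ, AnalyticAt ℂ g x₀ ∧ (∀ᶠ x in 𝓝 x₀, x ∈ D → F x = g x) ∧ g x₀ = v

/-- The residue at the nondegenerate singular point `x₀` of the form
`F dy₁ ∧ ⋯ ∧ dyₙ`, `F = h / (f₁ ⋯ fₙ)`, in local coordinates `y`, for the polar divisors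
`f₁ = 0, …, fₙ = 0`: it is `h(x₀) / det (∂fᵢ/∂yⱼ)(x₀)`. -/
def HasResidue {E κ : Type*} [NormedAddCommGroup E] [NormedSpace ℂ E] [Fintype κ] [DecidableEq κ]
    (F : E → ℂ) (f y : κ → E → ℂ) (x₀ : E) (r : ℂ) : Prop :=
  (∀ j, AnalyticAt ℂ (y j) x₀) ∧
  LinearIndependent ℂ (fun j => fderiv ℂ (y j) x₀) ∧
  Submodule.span ℂ (Set.range fun j => fderiv ℂ (y j) x₀) = ⊤ ∧
  (∀ i, AnalyticAt ℂ (f i) x₀ ∧ f i x₀ = 0) ∧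
  ∃ (h : E → ℂ) (J : Matrix κ κ ℂ),
    AnalyticAt ℂ h x₀ ∧
    (∀ᶠ x in 𝓝 x₀, (∀ i, f i x ≠ 0) → F x = h x / ∏ i, f i x) ∧
    (∀ i, fderiv ℂ (f i) x₀ = ∑ j, J i j • fderiv ℂ (y j) x₀) ∧
    J.det ≠ 0 ∧ r = h x₀ / J.det

/-- The residue of the function `F` at `x₀` with respect to the divisors `1 - t X_{γ i} = 0` and
the form `⋀ dX_{γ i} / X_{γ i}`, with the clockwise orientation of the loops around them; that is,
with respect to the coordinates `- log X_{γ i} = - (log q) (x, γ i)`. -/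
def HasMuResidue {κ : Type*} [Fintype κ] [DecidableEq κ] (q : ℝ) (k : ℝ → ℂ)
    (F : (V →L[ℝ] ℂ) → ℂ) (γ : κ → V × ℝ) (x₀ : V →L[ℝ] ℂ) (r : ℂ) : Prop :=
  HasResidue F (fun i x => 1 - tPar q k (γ i) * X q (γ i) x)
    (fun i x => -(Real.log q : ℂ) * affEval x (γ i)) x₀ r

end

/-! ### Types -/

/-- The root system with the base `b` is of type `C_n`, where `n` is its rank. -/
def IsTypeC {ι V N : Type*} [AddCommGroup V] [Module ℝ V] [AddCommGroup N] [Module ℝ N]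
    (P : RootPairing ι ℝ V N) [P.IsCrystallographic] (b : P.Base) : Prop :=
  ∃ e : b.support ≃ Fin (Module.finrank ℝ V),
    ∀ i j, b.cartanMatrix i j = CartanMatrix.C (Module.finrank ℝ V) (e i) (e j)

/-- The root system with the base `b` is of type `F_4`. -/
def IsTypeF {ι V N : Type*} [AddCommGroup V] [Module ℝ V] [AddCommGroup N] [Module ℝ N]
    (P : RootPairing ι ℝ V N) [P.IsCrystallographic] (b : P.Base) : Prop :=
  ∃ e : b.support ≃ Fin 4, ∀ i j, b.cartanMatrix i j = CartanMatrix.F₄ (e i) (e j)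

end DoubleAffine

end

/-! Everything rests on what the equations $t_{\tilde\beta}X_{\tilde\beta}(q^\xi)=1$ impose on the
affine roots satisfying them; call these roots poles. No $X_{\tilde\alpha}$ equals $1$ at $q^\xi$,
so two poles with equal $t$ never differ by an affine root. Since the difference of two different
roots at an acute angle is a root, such poles are pairwise obtuse; the relation between $t_{sht}$
and $t_{lng}$ extends this to poles of different lengths (`PoleData.inner_nonpos`). Genericity of
$q$ makes every integral relation between the nonaffine components of poles lift to the poles
themselves (`eq_sum_of_pole`). Obtuseness, positivity and genericity together give linear
independence (`PoleData.linearIndependent`), and obtuse independent roots whose differences are not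
roots form a set of simple roots of what they span (`isSimpleSystem_of_sub_notMem`). This is (ii).

For (iii), the $\tilde\beta_i$ vanish at a common point of $V$, where all affine roots of $R'$ take
integral values. A suitable alcove of $R'$ at this point has the $\tilde\beta_i$ among its walls,
and the element of $\widetilde W'$ that moves the basic alcove there conjugates them to affine
simple roots (`exists_affWeyl_simpleRoots`). In every component exactly one affine simple root is
missing, since two missing ones would split the component into orthogonal parts
(`existsUnique_simpleRoot`). The condition $|t_{sht}|>1$ excludes negative poles
(`PoleData.mem_range_of_pole`), so that the poles at $\xi_0$ and at $\xi$ correspond to each other.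

For (i), the core is `Specialization.exists_eq_simple`: a positive root with
$q^{(\alpha,\rho_k)}=t_\alpha$ is simple. A nonsimple one would be obtuse to the simple roots of its
length, hence acute to one of the other length. There may be one long simple root (type $C$), one
short simple root (type $B$), or the type is $F_4$ or $G_2$; each case ends in a contradiction with
positive definiteness, in a root where the character is $1$, or in an excluded relation between the
parameters. Hence the poles at $w(-\rho_k)+b$ are those of the $bw(\alpha_i)$ that are positive, and
all of them are positive precisely for $\pi_b$ (`isMinAntidominant_iff`).

The residues come from two facts. After deletion of the vanishing binomials $\mu$ is analytic, and
in the coordinates $-\log X$ the Jacobian is the identity, so the residue is the deleted product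
(`Admissible.hasMuResidue`). An affine isometry permutes the affine roots up to sign, and only the
roots that change sign contribute to the ratio (`hasProd_deletedFactor_actPt`). -/

noncomputable section
namespace DoubleAffine

/-! ### Analytic properties and residues of products over affine roots -/

section Analytic

open Filter

variable {V : Type*} [NormedAddCommGroup V] [InnerProductSpace ℝ V]
  {q : ℝ} {k : ℝ → ℂ} {x x₀ : V →L[ℝ] ℂ} {γ δ : V × ℝ} {Ψ S : Set (V × ℝ)}

lemma affEval_add (x : V →L[ℝ] ℂ) (γ δ : V × ℝ) :
    affEval x (γ + δ) = affEval x γ + affEval x δ := by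
  simp [affEval]; ring

lemma affEval_smul (x : V →L[ℝ] ℂ) (r : ℝ) (γ : V × ℝ) :
    affEval x (r • γ) = r * affEval x γ := by
  simp [affEval]; ring

lemma X_add (hq : 0 < q) (γ δ : V × ℝ) (x : V →L[ℝ] ℂ) : X q (γ + δ) x = X q γ x * X q δ x := by
  rw [X, affEval_add, Complex.cpow_add _ _ (by exact_mod_cast hq.ne')]; rfl

lemma X_ne_zero (hq : 0 < q) (γ : V × ℝ) (x : V →L[ℝ] ℂ) : X q γ x ≠ 0 := by
  simp [X, Complex.cpow_eq_zero_iff, hq.ne']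

lemma X_zero (x : V →L[ℝ] ℂ) : X q 0 x = 1 := by
  simp [X, affEval]

lemma X_neg (hq : 0 < q) (γ : V × ℝ) (x : V →L[ℝ] ℂ) : X q (-γ) x = (X q γ x)⁻¹ := by
  refine eq_inv_of_mul_eq_one_left ?_
  rw [← X_add hq, neg_add_cancel, X_zero]

lemma X_sub (hq : 0 < q) (γ δ : V × ℝ) (x : V →L[ℝ] ℂ) : X q (γ - δ) x = X q γ x / X q δ x := by
  rw [sub_eq_add_neg, X_add hq, X_neg hq, div_eq_mul_inv]

lemma X_zsmul (m : ℤ) (γ : V × ℝ) (x : V →L[ℝ] ℂ) :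
    X q (m • γ) x = X q γ x ^ m := by
  rw [X, X, ← Complex.cpow_mul_int, ← Int.cast_smul_eq_zsmul ℝ, affEval_smul, mul_comm]
  simp

lemma X_sum (hq : 0 < q) {κ : Type*} (s : Finset κ) (β : κ → V × ℝ) (x : V →L[ℝ] ℂ) :
    X q (∑ i ∈ s, β i) x = ∏ i ∈ s, X q (β i) x := by
  classical
  induction s using Finset.induction_on with
  | empty => simp [X_zero]
  | insert i s hi ih => rw [Finset.sum_insert hi, Finset.prod_insert hi, X_add hq, ih]

lemma X_imag (m : ℤ) (x : V →L[ℝ] ℂ) : X q ((0 : V), (m : ℝ)) x = (q : ℂ) ^ m := by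
  simp [X, affEval]

lemma X_eq_mul (hq : 0 < q) (γ : V × ℝ) (x : V →L[ℝ] ℂ) :
    X q γ x = X q (γ.1, 0) x * ((q ^ γ.2 : ℝ) : ℂ) := by
  have : γ = (γ.1, 0) + (0, γ.2) := by ext <;> simp
  conv_lhs => rw [this, X_add hq]
  congr 1
  simp [X, affEval, Complex.ofReal_cpow hq.le]

lemma tPar_ne_zero (hq : 0 < q) (k : ℝ → ℂ) (γ : V × ℝ) : tPar q k γ ≠ 0 := by
  simp [tPar, tOf, Complex.cpow_eq_zero_iff, hq.ne']

lemma tPar_neg (q : ℝ) (k : ℝ → ℂ) (γ : V × ℝ) : tPar q k (-γ) = tPar q k γ := by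
  simp [tPar, nu]

/-- Evaluation at a vector, as a complex linear functional on the complexification. -/
def evalAt (v : V) : (V →L[ℝ] ℂ) →L[ℂ] ℂ :=
  LinearMap.mkContinuous
    { toFun := fun x => x v
      map_add' := fun _ _ => rfl
      map_smul' := fun _ _ => rfl } ‖v‖ fun x => by
    simpa [mul_comm] using x.le_opNorm v

@[simp] lemma evalAt_apply (v : V) (x : V →L[ℝ] ℂ) : evalAt v x = x v := rfl

lemma hasFDerivAt_affEval (γ : V × ℝ) (x : V →L[ℝ] ℂ) :
    HasFDerivAt (fun x : V →L[ℝ] ℂ => affEval x γ) (evalAt γ.1) x :=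
  (evalAt γ.1).hasFDerivAt.add_const (γ.2 : ℂ)

lemma analyticAt_affEval (γ : V × ℝ) (x : V →L[ℝ] ℂ) :
    AnalyticAt ℂ (fun x : V →L[ℝ] ℂ => affEval x γ) x :=
  ((evalAt γ.1).analyticAt x).add analyticAt_const

lemma X_eq_exp (hq : 0 < q) (γ : V × ℝ) (x : V →L[ℝ] ℂ) :
    X q γ x = Complex.exp ((Real.log q : ℂ) * affEval x γ) := by
  rw [X, Complex.cpow_def_of_ne_zero (by exact_mod_cast hq.ne'), Complex.ofReal_log hq.le]

lemma analyticAt_X (hq : 0 < q) (γ : V × ℝ) (x : V →L[ℝ] ℂ) : AnalyticAt ℂ (X q γ) x := by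
  have : X q γ = fun x => Complex.exp ((Real.log q : ℂ) * affEval x γ) :=
    funext fun x => X_eq_exp hq γ x
  rw [this]
  exact (analyticAt_const.mul (analyticAt_affEval γ x)).cexp

lemma hasFDerivAt_X (hq : 0 < q) (γ : V × ℝ) (x : V →L[ℝ] ℂ) :
    HasFDerivAt (X q γ) ((X q γ x * Real.log q) • evalAt γ.1) x := by
  have : X q γ = fun x => Complex.exp ((Real.log q : ℂ) * affEval x γ) :=
    funext fun x => X_eq_exp hq γ x
  rw [X_eq_exp hq, this]
  convert! ((hasFDerivAt_affEval γ x).const_mul (Real.log q : ℂ)).cexp using 1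
  rw [smul_smul]

/-! ### Admissible sets of affine roots and infinite products over them -/

/-- A set of affine roots over which the products considered here converge. -/
structure Admissible (q : ℝ) (Ψ : Set (V × ℝ)) : Prop where
  summable : Summable fun γ : Ψ => q ^ γ.1.2
  finite : (Prod.fst '' Ψ).Finite

omit [NormedAddCommGroup V] [InnerProductSpace ℝ V] in
lemma Admissible.mono {Ψ' : Set (V × ℝ)} (h : Admissible q Ψ) (hs : Ψ' ⊆ Ψ) :
    Admissible q Ψ' :=
  ⟨(h.summable.comp_injective (Set.inclusion_injective hs) :
      Summable ((fun γ : Ψ => q ^ γ.1.2) ∘ Set.inclusion hs)),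
    h.finite.subset (Set.image_mono hs)⟩

omit [NormedAddCommGroup V] [InnerProductSpace ℝ V] in
lemma exists_bound_fst (h : (Prod.fst '' Ψ).Finite) (f : V → ℝ) : ∃ C, 0 ≤ C ∧ ∀ γ ∈ Ψ, f γ.1 ≤ C := by
  obtain ⟨C, hC⟩ := (h.image f).bddAbove
  exact ⟨max C 0, le_max_right _ _, fun γ hγ => (hC ⟨γ.1, ⟨γ, hγ, rfl⟩, rfl⟩).trans (le_max_left _ _)⟩

lemma Admissible.summable_norm_X (h : Admissible q Ψ) (hq : 0 < q) (x : V →L[ℝ] ℂ) :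
    Summable fun γ : Ψ => ‖X q γ x‖ := by
  obtain ⟨C, hC, hb⟩ := exists_bound_fst h.finite fun v => ‖X q (v, 0) x‖
  refine Summable.of_nonneg_of_le (fun _ => norm_nonneg _) (fun γ => ?_) (h.summable.mul_left C)
  rw [X_eq_mul hq, norm_mul, Complex.norm_real, Real.norm_of_nonneg (Real.rpow_nonneg hq.le _)]
  exact mul_le_mul_of_nonneg_right (hb _ γ.2) (Real.rpow_nonneg hq.le _)

/-- Convergence is locally uniform on the disc of radius $|z|+1$. This is the function of one
variable to which the affine roots with a fixed nonaffine component contribute. -/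
lemma differentiable_tprod_one_add_mul {ι : Type*} {a : ι → ℂ} (ha : Summable fun i => ‖a i‖) :
    Differentiable ℂ fun z => ∏' i, (1 + a i * z) := by
  intro z
  have hR : IsOpen (Metric.ball (0 : ℂ) (‖z‖ + 1)) := Metric.isOpen_ball
  have h := (Summable.hasProdLocallyUniformlyOn_one_add (f := fun i z => a i * z) hR
    (ha.mul_right (‖z‖ + 1)) (Eventually.of_forall fun i w hw => ?_) fun i => by fun_prop)
  · refine (h.differentiableOn (.of_forall fun s => ?_) hR).differentiableAt (hR.mem_nhds (by simp))
    simpa [Finset.prod_fn] using DifferentiableOn.finsetProd (fun _ _ => by fun_prop)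
  · rw [norm_mul]
    exact mul_le_mul_of_nonneg_left (by rw [mem_ball_zero_iff] at hw; exact hw.le) (norm_nonneg _)

lemma Admissible.summable_norm_mul_X (h : Admissible q Ψ) (hq : 0 < q) {c : Ψ → ℂ} {C : ℝ}
    (hc : ∀ γ, ‖c γ‖ ≤ C) (x : V →L[ℝ] ℂ) : Summable fun γ : Ψ => ‖c γ * X q γ x‖ := by
  refine Summable.of_nonneg_of_le (fun _ => norm_nonneg _) (fun γ => ?_)
    ((h.summable_norm_X hq x).mul_left C)
  rw [norm_mul]
  exact mul_le_mul_of_nonneg_right (hc γ) (norm_nonneg _)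

/-- Only finitely many nonaffine components $v$ occur, and $X_{[v,m]}=q^mX_{[v,0]}$. So the product
splits into finitely many entire functions of one variable, composed with the $X_{[v,0]}$, and no
infinite product in several variables has to be treated. -/
lemma Admissible.analyticAt_tprod (h : Admissible q Ψ) (hq : 0 < q) {c : Ψ → ℂ} {C : ℝ}
    (hc : ∀ γ, ‖c γ‖ ≤ C) (x₀ : V →L[ℝ] ℂ) :
    AnalyticAt ℂ (fun x => ∏' γ : Ψ, (1 + c γ * X q γ x)) x₀ := by
  classical
  have := h.finite.fintype
  let g : Ψ → Prod.fst '' Ψ := fun γ => ⟨γ.1.1, γ.1, γ.2, rfl⟩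
  let a : Ψ → ℂ := fun γ => c γ * ((q ^ γ.1.2 : ℝ) : ℂ)
  have ha : Summable fun γ => ‖a γ‖ := by
    refine Summable.of_nonneg_of_le (fun _ => norm_nonneg _) (fun γ => ?_) (h.summable.mul_left C)
    rw [norm_mul, Complex.norm_real, Real.norm_of_nonneg (Real.rpow_nonneg hq.le _)]
    exact mul_le_mul_of_nonneg_right (hc γ) (Real.rpow_nonneg hq.le _)
  have key : (fun x => ∏' γ : Ψ, (1 + c γ * X q γ x)) =
      fun x => ∏ v : Prod.fst '' Ψ,
        (fun z => ∏' γ : g ⁻¹' {v}, (1 + a γ.1 * z)) (X q ((v : V), (0 : ℝ)) x) := by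
    funext x
    have hm := multipliable_one_add_of_summable (h.summable_norm_mul_X hq hc x)
    have h1 : HasProd (fun v : Prod.fst '' Ψ => ∏' γ : g ⁻¹' {v}, (1 + a γ.1 * X q ((v : V), (0 : ℝ)) x))
        (∏' γ : Ψ, (1 + c γ * X q γ x)) := by
      let e := Equiv.sigmaFiberEquiv g
      have h2 : HasProd (fun s : Σ v, { γ // g γ = v } => 1 + c (e s) * X q (e s).1 x)
        (∏' γ : Ψ, (1 + c γ * X q γ x)) := e.hasProd_iff.2 hm.hasProd
      refine h2.sigma fun v => ?_
      have h3 : Multipliable fun γ : g ⁻¹' {v} => (1 + a γ.1 * X q ((v : V), (0 : ℝ)) x) :=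
        multipliable_one_add_of_summable (by
          simp_rw [norm_mul]
          exact (ha.comp_injective Subtype.val_injective).mul_right _)
      convert! h3.hasProd using 1
      funext γ
      have hv : (v : V) = γ.1.1.1 := by have := congrArg Subtype.val γ.2; exact this.symm
      change 1 + c γ.1 * X q γ.1.1 x = _
      rw [X_eq_mul hq]
      simp only [a, hv]
      ring
    rw [← h1.tprod_eq, tprod_fintype]
  rw [key]
  refine Finset.analyticAt_fun_prod _ fun v _ => ?_
  refine AnalyticAt.comp (g := fun z => ∏' γ : g ⁻¹' {v}, (1 + a γ.1 * z)) ?_ (analyticAt_X hq _ _)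
  exact (differentiable_tprod_one_add_mul (a := fun γ : g ⁻¹' {v} => a γ.1)
    (ha.comp_injective Subtype.val_injective)).analyticAt _

lemma Admissible.exists_bound_tPar (h : Admissible q Ψ) (k : ℝ → ℂ) :
    ∃ C, 0 ≤ C ∧ ∀ γ ∈ Ψ, ‖tPar q k γ‖ ≤ C :=
  exists_bound_fst h.finite fun v => ‖tOf q k (nu v)‖

/-- Almost all factors differ from $1$ by $O(|X_\gamma|)$, which is summable. The finitely many
others, including those with a vanishing denominator (equal to $0$ by the convention for division),
do not affect convergence, so no condition on the point is needed. -/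
lemma Admissible.multipliable_deletedFactor (h : Admissible q Ψ) (hq : 0 < q) (k : ℝ → ℂ)
    (S : Set (V × ℝ)) (x : V →L[ℝ] ℂ) :
    Multipliable fun γ : Ψ => deletedFactor q k S x γ := by
  classical
  obtain ⟨C, hC, hb⟩ := h.exists_bound_tPar k
  have hX := h.summable_norm_X hq x
  have hs : Summable fun γ : Ψ => ‖deletedFactor q k S x γ - 1‖ := by
    refine summable_norm_iff.2 (Summable.of_norm_bounded_eventually
      (hX.mul_left (2 * (C + 1))) ?_)
    -- As $C$ bounds all $|t_\gamma|$, this smallness of $|X_\gamma|$ gives $|t_\gamma X_\gamma|\le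
    -- 1/2$ and keeps the denominator away from $0$.
    have h0 := hX.tendsto_cofinite_zero.eventually
      (gt_mem_nhds (show (0 : ℝ) < 1 / (2 * (C + 1)) by positivity))
    filter_upwards [h0] with γ hγ
    have hX0 := norm_nonneg (X q (γ : V × ℝ) x)
    rw [lt_div_iff₀ (by positivity)] at hγ
    by_cases hS : (γ : V × ℝ) ∈ S
    · simp only [deletedFactor, hS, if_true, div_one]
      rw [sub_sub_cancel_left, norm_neg]
      nlinarith
    · simp only [deletedFactor, hS, if_false]
      have ht : ‖tPar q k γ.1 * X q γ x‖ ≤ 1 / 2 := by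
        rw [norm_mul]
        nlinarith [hb γ γ.2, norm_nonneg (tPar q k γ.1), norm_nonneg (X q γ.1 x)]
      have hd : 1 / 2 ≤ ‖1 - tPar q k γ.1 * X q γ x‖ := by
        have := norm_sub_norm_le (1 : ℂ) (tPar q k γ.1 * X q γ x)
        rw [norm_one] at this; linarith
      have hd0 : 1 - tPar q k γ.1 * X q γ x ≠ 0 := by
        intro h0; rw [h0, norm_zero] at hd; linarith
      have : (1 - X q γ.1 x) / (1 - tPar q k γ.1 * X q γ x) - 1 =
          (tPar q k γ.1 - 1) * X q γ x / (1 - tPar q k γ.1 * X q γ x) := by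
        rw [div_sub_one hd0]; ring
      rw [this, norm_div, norm_mul, div_le_iff₀ (by linarith)]
      have h1 : ‖tPar q k γ.1 - 1‖ ≤ C + 1 := (norm_sub_le _ _).trans (by
        rw [norm_one]; linarith [hb γ γ.2])
      have h2 : ‖tPar q k γ.1 - 1‖ * ‖X q (γ : V × ℝ) x‖ ≤ (C + 1) * ‖X q (γ : V × ℝ) x‖ :=
        mul_le_mul_of_nonneg_right h1 hX0
      nlinarith [mul_nonneg (by linarith : (0 : ℝ) ≤ C + 1) hX0]
  simpa using multipliable_one_add_of_summable hs

lemma deletedFactor_empty (q : ℝ) (k : ℝ → ℂ) (x : V →L[ℝ] ℂ) (γ : V × ℝ) :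
    deletedFactor q k ∅ x γ = muFactor q k x γ := by
  simp [deletedFactor, muFactor]

lemma Admissible.multipliable_muFactor (h : Admissible q Ψ) (hq : 0 < q) (k : ℝ → ℂ)
    (x : V →L[ℝ] ℂ) : Multipliable fun γ : Ψ => muFactor q k x γ := by
  simpa only [deletedFactor_empty] using h.multipliable_deletedFactor hq k ∅ x

/-- The product is a quotient of two products that are analytic everywhere. Deleting a binomial
amounts to the coefficient $0$ in the lower product, which therefore does not vanish at $x_0$. -/
lemma Admissible.tprod_deletedFactor (h : Admissible q Ψ) (hq : 0 < q) (k : ℝ → ℂ)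
    (S : Set (V × ℝ)) (x₀ : V →L[ℝ] ℂ)
    (hS : ∀ γ ∈ Ψ, γ ∉ S → 1 - tPar q k γ * X q γ x₀ ≠ 0) :
    AnalyticAt ℂ (fun x => ∏' γ : Ψ, deletedFactor q k S x γ) x₀ ∧
    ((∀ γ ∈ Ψ, 1 - X q γ x₀ ≠ 0) → ∏' γ : Ψ, deletedFactor q k S x₀ γ ≠ 0) := by
  classical
  obtain ⟨C, hC, hb⟩ := h.exists_bound_tPar k
  let c : Ψ → ℂ := fun γ => if (γ : V × ℝ) ∈ S then 0 else -tPar q k γ.1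
  have hc : ∀ γ, ‖c γ‖ ≤ C := fun γ => by
    by_cases hS : (γ : V × ℝ) ∈ S
    · simpa [c, hS] using hC
    · simpa [c, hS] using hb γ γ.2
  have hn : ∀ γ : Ψ, ‖(fun _ : Ψ => (-1 : ℂ)) γ‖ ≤ 1 := by simp
  have hfac : ∀ x (γ : Ψ), deletedFactor q k S x γ =
      (1 + (-1) * X q γ x) / (1 + c γ * X q γ x) := fun x γ => by
    by_cases hS : (γ : V × ℝ) ∈ S <;> simp [deletedFactor, c, hS, sub_eq_add_neg]
  have hmc := fun x => multipliable_one_add_of_summable (h.summable_norm_mul_X hq hc x)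
  have hmn := fun x => multipliable_one_add_of_summable (h.summable_norm_mul_X hq hn x)
  have hD : ∏' γ : Ψ, (1 + c γ * X q γ x₀) ≠ 0 := by
    refine tprod_one_add_ne_zero_of_summable (fun γ => ?_) (h.summable_norm_mul_X hq hc x₀)
    by_cases hγ : (γ : V × ℝ) ∈ S
    · simp [c, hγ]
    · simpa [c, hγ, sub_eq_add_neg] using hS γ γ.2 hγ
  have hA := h.analyticAt_tprod hq hc x₀
  have hN := h.analyticAt_tprod hq hn x₀
  constructor
  · refine (hN.div hA hD).congr ?_
    filter_upwards [hA.continuousAt.eventually_ne hD] with x hx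
    simp_rw [hfac]
    rw [(hmn x).tprod_div₀ (hmc x) hx]
    rfl
  · intro h1
    simp_rw [hfac]
    rw [(hmn x₀).tprod_div₀ (hmc x₀) hD]
    refine div_ne_zero (tprod_one_add_ne_zero_of_summable (fun γ => ?_)
      (h.summable_norm_mul_X hq hn x₀)) hD
    simpa [sub_eq_add_neg] using h1 γ γ.2

lemma Admissible.mu_ne_zero (h : Admissible q Ψ) (hq : 0 < q) (k : ℝ → ℂ) {x : V →L[ℝ] ℂ}
    (hx : ∀ γ ∈ Ψ, 1 - X q γ x ≠ 0 ∧ 1 - tPar q k γ * X q γ x ≠ 0) : mu q k Ψ x ≠ 0 := by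
  have := (h.tprod_deletedFactor hq k ∅ x fun γ hγ _ => (hx γ hγ).2).2 fun γ hγ => (hx γ hγ).1
  simp only [deletedFactor_empty] at this
  exact this

lemma Admissible.analyticAt_mu (h : Admissible q Ψ) (hq : 0 < q) (k : ℝ → ℂ) {x : V →L[ℝ] ℂ}
    (hx : ∀ γ ∈ Ψ, 1 - tPar q k γ * X q γ x ≠ 0) : AnalyticAt ℂ (mu q k Ψ) x := by
  have := (h.tprod_deletedFactor hq k ∅ x fun γ hγ _ => hx γ hγ).1
  simp only [deletedFactor_empty] at this
  exact this

/-- Multiplication by finitely many inverses restores the deleted denominators. With $0^{-1}=0$ this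
is true at every point, also on the polar divisors. -/
lemma Admissible.mu_eq_div (h : Admissible q Ψ) (hq : 0 < q) (k : ℝ → ℂ) {κ : Type*} [Fintype κ]
    {β : κ → V × ℝ} (hβ : Function.Injective β) (hβΨ : ∀ i, β i ∈ Ψ) (x : V →L[ℝ] ℂ) :
    mu q k Ψ x = (∏' γ : Ψ, deletedFactor q k (Set.range β) x γ) /
      ∏ i, (1 - tPar q k (β i) * X q (β i) x) := by
  classical
  let g : Ψ → ℂ := fun γ =>
    if (γ : V × ℝ) ∈ Set.range β then (1 - tPar q k γ.1 * X q γ x)⁻¹ else 1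
  let b : κ → Ψ := fun i => ⟨β i, hβΨ i⟩
  have hb : Function.Injective b := fun i j hij => hβ (congrArg Subtype.val hij)
  have hg : HasProd g (∏ γ ∈ Finset.univ.image b, g γ) := by
    refine hasProd_prod_of_ne_finset_one fun γ hγ => if_neg ?_
    rintro ⟨i, hi⟩
    exact hγ (Finset.mem_image.2 ⟨i, Finset.mem_univ _, Subtype.ext hi⟩)
  have h1 := (h.multipliable_deletedFactor hq k (Set.range β) x).hasProd.mul hg
  rw [mu]
  have h2 : (fun γ : Ψ => muFactor q k x γ) =
      fun γ : Ψ => deletedFactor q k (Set.range β) x γ * g γ := by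
    funext γ
    by_cases hγ : (γ : V × ℝ) ∈ Set.range β <;>
      simp only [muFactor, deletedFactor, g, hγ, if_true, if_false, mul_one,
        div_eq_mul_inv, inv_one]
  rw [h2, h1.tprod_eq, Finset.prod_image fun i _ j _ hij => hb hij, div_eq_mul_inv,
    ← Finset.prod_inv_distrib]
  congr 1
  exact Finset.prod_congr rfl fun i _ => by simp [g, b]

/-- If the polar functions and the coordinates have the same differentials at $x_0$, the Jacobian
matrix is the identity and the residue is just the value of the numerator. -/
lemma hasResidue_of_hasFDerivAt {E κ : Type*} [NormedAddCommGroup E] [NormedSpace ℂ E] [Fintype κ]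
    [DecidableEq κ] {F h : E → ℂ} {f y : κ → E → ℂ} {x₀ : E} {e : κ → E} {L : κ → (E →L[ℂ] ℂ)}
    (hL : ∀ i j, L i (e j) = if i = j then 1 else 0) (he : ∀ x, x = ∑ i, L i x • e i)
    {c : ℂ} (hc : c ≠ 0) (hya : ∀ j, AnalyticAt ℂ (y j) x₀) (hfa : ∀ j, AnalyticAt ℂ (f j) x₀)
    (hy : ∀ j, HasFDerivAt (y j) (c • L j) x₀) (hf : ∀ j, HasFDerivAt (f j) (c • L j) x₀)
    (hf0 : ∀ j, f j x₀ = 0) (hh : AnalyticAt ℂ h x₀) (hF : ∀ x, F x = h x / ∏ i, f i x) :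
    HasResidue F f y x₀ (h x₀) := by
  have hfy : (fun j => fderiv ℂ (y j) x₀) = fun j => c • L j := funext fun j => (hy j).fderiv
  refine ⟨hya, ?_, ?_, fun i => ⟨hfa i, hf0 i⟩, h, 1, hh, Eventually.of_forall fun x _ => hF x,
    fun i => ?_, by simp, by simp⟩
  · rw [hfy, Fintype.linearIndependent_iff]
    intro a ha i
    have := congrArg (fun M : E →L[ℂ] ℂ => M (e i)) ha
    simpa [hL, hc] using this
  · rw [hfy, eq_top_iff]
    intro M _
    have hM : M = ∑ i, (M (e i) * c⁻¹) • (c • L i) := by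
      ext x
      conv_lhs => rw [he x]
      simp only [map_sum, map_smul, smul_eq_mul, FunLike.coe_sum, Finset.sum_apply,
        smul_apply]
      exact Finset.sum_congr rfl fun i _ => by field_simp
    rw [hM]
    exact Submodule.sum_mem _ fun i _ => Submodule.smul_mem _ _
      (Submodule.subset_span ⟨i, rfl⟩)
  · rw [Finset.sum_eq_single i (fun j _ hj => by
      ext v; simp [Matrix.one_apply_ne hj.symm]) (by simp), Matrix.one_apply_eq, one_smul,
      (hf i).fderiv, (hy i).fderiv]

/-- Where $tX=1$, the differential of $1-tX$ is $-tX\log q\,d(x,\beta)=-\log q\,d(x,\beta)$, that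
is, the differential of $-\log X$. So no Jacobian appears, and the residue is the product with the
vanishing binomials deleted. -/
lemma Admissible.hasMuResidue [FiniteDimensional ℝ V] (h : Admissible q Ψ) (hq : 0 < q)
    (hq1 : q < 1) (k : ℝ → ℂ) {κ : Type*} [Fintype κ] [DecidableEq κ] {β : κ → V × ℝ}
    (hli : LinearIndependent ℝ fun i => (β i).1) (hcard : Fintype.card κ = Module.finrank ℝ V)
    (x₀ : V →L[ℝ] ℂ) (hv : vanishing q k Ψ x₀ = Set.range β) {r : ℂ}
    (hr : HasProd (fun γ : Ψ => deletedFactor q k (Set.range β) x₀ γ) r) :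
    HasMuResidue q k (mu q k Ψ) β x₀ r := by
  have hβ : Function.Injective β := fun i j hij => hli.injective (congrArg Prod.fst hij)
  have hvan : ∀ i, β i ∈ Ψ ∧ 1 - tPar q k (β i) * X q (β i) x₀ = 0 := fun i => by
    have : β i ∈ vanishing q k Ψ x₀ := hv ▸ ⟨i, rfl⟩
    exact this
  have hlog : (Real.log q : ℂ) ≠ 0 := by
    exact_mod_cast (Real.log_neg hq hq1).ne
  have hy : ∀ j, HasFDerivAt (fun x : V →L[ℝ] ℂ => -(Real.log q : ℂ) * affEval x (β j))
      (-(Real.log q : ℂ) • evalAt (β j).1) x₀ := fun j =>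
    (hasFDerivAt_affEval (β j) x₀).const_mul _
  have hf : ∀ j, HasFDerivAt (fun x : V →L[ℝ] ℂ => 1 - tPar q k (β j) * X q (β j) x)
      (-(Real.log q : ℂ) • evalAt (β j).1) x₀ := fun j => by
    have h1 := ((hasFDerivAt_X hq (β j) x₀).const_mul (tPar q k (β j))).const_sub 1
    convert! h1 using 1
    ext v
    simp only [smul_apply, neg_apply, smul_eq_mul]
    linear_combination (Real.log q : ℂ) * evalAt (β j).1 v * -(hvan j).2
  let B := basisOfLinearIndependentOfCardEqFinrank' (fun i => (β i).1) hli hcard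
  have hB : ∀ i, B i = (β i).1 := fun i => by simp [B]
  let e : κ → (V →L[ℝ] ℂ) := fun i =>
    Complex.ofRealCLM.comp (LinearMap.toContinuousLinearMap (B.coord i))
  have he : ∀ i j, e i (B j) = if i = j then 1 else 0 := fun i j => by
    by_cases h : i = j
    · simp [e, h]
    · simp [e, h]
  rw [← hr.tprod_eq]
  refine hasResidue_of_hasFDerivAt
    (h := fun x => ∏' γ : Ψ, deletedFactor q k (Set.range β) x γ) (e := e)
    (L := fun i => evalAt (β i).1) (fun i j => ?_) (fun x => ?_) (neg_ne_zero.2 hlog)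
    (fun j => analyticAt_const.mul (analyticAt_affEval _ _))
    (fun i => analyticAt_const.sub (analyticAt_const.mul (analyticAt_X hq _ _))) hy hf
    (fun i => (hvan i).2) ?_ (fun x => h.mu_eq_div hq k hβ (fun i => (hvan i).1) x)
  · rw [evalAt_apply, ← hB, he]
    simp [eq_comm]
  · refine ContinuousLinearMap.coe_injective (B.ext fun j => ?_)
    simp only [← hB, evalAt_apply]
    simp [he]
  · refine (h.tprod_deletedFactor hq k _ x₀ fun γ hγ hγS h0 => hγS ?_).1
    rw [← hv]; exact ⟨hγ, h0⟩

/-! ### Regular points -/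

/-- On the line $\xi+tr$ the modulus of $X_\gamma$ is $q^{a+bt}$ with $b\ne0$, so each binomial
vanishes for at most one real $t$. There are countably many binomials, and a countable set of reals
has a dense complement. -/
lemma mem_closure_regularPts (hq : 0 < q) (hq1 : q < 1) (k : ℝ → ℂ) {R : Set V} (hfin : R.Finite)
    {r : V} (hr : ∀ α ∈ R, ⟪r, α⟫ ≠ 0) (ξ : V →L[ℝ] ℂ) : ξ ∈ closure (regularPts q k R) := by
  have hcount : (affRoots R).Countable := by
    have : affRoots R ⊆ (fun p : V × ℤ => (p.1, nu p.1 * p.2)) '' (R ×ˢ Set.univ) := by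
      rintro ⟨α, m⟩ ⟨h1, j, h2⟩
      exact ⟨(α, j), ⟨h1, trivial⟩, Prod.ext rfl h2.symm⟩
    exact ((hfin.countable.prod (Set.to_countable _)).image _).mono this
  let f : ℝ → (V →L[ℝ] ℂ) := fun t => ξ + (t : ℂ) • Complex.ofRealCLM.comp (innerSL ℝ r)
  have hf : Continuous f := by fun_prop
  have hsub : ∀ γ ∈ affRoots R, ∀ c : ℂ, c ≠ 0 → {t : ℝ | 1 - c * X q γ (f t) = 0}.Subsingleton := by
    intro γ hγ c hc s hs t ht
    have hval : ∀ t, ‖X q γ (f t)‖ = q ^ ((affEval ξ γ).re + t * ⟪r, γ.1⟫) := fun t => by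
      rw [X, Complex.norm_cpow_eq_rpow_re_of_pos hq]
      congr 1
      simp [affEval, f]; ring
    have h1 : c * X q γ (f s) = c * X q γ (f t) := by
      rw [← sub_eq_zero.1 hs, ← sub_eq_zero.1 ht]
    have h2 := congrArg norm (mul_left_cancel₀ hc h1)
    rw [hval, hval] at h2
    have h3 := (Real.rpow_right_inj hq hq1.ne).1 h2
    have h4 := hr γ.1 hγ.1
    exact mul_right_cancel₀ h4 (add_left_cancel h3)
  let bad : Set ℝ := ⋃ γ ∈ affRoots R,
    {t : ℝ | 1 - 1 * X q γ (f t) = 0} ∪ {t | 1 - tPar q k γ * X q γ (f t) = 0}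
  have hbad : bad.Countable := hcount.biUnion fun γ hγ =>
    ((hsub γ hγ 1 one_ne_zero).countable).union ((hsub γ hγ _ (tPar_ne_zero hq k γ)).countable)
  have hdense : Dense badᶜ := hbad.dense_compl ℝ
  have h0 : f 0 = ξ := by
    ext v; simp [f]
  rw [← h0]
  have hcl : (0 : ℝ) ∈ closure badᶜ := hdense 0
  refine closure_mono ?_ (image_closure_subset_closure_image hf ⟨0, hcl, rfl⟩)
  rintro _ ⟨t, ht, rfl⟩ γ hγ
  simp only [bad, Set.mem_compl_iff, Set.mem_iUnion, not_exists] at ht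
  have := ht γ hγ
  simp only [Set.mem_union, Set.mem_ofPred_eq, not_or, one_mul] at this
  exact this

end Analytic

/-! ### Euclidean root systems and the relations between poles -/

section Roots

variable {V : Type*} [NormedAddCommGroup V] [InnerProductSpace ℝ V] {R Rpos : Set V}

/-- A finite crystallographic root system in a Euclidean space, with `ν_α` a positive integer for
every root. -/
structure IsRootSet (R : Set V) : Prop where
  finite : R.Finite
  ne_zero : ∀ α ∈ R, α ≠ 0
  exists_nu : ∀ α ∈ R, ∃ m : ℕ, 0 < m ∧ nu α = m
  reflect : ∀ α ∈ R, ∀ β ∈ R, β - (⟪β, α⟫ / nu α) • α ∈ R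
  integral : ∀ α ∈ R, ∀ β ∈ R, ∃ m : ℤ, ⟪β, α⟫ = nu α * m

/-- `Rpos` is the set of those roots that are positive on the vector `r`, and no root vanishes
on `r`. -/
structure IsPositive (R Rpos : Set V) (r : V) : Prop where
  mem_iff : ∀ α, α ∈ Rpos ↔ α ∈ R ∧ 0 < ⟪r, α⟫
  inner_ne : ∀ α ∈ R, ⟪r, α⟫ ≠ 0

lemma inner_self_eq_nu (α : V) : ⟪α, α⟫ = 2 * nu α := by
  rw [nu]; ring

lemma nu_neg (α : V) : nu (-α) = nu α := by simp [nu]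

lemma nu_sub (α β : V) : nu (α - β) = nu α + nu β - ⟪α, β⟫ := by
  simp only [nu, inner_sub_left, inner_sub_right, real_inner_comm α β]; ring

namespace IsRootSet

variable (hR : IsRootSet R)
include hR

lemma nu_pos {α : V} (hα : α ∈ R) : 0 < nu α := by
  obtain ⟨m, hm, h⟩ := hR.exists_nu α hα
  rw [h]; exact_mod_cast hm

lemma neg_mem {α : V} (hα : α ∈ R) : -α ∈ R := by
  have h := hR.reflect α hα α hα
  rw [inner_self_eq_nu, mul_div_assoc, div_self (hR.nu_pos hα).ne', mul_one, two_smul] at h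
  simpa using h

/-- If both Cartan integers were at least $2$, the squared length of $\alpha-\beta$ would not be
positive. Hence one of them is $1$. -/
lemma inner_eq_or {α β : V} (hα : α ∈ R) (hβ : β ∈ R) (hne : α ≠ β) (h : 0 < ⟪α, β⟫) :
    ⟪α, β⟫ = nu α ∨ ⟪α, β⟫ = nu β := by
  have h1 := hR.nu_pos hα
  have h2 := hR.nu_pos hβ
  obtain ⟨a, ha⟩ := hR.integral α hα β hβ
  obtain ⟨b, hb⟩ := hR.integral β hβ α hα
  rw [real_inner_comm] at ha
  by_contra! hcon
  have hpos : 0 < a ∧ 0 < b := by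
    constructor
    · by_contra! h0
      have : (a : ℝ) ≤ 0 := by exact_mod_cast h0
      nlinarith
    · by_contra! h0
      have : (b : ℝ) ≤ 0 := by exact_mod_cast h0
      nlinarith
  have ha2 : 2 ≤ a := by
    by_contra! h0
    have : a = 1 := by omega
    exact hcon.1 (by rw [ha, this]; simp)
  have hb2 : 2 ≤ b := by
    by_contra! h0
    have : b = 1 := by omega
    exact hcon.2 (by rw [hb, this]; simp)
  have ha3 : (2 : ℝ) ≤ a := by exact_mod_cast ha2
  have hb3 : (2 : ℝ) ≤ b := by exact_mod_cast hb2
  have h3 : nu (α - β) ≤ 0 := by rw [nu_sub]; nlinarith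
  rw [nu] at h3
  have h4 : ⟪α - β, α - β⟫ = 0 := le_antisymm (by linarith) real_inner_self_nonneg
  exact hne (sub_eq_zero.1 (inner_self_eq_zero.1 h4))

lemma sub_mem {α β : V} (hα : α ∈ R) (hβ : β ∈ R) (hne : α ≠ β) (h : 0 < ⟪α, β⟫) : α - β ∈ R := by
  rcases hR.inner_eq_or hα hβ hne h with h1 | h1
  · have := hR.reflect α hα β hβ
    rw [real_inner_comm, h1, div_self (hR.nu_pos hα).ne', one_smul] at this
    simpa using hR.neg_mem this
  · have := hR.reflect β hβ α hα
    rwa [h1, div_self (hR.nu_pos hβ).ne', one_smul] at this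

omit hR in
lemma affReflect_eq (γ δ : V × ℝ) : affReflect γ δ = δ - (⟪δ.1, γ.1⟫ / nu γ.1) • γ := by
  rw [affReflect, affInner, affInner, nu]
  congr 2
  rw [div_div_eq_mul_div, mul_comm]

/-- The new affine component is $\nu_\delta j-(\delta,\gamma)i$, and $(\delta,\gamma)$ is a multiple
of $\nu_\delta$ by integrality for the coroot of $\delta$. This is what the twisted form
$[\alpha,\nu_\alpha j]$ is made for. -/
lemma affReflect_mem {γ δ : V × ℝ} (hγ : γ ∈ affRoots R) (hδ : δ ∈ affRoots R) :
    affReflect γ δ ∈ affRoots R := by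
  obtain ⟨hγ1, i, hi⟩ := hγ
  obtain ⟨hδ1, j, hj⟩ := hδ
  rw [affReflect_eq]
  refine ⟨hR.reflect _ hγ1 _ hδ1, ?_⟩
  have hnu : nu (δ.1 - (⟪δ.1, γ.1⟫ / nu γ.1) • γ.1) = nu δ.1 := by
    have h0 := (hR.nu_pos hγ1).ne'
    rw [nu_sub, inner_smul_right]
    have : nu ((⟪δ.1, γ.1⟫ / nu γ.1) • γ.1) = (⟪δ.1, γ.1⟫ / nu γ.1) ^ 2 * nu γ.1 := by
      simp only [nu, inner_smul_left, inner_smul_right]; simp; ring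
    rw [this]; field_simp; ring
  obtain ⟨m, hm⟩ := hR.integral δ.1 hδ1 γ.1 hγ1
  refine ⟨j - m * i, ?_⟩
  change δ.2 - (⟪δ.1, γ.1⟫ / nu γ.1) * γ.2 = nu (δ.1 - (⟪δ.1, γ.1⟫ / nu γ.1) • γ.1) * _
  rw [hnu, hi, hj, real_inner_comm, hm]
  have h0 := (hR.nu_pos hγ1).ne'
  push_cast
  field_simp

lemma neg_mem_aff {γ : V × ℝ} (hγ : γ ∈ affRoots R) : -γ ∈ affRoots R := by
  obtain ⟨h1, j, hj⟩ := hγ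
  refine ⟨hR.neg_mem h1, -j, ?_⟩
  simp [nu_neg, hj]

lemma sub_mem_aff {γ δ : V × ℝ} (hγ : γ ∈ affRoots R) (hδ : δ ∈ affRoots R) (hne : γ.1 ≠ δ.1)
    (h : 0 < ⟪γ.1, δ.1⟫) : γ - δ ∈ affRoots R := by
  rcases hR.inner_eq_or hγ.1 hδ.1 hne h with h1 | h1
  · have := hR.affReflect_mem hγ hδ
    rw [affReflect_eq, real_inner_comm, h1, div_self (hR.nu_pos hγ.1).ne', one_smul] at this
    simpa using hR.neg_mem_aff this
  · have := hR.affReflect_mem hδ hγ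
    rwa [affReflect_eq, h1, div_self (hR.nu_pos hδ.1).ne', one_smul] at this

lemma exists_int_snd {γ : V × ℝ} (hγ : γ ∈ affRoots R) : ∃ m : ℤ, γ.2 = m := by
  obtain ⟨h1, j, hj⟩ := hγ
  obtain ⟨m, -, h⟩ := hR.exists_nu _ h1
  exact ⟨m * j, by rw [hj, h]; push_cast; rfl⟩

end IsRootSet

/-! ### Recognition of simple systems -/

/-- The squared norm of $x=\sum c_ib_i$ is the sum of the numbers $c_i(x,b_i)$, so they cannot all
be nonpositive. -/
lemma exists_pos_mul_inner {κ : Type*} [Fintype κ] {b : κ → V} {c : κ → ℝ}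
    (h : ∑ i, c i • b i ≠ 0) : ∃ i, 0 < c i * ⟪∑ j, c j • b j, b i⟫ := by
  by_contra! hcon
  have h1 : ⟪∑ j, c j • b j, ∑ i, c i • b i⟫ = ∑ i, c i * ⟪∑ j, c j • b j, b i⟫ := by
    rw [inner_sum]
    exact Finset.sum_congr rfl fun i _ => inner_smul_right _ _ _
  have h2 : ⟪∑ j, c j • b j, ∑ i, c i • b i⟫ ≤ 0 := h1 ▸ Finset.sum_nonpos fun i _ => hcon i
  exact h (inner_self_eq_zero.1 (le_antisymm h2 real_inner_self_nonneg))

lemma exists_pos_mul_inner_int {κ : Type*} [Fintype κ] {b : κ → V} {c : κ → ℤ}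
    (h : ∑ i, c i • b i ≠ 0) : ∃ i, 0 < c i * ⟪∑ j, c j • b j, b i⟫ := by
  have h1 : ∑ i, c i • b i = ∑ i, (c i : ℝ) • b i := by simp [Int.cast_smul_eq_zsmul]
  rw [h1] at h ⊢
  exact exists_pos_mul_inner h

section SimpleSystem

variable {M κ : Type*} [AddCommGroup M] [Module ℝ M] [Fintype κ]
  {p : M →ₗ[ℝ] V} {Φ : Set M} {β : κ → M}

lemma int_coeff_eq (hli : LinearIndependent ℝ fun i => p (β i)) {m m' : κ → ℤ}
    (h : p (∑ i, m i • β i) = p (∑ i, m' i • β i)) : m = m' := by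
  have h1 : ∑ i, ((m i : ℝ) - m' i) • p (β i) = 0 := by
    simp only [map_sum, map_zsmul] at h
    simp only [sub_smul, Int.cast_smul_eq_zsmul, Finset.sum_sub_distrib, h, sub_self]
  funext i
  have := Fintype.linearIndependent_iff.1 hli _ h1 i
  exact_mod_cast sub_eq_zero.1 this

/-- Induction on the sum of the absolute values of the coefficients: a root is acute to some
$\beta_i$ with a positive coefficient (up to a common sign), and subtracting this $\beta_i$ gives a
smaller root. The map $p$ makes the criterion apply both to affine roots, with the nonaffine
projection, and to finite ones, with the identity. -/
lemma isSimpleSystem_of_sub_notMem (hli : LinearIndependent ℝ fun i => p (β i))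
    (hβ : ∀ i, β i ∈ Φ) (hspan : ∀ γ ∈ Φ, ∃ m : κ → ℤ, γ = ∑ i, m i • β i)
    (hneg : ∀ γ ∈ Φ, -γ ∈ Φ) (h0 : (0 : M) ∉ Φ)
    (hsub : ∀ γ ∈ Φ, ∀ i, p γ ≠ p (β i) → 0 < ⟪p γ, p (β i)⟫ → γ - β i ∈ Φ)
    (hobt : ∀ i j, i ≠ j → ⟪p (β i), p (β j)⟫ ≤ 0) (hdiff : ∀ i j, β i - β j ∉ Φ) :
    IsSimpleSystem Φ β := by
  classical
  have hsingle : ∀ i, β i = ∑ j, (Pi.single i 1 : κ → ℤ) j • β j := fun i => by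
    simp [Pi.single_apply, ite_smul]
  have hp : ∀ m : κ → ℤ, p (∑ i, m i • β i) = ∑ i, m i • p (β i) := fun m => by simp
  have hne : ∀ m : κ → ℤ, m ≠ 0 → ∑ i, m i • p (β i) ≠ 0 := fun m hm h => hm <| by
    refine int_coeff_eq hli (m' := 0) ?_
    rw [hp, h]; simp
  have key : ∀ N : ℕ, ∀ m : κ → ℤ, ∑ i, (m i).natAbs = N → ∑ i, m i • β i ∈ Φ →
      (∀ i, 0 ≤ m i) ∨ ∀ i, m i ≤ 0 := by
    intro N
    induction N using Nat.strong_induction_on with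
    | _ N ih =>
    have hstep : ∀ m : κ → ℤ, ∑ i, (m i).natAbs = N → ∑ i, m i • β i ∈ Φ → ∀ i, 0 < m i →
        0 < ⟪∑ j, m j • p (β j), p (β i)⟫ → ∀ j, 0 ≤ m j := by
      intro m hN hm i hi hin
      by_cases heq : p (∑ j, m j • β j) = p (β i)
      · rw [hsingle i] at heq
        have := int_coeff_eq hli heq
        intro j
        rw [this, Pi.single_apply]
        split_ifs <;> norm_num
      have h1 := hsub _ hm i heq (by rwa [hp])
      have h2 : ∑ j, m j • β j - β i = ∑ j, (m - Pi.single i 1 : κ → ℤ) j • β j := by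
        conv_lhs => rw [hsingle i]
        rw [← Finset.sum_sub_distrib]
        exact Finset.sum_congr rfl fun j _ => by rw [Pi.sub_apply, sub_smul]
      rw [h2] at h1
      have h3 : ∑ j, ((m - Pi.single i 1 : κ → ℤ) j).natAbs < N := by
        rw [← hN]
        refine Finset.sum_lt_sum (fun j _ => ?_) ⟨i, Finset.mem_univ i, ?_⟩
        · by_cases hj : j = i
          · subst hj; simp; omega
          · simp [hj]
        · simp; omega
      rcases ih _ h3 _ rfl h1 with h4 | h4
      · intro j
        have := h4 j
        by_cases hj : j = i
        · subst hj; exact hi.le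
        · simpa [hj] using this
      -- The remaining case: after the subtraction all coefficients are $\le0$, so the root is
      -- $\beta_i-y$ with $y$ a nonnegative combination of the other $\beta_j$. It has to be shown
      -- that $y=0$.
      have hi1 : m i = 1 := by have := h4 i; simp at this; omega
      have hj1 : ∀ j, j ≠ i → m j ≤ 0 := fun j hj => by simpa [hj] using h4 j
      by_contra! hcon
      obtain ⟨j₀, hj₀⟩ := hcon
      have hij₀ : j₀ ≠ i := by rintro rfl; omega
      have hd0 : (Pi.single i 1 - m : κ → ℤ) ≠ 0 := fun h => by
        have := congrFun h j₀; simp [hij₀] at this; omega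
      -- Some $\beta_j$ occurring in $y$ has $(y,\beta_j)>0$. Since $(\beta_i,\beta_j)\le0$, the
      -- root $\beta_i-y$ is strictly obtuse to $\beta_j$, so that adding $\beta_j$ gives a root
      -- again.
      obtain ⟨j, hj⟩ := exists_pos_mul_inner_int (hne _ hd0)
      have hji : j ≠ i := by
        rintro rfl
        simp [hi1] at hj
      simp only [Pi.sub_apply, Pi.single_apply, hji, if_false, zero_sub] at hj
      have hmj : m j < 0 := by
        rcases (hj1 j hji).lt_or_eq with h | h
        · exact h
        · simp [h] at hj
      have hmj' : (m j : ℝ) < 0 := by exact_mod_cast hmj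
      have h5 : ∑ x, ((if x = i then 1 else 0) - m x) • p (β x) =
          p (β i) - ∑ x, m x • p (β x) := by
        simp [sub_smul, Finset.sum_sub_distrib, ite_smul]
      rw [h5, inner_sub_left] at hj
      push_cast at hj
      have h6 := hobt i j hji.symm
      have h7 : 0 < ⟪p (-∑ x, m x • β x), p (β j)⟫ := by
        rw [map_neg, hp, inner_neg_left]
        nlinarith
      have h8 : p (-∑ x, m x • β x) ≠ p (β j) := by
        rw [← Finset.sum_neg_distrib]
        simp_rw [← neg_smul]
        intro h
        rw [hsingle j] at h
        have := congrFun (int_coeff_eq hli h) i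
        simp [Ne.symm hji, hi1] at this
      have h9 := hneg _ (hsub _ (hneg _ hm) j h8 h7)
      have h10 : -(-∑ x, m x • β x - β j) = ∑ x, (m + Pi.single j 1 : κ → ℤ) x • β x := by
        conv_lhs => rw [hsingle j]
        rw [neg_sub, sub_neg_eq_add, add_comm, ← Finset.sum_add_distrib]
        exact Finset.sum_congr rfl fun x _ => by rw [Pi.add_apply, add_smul]
      rw [h10] at h9
      have h11 : ∑ x, ((m + Pi.single j 1 : κ → ℤ) x).natAbs < N := by
        rw [← hN]
        refine Finset.sum_lt_sum (fun x _ => ?_) ⟨j, Finset.mem_univ j, ?_⟩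
        · by_cases hx : x = j
          · subst hx; simp; omega
          · simp [hx]
        · simp; omega
      -- The coefficient at $\beta_i$ is still $1$, so by induction no coefficient is negative. This
      -- leaves only $\beta_i-\beta_j$, which is not a root.
      have h12 : ∀ x, 0 ≤ (m + Pi.single j 1 : κ → ℤ) x := by
        rcases ih _ h11 _ rfl h9 with h | h
        · exact h
        · have := h i; simp [Ne.symm hji, hi1] at this
      refine hdiff i j ?_
      have h13 : m = Pi.single i 1 - Pi.single j 1 := by
        funext x
        have ha := h12 x
        simp only [Pi.add_apply, Pi.sub_apply, Pi.single_apply] at ha ⊢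
        by_cases hx : x = i
        · subst hx; simp [Ne.symm hji, hi1]
        · have := hj1 x hx
          by_cases hxj : x = j
          · subst hxj; simp [hx] at ha ⊢; omega
          · simp [hx, hxj] at ha ⊢; omega
      have h14 : β i - β j = ∑ x, m x • β x := by
        rw [h13]
        conv_lhs => rw [hsingle i, hsingle j]
        rw [← Finset.sum_sub_distrib]
        exact Finset.sum_congr rfl fun x _ => by rw [Pi.sub_apply, sub_smul]
      rw [h14]; exact hm
    intro m hN hm
    have hm0 : m ≠ 0 := by
      rintro rfl
      exact h0 (by simpa using hm)
    obtain ⟨i, hi⟩ := exists_pos_mul_inner_int (hne m hm0)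
    rcases lt_trichotomy (m i) 0 with h | h | h
    · right
      have hr : (m i : ℝ) < 0 := by exact_mod_cast h
      have := hstep (-m) (by simpa using hN) (by simpa using hneg _ hm) i (by simpa using h)
        (by simp only [Pi.neg_apply, neg_smul, Finset.sum_neg_distrib, inner_neg_left]; nlinarith)
      intro j
      simpa using this j
    · simp [h] at hi
    · left
      have hr : (0 : ℝ) < m i := by exact_mod_cast h
      exact hstep m hN hm i h (by nlinarith)
  refine ⟨LinearIndependent.of_comp p hli, hβ, fun γ hγ => ?_⟩
  obtain ⟨m, rfl⟩ := hspan γ hγ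
  refine ⟨fun i => (m i).natAbs, ?_⟩
  rcases key _ m rfl hγ with h | h
  · left
    refine Finset.sum_congr rfl fun i _ => ?_
    rw [← natCast_zsmul, Int.natAbs_of_nonneg (h i)]
  · right
    rw [← Finset.sum_neg_distrib]
    refine Finset.sum_congr rfl fun i _ => ?_
    rw [← natCast_zsmul, Int.ofNat_natAbs_of_nonpos (h i), neg_smul, neg_neg]

end SimpleSystem

/-- In integral coordinates the determinant is an integer; its vanishing over the reals is its
vanishing over the integers, which yields an integral kernel vector. -/
lemma exists_int_relation {κ κ' : Type*} [Fintype κ] [Fintype κ']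
    (B : Module.Basis κ' ℝ V) (hcard : Fintype.card κ = Fintype.card κ') {v : κ → V}
    (hv : ∀ i, ∃ m : κ' → ℤ, v i = ∑ j, m j • B j) (hli : ¬ LinearIndependent ℝ v) :
    ∃ c : κ → ℤ, c ≠ 0 ∧ ∑ i, c i • v i = 0 := by
  classical
  choose m hm using hv
  let e : κ ≃ κ' := Fintype.equivOfCardEq hcard
  let A : Matrix κ κ ℤ := fun i j => m i (e j)
  have hsum : ∀ g : κ → ℝ, ∑ i, g i • v i = ∑ j, (∑ i, g i * m i (e j)) • B (e j) := fun g => by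
    have : ∀ i, v i = ∑ j, (m i (e j) : ℝ) • B (e j) := fun i => by
      rw [hm, ← e.sum_comp]
      simp [Int.cast_smul_eq_zsmul]
    simp_rw [this, Finset.smul_sum, Finset.sum_smul, smul_smul]
    exact Finset.sum_comm
  rw [Fintype.linearIndependent_iff] at hli
  push Not at hli
  obtain ⟨g, hg, i₀, hi₀⟩ := hli
  rw [hsum] at hg
  have hg' : ∀ j, ∑ i, g i * m i (e j) = 0 :=
    Fintype.linearIndependent_iff.1 (B.linearIndependent.comp e e.injective) _ hg
  have hdet : (A.map (Int.castRingHom ℝ)).det = 0 :=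
    Matrix.exists_vecMul_eq_zero_iff.1 ⟨g, fun h => hi₀ (congrFun h i₀), by
      funext j; exact hg' j⟩
  have hdet' : A.det = 0 := by
    have := (Int.castRingHom ℝ).map_det A
    rw [RingHom.mapMatrix_apply, hdet] at this
    exact Int.cast_eq_zero.1 this
  obtain ⟨c, hc, hcA⟩ := Matrix.exists_vecMul_eq_zero_iff.2 hdet'
  refine ⟨c, hc, ?_⟩
  have h1 := hsum fun i => (c i : ℝ)
  simp only [Int.cast_smul_eq_zsmul] at h1
  rw [h1]
  refine Finset.sum_eq_zero fun j _ => ?_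
  have h2 : ∑ i, c i * m i (e j) = 0 := by
    simpa [Matrix.vecMul, dotProduct, A] using congrFun hcA j
  have h3 : ∑ i, (c i : ℝ) * m i (e j) = 0 := by exact_mod_cast h2
  rw [h3, zero_smul]

/-- The relation equates the part with positive coefficients and the part with negative ones. Their
supports are disjoint, so by obtuseness their inner product, which is the squared norm of either, is
$\le0$. -/
lemma sum_posPart_eq_zero {κ : Type*} [Fintype κ] {v : κ → V}
    (hobt : ∀ i j, i ≠ j → ⟪v i, v j⟫ ≤ 0) {c : κ → ℤ} (hc : ∑ i, c i • v i = 0) :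
    ∑ i, (c i)⁺ • v i = 0 := by
  have h1 : ∑ i, (c i)⁺ • v i = ∑ i, (c i)⁻ • v i := by
    rw [← sub_eq_zero, ← Finset.sum_sub_distrib, ← hc]
    exact Finset.sum_congr rfl fun i _ => by rw [← sub_smul, posPart_sub_negPart]
  have h2 : ⟪∑ i, (c i)⁺ • v i, ∑ j, (c j)⁺ • v j⟫ ≤ 0 := by
    conv_lhs => rw [h1]
    rw [← h1]
    conv_lhs => arg 2; rw [h1]
    simp only [← Int.cast_smul_eq_zsmul ℝ, inner_sum, sum_inner, inner_smul_left, inner_smul_right,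
      Finset.mul_sum]
    refine Finset.sum_nonpos fun i _ => Finset.sum_nonpos fun j _ => ?_
    by_cases hij : i = j
    · subst hij
      rcases le_total (c i) 0 with h | h
      · simp [posPart_eq_zero.2 h]
      · simp [negPart_eq_zero.2 h]
    · have h3 : (0 : ℝ) ≤ (c i)⁺ := by exact_mod_cast posPart_nonneg (c i)
      have h4 : (0 : ℝ) ≤ (c j)⁻ := by exact_mod_cast negPart_nonneg (c j)
      have h5 := hobt _ _ hij
      have h6 := hobt _ _ (Ne.symm hij)
      simp only [conj_trivial]
      exact mul_nonpos_of_nonneg_of_nonpos h3 (mul_nonpos_of_nonneg_of_nonpos h4 h6)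
  have h3 : ⟪∑ i, (c i)⁺ • v i, ∑ j, (c j)⁺ • v j⟫ = 0 := le_antisymm h2 real_inner_self_nonneg
  exact inner_self_eq_zero.1 h3

/-! ### The roots at which the denominator vanishes -/

section Vanishing

variable {q : ℝ} {k : ℝ → ℂ} {νlng : ℕ} {κ : Type*} [Fintype κ]

/-- Every `t_γ`, for `γ` an affine root, is one of `t_sht`, `t_lng`. -/
lemma tPar_eq_or (hν : ∀ α ∈ R, nu α = 1 ∨ nu α = νlng) (k : ℝ → ℂ) {γ : V × ℝ}
    (hγ : γ.1 ∈ R) : tPar q k γ = tOf q k 1 ∨ tPar q k γ = tOf q k νlng := by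
  rcases hν _ hγ with h | h <;> simp [tPar, h]

omit [Fintype κ] in
lemma exists_prod_zpow_tPar (hν : ∀ α ∈ R, nu α = 1 ∨ nu α = νlng) (hq : 0 < q) {β : κ → V × ℝ}
    (hβ : ∀ i, (β i).1 ∈ R) (s : Finset κ) (m : κ → ℤ) :
    ∃ l₁ l₂ : ℤ, ∏ i ∈ s, tPar q k (β i) ^ m i = tOf q k 1 ^ l₁ * tOf q k νlng ^ l₂ := by
  classical
  have h1 : ∀ ν, tOf q k ν ≠ 0 := fun ν => by simp [tOf, Complex.cpow_eq_zero_iff, hq.ne']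
  induction s using Finset.induction_on with
  | empty => exact ⟨0, 0, by simp⟩
  | insert i s hi ih =>
    obtain ⟨l₁, l₂, h⟩ := ih
    rw [Finset.prod_insert hi, h]
    rcases tPar_eq_or hν k (hβ i) with h2 | h2
    · exact ⟨m i + l₁, l₂, by rw [h2, zpow_add₀ (h1 _), mul_assoc]⟩
    · exact ⟨l₁, m i + l₂, by rw [h2, zpow_add₀ (h1 _)]; ring⟩

lemma X_sum_zsmul (hq : 0 < q) (m : κ → ℤ) (β : κ → V × ℝ) (x : V →L[ℝ] ℂ) :
    X q (∑ i, m i • β i) x = ∏ i, X q (β i) x ^ m i := by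
  rw [X_sum hq]
  exact Finset.prod_congr rfl fun i _ => X_zsmul _ _ _

variable {ξ : V →L[ℝ] ℂ} {β : κ → V × ℝ}

/-- Roots at which `t X = 1`, under the assumptions on the parameters. -/
structure PoleData (R : Set V) (q : ℝ) (k : ℝ → ℂ) (νlng : ℕ) (ξ : V →L[ℝ] ℂ) (β : κ → V × ℝ) :
    Prop where
  root : IsRootSet R
  nu_eq : ∀ α ∈ R, nu α = 1 ∨ nu α = νlng
  one_le : 1 ≤ νlng
  q_pos : 0 < q
  generic : ∀ m l₁ l₂ : ℤ, m ≠ 0 → (q : ℂ) ^ m ≠ tOf q k 1 ^ l₁ * tOf q k νlng ^ l₂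
  numerator : ∀ γ ∈ affRoots R, X q γ ξ ≠ 1
  param : tOf q k 1 = tOf q k νlng ∨ tOf q k 1 ^ νlng = tOf q k νlng
  inj : Function.Injective β
  mem : ∀ i, β i ∈ affRoots R
  pole : ∀ i, tPar q k (β i) * X q (β i) ξ = 1

namespace PoleData

variable (h : PoleData R q k νlng ξ β)
include h

omit [Fintype κ] in
lemma X_eq (i : κ) : X q (β i) ξ = (tPar q k (β i))⁻¹ :=
  eq_inv_of_mul_eq_one_right (h.pole i)

-- Two poles with the same nonaffine component would give $q^m=1$ with $m\ne0$, against genericity.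
omit [Fintype κ] in
lemma fst_ne {i j : κ} (hij : i ≠ j) : (β i).1 ≠ (β j).1 := by
  intro h1
  have h2 : X q (β i - β j) ξ = 1 := by
    rw [X_sub h.q_pos, h.X_eq, h.X_eq, show tPar q k (β i) = tPar q k (β j) by rw [tPar, tPar, h1]]
    exact div_self (inv_ne_zero (tPar_ne_zero h.q_pos k (β j)))
  obtain ⟨a, ha⟩ := h.root.exists_int_snd (h.mem i)
  obtain ⟨b, hb⟩ := h.root.exists_int_snd (h.mem j)
  have h3 : β i - β j = (0, ((a - b : ℤ) : ℝ)) :=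
    Prod.ext (by simp [h1]) (by simp [ha, hb])
  rw [h3, X_imag] at h2
  by_cases h4 : a - b = 0
  · exact hij (h.inj (Prod.ext h1 (by rw [ha, hb, sub_eq_zero.1 h4])))
  · exact h.generic _ 0 0 h4 (by simpa using h2)

omit [Fintype κ] in
lemma sub_notMem_of_tPar_eq {i j : κ} (ht : tPar q k (β i) = tPar q k (β j)) :
    β i - β j ∉ affRoots R := fun hm => h.numerator _ hm <| by
  rw [X_sub h.q_pos, h.X_eq, h.X_eq, ht, div_self (inv_ne_zero (tPar_ne_zero h.q_pos k _))]

omit [Fintype κ] h in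
lemma tPar_eq_of_nu_eq {i j : κ} (hn : nu (β i).1 = nu (β j).1) :
    tPar q k (β i) = tPar q k (β j) := by rw [tPar, tPar, hn]

-- At an acute angle the inner product would be $\nu_{lng}$, and reflecting the long root in the
-- short one would give the affine root $\tilde\beta_i-\nu_{lng}\tilde\beta_j$, at which
-- $X=t_{lng}^{-1}t_{sht}^{\nu_{lng}}=1$.
omit [Fintype κ] in
lemma inner_nonpos_aux {i j : κ} (hij : i ≠ j) (hi : nu (β i).1 = νlng) (hj : nu (β j).1 = 1)
    (hne : nu (β i).1 ≠ nu (β j).1) (hpow : tOf q k 1 ^ νlng = tOf q k νlng) :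
    ⟪(β i).1, (β j).1⟫ ≤ 0 := by
  by_contra! hpos
  have hin : ⟪(β i).1, (β j).1⟫ = νlng := by
    rcases h.root.inner_eq_or (h.mem i).1 (h.mem j).1 (h.fst_ne hij) hpos with h1 | h1
    · rw [h1, hi]
    · obtain ⟨m, hm⟩ := h.root.integral _ (h.mem i).1 _ (h.mem j).1
      rw [real_inner_comm, h1, hj, hi] at hm
      have h2 : (νlng : ℤ) * m = 1 := by exact_mod_cast hm.symm
      have h3 : (νlng : ℤ) = 1 := Int.eq_one_of_mul_eq_one_right (by positivity) h2
      exfalso; apply hne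
      rw [hi, hj]; exact_mod_cast h3
  have h1 := h.root.affReflect_mem (h.mem j) (h.mem i)
  rw [IsRootSet.affReflect_eq, hin, hj, div_one] at h1
  refine h.numerator _ h1 ?_
  have h2 : ((νlng : ℕ) : ℝ) • β j = (νlng : ℤ) • β j := by
    rw [← Int.cast_smul_eq_zsmul ℝ]; simp
  have h3 : tOf q k νlng ≠ 0 := by simp [tOf, Complex.cpow_eq_zero_iff, h.q_pos.ne']
  rw [h2, X_sub h.q_pos, X_zsmul, h.X_eq, h.X_eq, tPar, tPar, hi, hj]
  rw [zpow_natCast, inv_pow]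
  simp only [hpow, div_self (inv_ne_zero h3)]

omit [Fintype κ] in
lemma inner_nonpos {i j : κ} (hij : i ≠ j) : ⟪(β i).1, (β j).1⟫ ≤ 0 := by
  by_contra! hpos
  by_cases ht : tPar q k (β i) = tPar q k (β j)
  · exact h.sub_notMem_of_tPar_eq ht (h.root.sub_mem_aff (h.mem i) (h.mem j) (h.fst_ne hij) hpos)
  have hne : nu (β i).1 ≠ nu (β j).1 := fun hn => ht (tPar_eq_of_nu_eq hn)
  have hpow : tOf q k 1 ^ νlng = tOf q k νlng := by
    refine h.param.resolve_left fun h1 => ht ?_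
    rcases tPar_eq_or h.nu_eq k (h.mem i).1 with h2 | h2 <;>
      rcases tPar_eq_or h.nu_eq k (h.mem j).1 with h3 | h3 <;> rw [h2, h3] <;> simp [h1]
  rcases h.nu_eq _ (h.mem i).1 with h1 | h1 <;> rcases h.nu_eq _ (h.mem j).1 with h2 | h2
  · exact hne (h1.trans h2.symm)
  · rw [real_inner_comm] at hpos
    exact absurd (h.inner_nonpos_aux (Ne.symm hij) h2 h1 hne.symm hpow) (not_le.2 hpos)
  · exact absurd (h.inner_nonpos_aux hij h1 h2 hne hpow) (not_le.2 hpos)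
  · exact hne (h1.trans h2.symm)

-- For obtuse vectors the squared length of the difference is at least the sum of the squared
-- lengths, while no root is longer than the long ones. This forces both poles to be short if their
-- difference is a root.
omit [Fintype κ] in
lemma nu_sub_le {i j : κ} (hij : i ≠ j) (hm : (β i).1 - (β j).1 ∈ R) :
    nu (β i).1 + nu (β j).1 ≤ νlng := by
  have h1 := nu_sub (β i).1 (β j).1
  have h2 := h.inner_nonpos hij
  have h3 : (1 : ℝ) ≤ νlng := by exact_mod_cast h.one_le
  rcases h.nu_eq _ hm with h4 | h4 <;> linarith

omit [Fintype κ] in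
lemma nu_eq_one_of_sub_mem {i j : κ} (hij : i ≠ j) (hm : (β i).1 - (β j).1 ∈ R) :
    nu (β i).1 = 1 ∧ nu (β j).1 = 1 := by
  have h1 := h.nu_sub_le hij hm
  have h2 := h.root.nu_pos (h.mem i).1
  have h3 := h.root.nu_pos (h.mem j).1
  constructor
  · refine (h.nu_eq _ (h.mem i).1).resolve_right fun h4 => ?_
    linarith
  · refine (h.nu_eq _ (h.mem j).1).resolve_right fun h4 => ?_
    linarith

omit [Fintype κ] in
lemma zero_notMem : (0 : V × ℝ) ∉ affRoots R := fun h0 => h.root.ne_zero _ h0.1 rfl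

omit [Fintype κ] in
lemma sub_notMem (i j : κ) : β i - β j ∉ affRoots R := by
  by_cases hij : i = j
  · rw [hij, sub_self]; exact h.zero_notMem
  intro hm
  obtain ⟨h1, h2⟩ := h.nu_eq_one_of_sub_mem hij hm.1
  exact h.sub_notMem_of_tPar_eq (tPar_eq_of_nu_eq (h1.trans h2.symm)) hm

-- If the nonaffine difference is a root, both poles are short. A short difference has an admissible
-- affine component automatically; for a long one divisibility by $\nu_{lng}$ is needed, and this is
-- what the exceptional case violates. Otherwise the difference of the poles would be an affine
-- root.
omit [Fintype κ] in
lemma fst_sub_notMem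
    (hex : ¬ ∃ i j, nu (β i).1 = 1 ∧ nu (β j).1 = 1 ∧ (β i - β j).1 ∈ R ∧
      nu (β i - β j).1 = νlng ∧ ¬ ∃ m : ℤ, (β i - β j).2 = νlng * m) (i j : κ) :
    (β i).1 - (β j).1 ∉ R := by
  by_cases hij : i = j
  · rw [hij, sub_self]; exact fun h0 => h.root.ne_zero _ h0 rfl
  intro hm
  obtain ⟨h1, h2⟩ := h.nu_eq_one_of_sub_mem hij hm
  refine h.sub_notMem i j ⟨hm, ?_⟩
  rcases h.nu_eq _ hm with h4 | h4
  · obtain ⟨a, ha⟩ := h.root.exists_int_snd (h.mem i)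
    obtain ⟨b, hb⟩ := h.root.exists_int_snd (h.mem j)
    refine ⟨a - b, ?_⟩
    change (β i).2 - (β j).2 = nu ((β i).1 - (β j).1) * _
    rw [h4, ha, hb]; simp
  · by_contra hcon
    refine hex ⟨i, j, h1, h2, hm, h4, ?_⟩
    change ¬ ∃ m : ℤ, _ = nu ((β i).1 - (β j).1) * _ at hcon
    rwa [h4] at hcon

/-- A dependence may be taken integral, and by obtuseness its positive part is a relation too.
Evaluating $X$ there gives a power of $q$ that is a monomial in the $t$, so by genericity the
exponent $\sum c_i^+a_i$ is $0$. As $a_i\ge0$, only roots with affine component $0$ occur; these are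
positive on $r$, so $c_i^+=0$. The same for $-c$ shows that $c=0$. -/
lemma linearIndependent {κ' : Type*} [Fintype κ'] {r : V} (hpos : IsPositive R Rpos r)
    (hβpos : ∀ i, β i ∈ affPos R Rpos) (B : Module.Basis κ' ℝ V)
    (hB : ∀ α ∈ R, ∃ m : κ' → ℤ, α = ∑ j, m j • B j) (hcard : Fintype.card κ = Fintype.card κ') :
    LinearIndependent ℝ fun i => (β i).1 := by
  by_contra hli
  obtain ⟨c, hc0, hc⟩ := exists_int_relation B hcard (fun i => hB _ (h.mem i).1) hli
  have key : ∀ c : κ → ℤ, ∑ i, c i • (β i).1 = 0 → ∀ i, c i ≤ 0 := by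
    intro c hc
    have hd := sum_posPart_eq_zero (fun i j hij => h.inner_nonpos hij) hc
    have hsnd : ∀ i, ∃ a : ℤ, (β i).2 = a := fun i => h.root.exists_int_snd (h.mem i)
    choose a ha using hsnd
    have h1 : ∑ i, (c i)⁺ • β i = (0, ((∑ i, (c i)⁺ * a i : ℤ) : ℝ)) := by
      refine Prod.ext ?_ ?_
      · simpa [Prod.fst_sum] using hd
      · simp [Prod.snd_sum, ha]
    have h2 : (q : ℂ) ^ (∑ i, (c i)⁺ * a i) = ∏ i, tPar q k (β i) ^ (-(c i)⁺) := by
      rw [← X_imag (q := q) (V := V) _ ξ, ← h1, X_sum_zsmul h.q_pos]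
      exact Finset.prod_congr rfl fun i _ => by rw [h.X_eq, inv_zpow, zpow_neg]
    have h3 : ∑ i, (c i)⁺ * a i = 0 := by
      by_contra h4
      obtain ⟨l₁, l₂, h5⟩ := exists_prod_zpow_tPar (k := k) h.nu_eq h.q_pos (fun i => (h.mem i).1)
        Finset.univ fun i => -(c i)⁺
      exact h.generic _ l₁ l₂ h4 (h2.trans h5)
    have h4 : ∀ i, 0 ≤ a i := fun i => by
      have : (0 : ℝ) ≤ a i := by
        rw [← ha]
        rcases (hβpos i).2 with h | h
        · exact h.le
        · exact h.1.ge
      exact_mod_cast this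
    have h5 : ∀ i, (c i)⁺ * a i = 0 := fun i =>
      (Finset.sum_eq_zero_iff_of_nonneg fun i _ => mul_nonneg (posPart_nonneg _) (h4 i)).1 h3 i
        (Finset.mem_univ i)
    have h6 : ∑ i, (((c i)⁺ : ℤ) : ℝ) * ⟪r, (β i).1⟫ = 0 := by
      have := congrArg (fun v => ⟪r, v⟫) hd
      simpa [inner_sum, ← Int.cast_smul_eq_zsmul ℝ, inner_smul_right] using this
    have h7 : ∀ i, 0 ≤ (((c i)⁺ : ℤ) : ℝ) * ⟪r, (β i).1⟫ := fun i => by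
      rcases mul_eq_zero.1 (h5 i) with h8 | h8
      · simp [h8]
      · have h9 : (β i).2 = 0 := by rw [ha, h8]; simp
        have h10 := (hβpos i).2.resolve_left (by rw [h9]; exact lt_irrefl _)
        exact mul_nonneg (by exact_mod_cast posPart_nonneg _) ((hpos.mem_iff _).1 h10.2).2.le
    intro i
    have h8 := (Finset.sum_eq_zero_iff_of_nonneg fun i _ => h7 i).1 h6 i (Finset.mem_univ i)
    rcases mul_eq_zero.1 h8 with h9 | h9
    · exact posPart_eq_zero.1 (by exact_mod_cast h9)
    · exact absurd h9 (hpos.inner_ne _ (h.mem i).1)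
  refine hc0 (funext fun i => le_antisymm (key c hc i) ?_)
  have := key (-c) (by simpa using hc) i
  simpa using this

variable (hli : LinearIndependent ℝ fun i => (β i).1)
include hli

lemma isSimpleSystem_affSpanRoots : IsSimpleSystem (affSpanRoots R β) β := by
  have hsp : ∀ i, β i ∈ Submodule.span ℤ (Set.range β) := fun i => Submodule.subset_span ⟨i, rfl⟩
  refine isSimpleSystem_of_sub_notMem (p := LinearMap.fst ℝ V ℝ) hli (fun i => ⟨h.mem i, hsp i⟩)
    (fun γ hγ => ?_) (fun γ hγ => ⟨h.root.neg_mem_aff hγ.1, Submodule.neg_mem _ hγ.2⟩)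
    (fun h0 => h.zero_notMem h0.1) (fun γ hγ i hne hin =>
      ⟨h.root.sub_mem_aff hγ.1 (h.mem i) hne hin, Submodule.sub_mem _ hγ.2 (hsp i)⟩)
    (fun i j hij => h.inner_nonpos hij) (fun i j hm => h.sub_notMem i j hm.1)
  obtain ⟨m, hm⟩ := (Submodule.mem_span_range_iff_exists_fun ℤ).1 hγ.2
  exact ⟨m, hm.symm⟩

lemma isSimpleSystem_spanRoots
    (hex : ¬ ∃ i j, nu (β i).1 = 1 ∧ nu (β j).1 = 1 ∧ (β i - β j).1 ∈ R ∧
      nu (β i - β j).1 = νlng ∧ ¬ ∃ m : ℤ, (β i - β j).2 = νlng * m) :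
    IsSimpleSystem (spanRoots R β) fun i => (β i).1 := by
  have hsp : ∀ i, (β i).1 ∈ Submodule.span ℤ (Set.range fun i => (β i).1) :=
    fun i => Submodule.subset_span ⟨i, rfl⟩
  refine isSimpleSystem_of_sub_notMem (p := LinearMap.id) hli (fun i => ⟨(h.mem i).1, hsp i⟩)
    (fun γ hγ => ?_) (fun γ hγ => ⟨h.root.neg_mem hγ.1, Submodule.neg_mem _ hγ.2⟩)
    (fun h0 => h.root.ne_zero _ h0.1 rfl) (fun γ hγ i hne hin =>
      ⟨h.root.sub_mem hγ.1 (h.mem i).1 hne hin, Submodule.sub_mem _ hγ.2 (hsp i)⟩)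
    (fun i j hij => h.inner_nonpos hij) (fun i j hm => h.fst_sub_notMem hex i j hm.1)
  obtain ⟨m, hm⟩ := (Submodule.mem_span_range_iff_exists_fun ℤ).1 hγ.2
  exact ⟨m, hm.symm⟩

omit h in
lemma injOn_fst_affSpanRoots : Set.InjOn Prod.fst (affSpanRoots R β) := by
  rintro γ ⟨-, hγ⟩ δ ⟨-, hδ⟩ hγδ
  obtain ⟨m, rfl⟩ := (Submodule.mem_span_range_iff_exists_fun ℤ).1 hγ
  obtain ⟨m', rfl⟩ := (Submodule.mem_span_range_iff_exists_fun ℤ).1 hδ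
  rw [int_coeff_eq (p := LinearMap.fst ℝ V ℝ) hli hγδ]

lemma finite_affSpanRoots : (affSpanRoots R β).Finite :=
  Set.Finite.of_finite_image (h.root.finite.subset (by rintro _ ⟨γ, hγ, rfl⟩; exact hγ.1.1))
    (injOn_fst_affSpanRoots hli)

omit hli [Fintype κ] in
lemma isClosedSubsystem_affSpanRoots : IsClosedSubsystem (affRoots R) (affSpanRoots R β) := by
  refine ⟨fun γ hγ => hγ.1, fun γ hγ δ hδ => ⟨h.root.affReflect_mem hγ.1 hδ.1, ?_⟩,
    fun γ hγ δ hδ hm => ⟨hm, Submodule.add_mem _ hγ.2 hδ.2⟩⟩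
  obtain ⟨m, hm⟩ := h.root.integral _ hγ.1.1 _ hδ.1.1
  rw [IsRootSet.affReflect_eq, hm, mul_div_cancel_left₀ _ (h.root.nu_pos hγ.1.1).ne',
    Int.cast_smul_eq_zsmul]
  exact Submodule.sub_mem _ hδ.2 (Submodule.smul_mem _ _ hγ.2)

lemma span_fst_affSpanRoots [FiniteDimensional ℝ V]
    (hcard : Fintype.card κ = Module.finrank ℝ V) :
    Submodule.span ℝ (Prod.fst '' affSpanRoots R β) = ⊤ := by
  rw [eq_top_iff, ← hli.span_eq_top_of_card_eq_finrank' hcard]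
  refine Submodule.span_mono ?_
  rintro _ ⟨i, rfl⟩
  exact ⟨β i, ⟨h.mem i, Submodule.subset_span ⟨i, rfl⟩⟩, rfl⟩

end PoleData

end Vanishing

end Roots

/-! ### The action of affine isometries on roots, points and products -/

section Transformations

variable {V : Type*} [NormedAddCommGroup V] [InnerProductSpace ℝ V] {R Rpos : Set V}

/-- The linear maps `[z, ζ] ↦ [w z, ζ - (w z, c)]` with `w` an isometry. -/
def IsAffineIsometry (g : (V × ℝ) ≃ₗ[ℝ] (V × ℝ)) : Prop :=
  ∃ (c : V) (w : V ≃ₗ[ℝ] V), (∀ z z', ⟪w z, w z'⟫ = ⟪z, z'⟫) ∧ g = extElt c w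

namespace IsAffineIsometry

variable {g g' : (V × ℝ) ≃ₗ[ℝ] (V × ℝ)}

lemma one : IsAffineIsometry (1 : (V × ℝ) ≃ₗ[ℝ] (V × ℝ)) :=
  ⟨0, 1, fun _ _ => rfl, by ext z <;> simp [extElt]⟩

lemma mul (hg : IsAffineIsometry g) (hg' : IsAffineIsometry g') : IsAffineIsometry (g * g') := by
  obtain ⟨c, w, hw, rfl⟩ := hg
  obtain ⟨c', w', hw', rfl⟩ := hg'
  refine ⟨c + w c', w * w', fun z z' => by simp [hw, hw'], ?_⟩
  ext z <;> simp [extElt, inner_add_right, hw]; ring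

lemma inv (hg : IsAffineIsometry g) : IsAffineIsometry g⁻¹ := by
  obtain ⟨c, w, hw, rfl⟩ := hg
  have hw' : ∀ z z', ⟪w⁻¹ z, z'⟫ = ⟪z, w z'⟫ := fun z z' => by
    rw [← hw, ← LinearEquiv.mul_apply, mul_inv_cancel]; rfl
  refine ⟨-(w⁻¹ c), w⁻¹, fun z z' => ?_, ?_⟩
  · rw [hw', ← LinearEquiv.mul_apply, mul_inv_cancel]; rfl
  · refine LinearEquiv.ext fun z => ?_
    refine Prod.ext rfl ?_
    change z.2 + ⟪z.1, c⟫ = z.2 - ⟪w⁻¹ z.1, -(w⁻¹ c)⟫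
    rw [hw', map_neg, ← LinearEquiv.mul_apply, mul_inv_cancel, inner_neg_right, sub_neg_eq_add]
    rfl

lemma map_imag (hg : IsAffineIsometry g) (m : ℝ) : g (0, m) = (0, m) := by
  obtain ⟨c, w, hw, rfl⟩ := hg
  simp [extElt]

lemma inner_map (hg : IsAffineIsometry g) (γ δ : V × ℝ) : ⟪(g γ).1, (g δ).1⟫ = ⟪γ.1, δ.1⟫ := by
  obtain ⟨c, w, hw, rfl⟩ := hg
  exact hw _ _

lemma nu_map (hg : IsAffineIsometry g) (γ : V × ℝ) : nu (g γ).1 = nu γ.1 := by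
  rw [nu, nu, hg.inner_map]

lemma tPar_map (hg : IsAffineIsometry g) (q : ℝ) (k : ℝ → ℂ) (γ : V × ℝ) :
    tPar q k (g γ) = tPar q k γ := by
  rw [tPar, tPar, hg.nu_map]

variable [FiniteDimensional ℝ V]

lemma affEval_actPt (hg : IsAffineIsometry g) (x : V →L[ℝ] ℂ) (γ : V × ℝ) :
    affEval (actPt g x) (g γ) = affEval x γ := by
  have h1 : γ = g.symm ((g γ).1, 0) + g.symm (0, (g γ).2) := by
    rw [← map_add, Prod.mk_add_mk, add_zero, zero_add, LinearEquiv.symm_apply_apply]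
  have h2 : g.symm (0, (g γ).2) = (0, (g γ).2) := by
    rw [LinearEquiv.symm_apply_eq, hg.map_imag]
  conv_rhs => rw [h1, affEval_add, h2]
  simp [affEval, actPt]

lemma X_actPt (hg : IsAffineIsometry g) (q : ℝ) (x : V →L[ℝ] ℂ) (γ : V × ℝ) :
    X q (g γ) (actPt g x) = X q γ x := by
  rw [X, X, hg.affEval_actPt]

lemma X_actPt' (hg : IsAffineIsometry g) (q : ℝ) (x : V →L[ℝ] ℂ) (γ : V × ℝ) :
    X q γ (actPt g x) = X q (g⁻¹ γ) x := by
  conv_lhs => rw [show γ = g (g⁻¹ γ) from (g.apply_symm_apply γ).symm, hg.X_actPt]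

lemma deletedFactor_actPt (hg : IsAffineIsometry g) (q : ℝ) (k : ℝ → ℂ) (S : Set (V × ℝ))
    (x : V →L[ℝ] ℂ) (γ : V × ℝ) :
    deletedFactor q k (g '' S) (actPt g x) (g γ) = deletedFactor q k S x γ := by
  have h : g γ ∈ g '' S ↔ γ ∈ S := g.injective.mem_set_image
  by_cases hγ : γ ∈ S
  · simp only [deletedFactor, hg.X_actPt, hg.tPar_map, hγ, h.2 hγ, if_true]
  · simp only [deletedFactor, hg.X_actPt, hg.tPar_map, hγ, mt h.1 hγ, if_false]

end IsAffineIsometry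

lemma actPt_actPt_inv [FiniteDimensional ℝ V] {g : (V × ℝ) ≃ₗ[ℝ] (V × ℝ)}
    (hg : IsAffineIsometry g) (x : V →L[ℝ] ℂ) : actPt g (actPt g⁻¹ x) = x := by
  ext v
  have h1 := hg.affEval_actPt (actPt g⁻¹ x) (g⁻¹ (v, 0))
  rw [hg.inv.affEval_actPt, show g (g⁻¹ (v, 0)) = (v, 0) from g.apply_symm_apply _] at h1
  simpa [affEval] using h1

lemma affReflect_affReflect {γ : V × ℝ} (hγ : γ.1 ≠ 0) (z : V × ℝ) :
    affReflect γ (affReflect γ z) = z := by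
  have hn : nu γ.1 ≠ 0 := by simpa [nu] using hγ
  rw [IsRootSet.affReflect_eq, IsRootSet.affReflect_eq]
  have : ⟪(z - (⟪z.1, γ.1⟫ / nu γ.1) • γ).1, γ.1⟫ / nu γ.1 = -(⟪z.1, γ.1⟫ / nu γ.1) := by
    rw [Prod.fst_sub, Prod.smul_fst, inner_sub_left, inner_smul_left, inner_self_eq_nu]
    simp only [conj_trivial]
    field_simp; ring
  rw [this, neg_smul, sub_neg_eq_add, sub_add_cancel]

/-- For $\gamma=[\alpha,m]$ the reflection is the linear reflection in $\alpha$ followed by the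
translation by $-(m/\nu_\alpha)\alpha$. -/
lemma isAffineIsometry_of_affReflect {γ : V × ℝ} (hγ : γ.1 ≠ 0) {g : (V × ℝ) ≃ₗ[ℝ] (V × ℝ)}
    (hg : ∀ z, g z = affReflect γ z) : IsAffineIsometry g := by
  have hn : nu γ.1 ≠ 0 := by simpa [nu] using hγ
  let w := (Submodule.reflection (ℝ ∙ γ.1)ᗮ).toLinearEquiv
  have hw : ∀ z, w z = z - (⟪z, γ.1⟫ / nu γ.1) • γ.1 := fun z => by
    change Submodule.reflection (ℝ ∙ γ.1)ᗮ z = _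
    rw [Submodule.reflection_orthogonal_apply, Submodule.reflection_singleton_apply,
      RCLike.ofReal_real_eq_id, id_eq, ← real_inner_self_eq_norm_sq, inner_self_eq_nu,
      real_inner_comm, neg_sub, ← Nat.cast_smul_eq_nsmul ℝ, smul_smul]
    congr 2
    field_simp
    push_cast
    ring
  refine ⟨-((γ.2 / nu γ.1) • γ.1), w, fun z z' => LinearIsometryEquiv.inner_map_map _ _ _,
    LinearEquiv.ext fun z => ?_⟩
  rw [hg, IsRootSet.affReflect_eq]
  refine Prod.ext (hw z.1).symm ?_
  change z.2 - (⟪z.1, γ.1⟫ / nu γ.1) * γ.2 = z.2 - ⟪w z.1, -((γ.2 / nu γ.1) • γ.1)⟫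
  rw [hw, inner_neg_right, inner_smul_right, inner_sub_left, inner_smul_left, inner_self_eq_nu]
  simp only [conj_trivial]
  field_simp
  ring

lemma affWeyl_induction {Φ : Set (V × ℝ)} (hR : IsRootSet R) (hΦ : Φ ⊆ affRoots R)
    {g : (V × ℝ) ≃ₗ[ℝ] (V × ℝ)} (hg : g ∈ affWeyl Φ) :
    IsAffineIsometry g ∧ (∀ γ ∈ affRoots R, g γ ∈ affRoots R) ∧
      ∀ γ ∈ affRoots R, g⁻¹ γ ∈ affRoots R := by
  induction hg using Subgroup.closure_induction with
  | mem g hg =>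
    obtain ⟨γ, hγ, h⟩ := hg
    have h1 := isAffineIsometry_of_affReflect (hR.ne_zero _ (hΦ hγ).1) h
    have h2 : ∀ δ ∈ affRoots R, g δ ∈ affRoots R := fun δ hδ => by
      rw [h]; exact hR.affReflect_mem (hΦ hγ) hδ
    refine ⟨h1, h2, fun δ hδ => ?_⟩
    have h3 : g⁻¹ δ = g δ := by
      rw [show g⁻¹ δ = g.symm δ from rfl, LinearEquiv.symm_apply_eq, h, h, affReflect_affReflect
        (hR.ne_zero _ (hΦ hγ).1)]
    rw [h3]; exact h2 δ hδ
  | one => exact ⟨.one, fun _ h => h, fun _ h => by rwa [inv_one]⟩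
  | mul g g' _ _ h h' =>
    exact ⟨h.1.mul h'.1, fun γ hγ => h.2.1 _ (h'.2.1 _ hγ), fun γ hγ => by
      rw [mul_inv_rev]; exact h'.2.2 _ (h.2.2 _ hγ)⟩
  | inv g _ h => exact ⟨h.1.inv, h.2.2, by simpa using h.2.1⟩

/-! ### Positive sets -/

/-- `Ψ` contains exactly one of `γ`, `-γ` for every `γ` in `Φ`. -/
structure IsHalf (Φ Ψ : Set (V × ℝ)) : Prop where
  subset : Ψ ⊆ Φ
  total : ∀ γ ∈ Φ, γ ∈ Ψ ∨ -γ ∈ Ψ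
  disjoint : ∀ γ ∈ Ψ, -γ ∉ Ψ

lemma isHalf_affPos (hR : IsRootSet R) {r : V} (hpos : IsPositive R Rpos r) :
    IsHalf (affRoots R) (affPos R Rpos) := by
  refine ⟨fun γ hγ => hγ.1, fun γ hγ => ?_, fun γ hγ hγ' => ?_⟩
  · rcases lt_trichotomy γ.2 0 with h | h | h
    · exact Or.inr ⟨hR.neg_mem_aff hγ, Or.inl (by simpa using h)⟩
    · rcases lt_or_gt_of_ne (hpos.inner_ne _ hγ.1) with h1 | h1
      · refine Or.inr ⟨hR.neg_mem_aff hγ, Or.inr ⟨by simpa using h, (hpos.mem_iff _).2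
          ⟨hR.neg_mem hγ.1, ?_⟩⟩⟩
        simpa [inner_neg_right] using h1
      · exact Or.inl ⟨hγ, Or.inr ⟨h, (hpos.mem_iff _).2 ⟨hγ.1, h1⟩⟩⟩
    · exact Or.inl ⟨hγ, Or.inl h⟩
  · rcases hγ.2 with h | ⟨h, h1⟩ <;> rcases hγ'.2 with h' | ⟨h', h1'⟩
    · simp at h'; linarith
    · simp at h'; linarith
    · simp [h] at h'
    · have := ((hpos.mem_iff _).1 h1).2
      have := ((hpos.mem_iff _).1 h1').2
      simp [inner_neg_right] at this
      linarith

lemma one_le_nu (hR : IsRootSet R) {α : V} (hα : α ∈ R) : 1 ≤ nu α := by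
  obtain ⟨m, hm, h⟩ := hR.exists_nu α hα
  rw [h]; exact_mod_cast hm

lemma snd_nonneg_of_mem_affPos {γ : V × ℝ} (hγ : γ ∈ affPos R Rpos) : 0 ≤ γ.2 := by
  rcases hγ.2 with h | h
  · exact h.le
  · exact h.1.ge

lemma finite_bounded_affRoots (hR : IsRootSet R) (C : ℝ) :
    {γ ∈ affRoots R | |γ.2| ≤ C}.Finite := by
  have h : {γ ∈ affRoots R | |γ.2| ≤ C} ⊆
      (fun p : V × ℤ => (p.1, nu p.1 * p.2)) '' (R ×ˢ Set.Icc (-⌈C⌉) ⌈C⌉) := by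
    rintro ⟨α, m⟩ ⟨⟨h1, j, h2⟩, h3⟩
    refine ⟨(α, j), ⟨h1, ?_⟩, Prod.ext rfl h2.symm⟩
    have h4 : |(j : ℝ)| ≤ ⌈C⌉ := by
      have h5 : 1 ≤ nu α := one_le_nu hR h1
      have h6 : m = nu α * j := h2
      change |m| ≤ C at h3
      rw [h6, abs_mul, abs_of_pos (by linarith)] at h3
      have := Int.le_ceil C
      nlinarith [abs_nonneg (j : ℝ)]
    rw [abs_le] at h4
    exact ⟨by exact_mod_cast h4.1, by exact_mod_cast h4.2⟩
  exact ((hR.finite.prod (Set.finite_Icc _ _)).image _).subset h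

/-- Since $\nu_\alpha\ge1$, the sum is dominated by finitely many copies of the geometric series in
$q$. -/
lemma admissible_affPos (hR : IsRootSet R) {q : ℝ} (hq : 0 < q) (hq1 : q < 1) :
    Admissible q (affPos R Rpos) := by
  refine ⟨?_, hR.finite.subset (by rintro _ ⟨γ, hγ, rfl⟩; exact hγ.1.1)⟩
  have := hR.finite.fintype
  have hex : ∀ γ : affPos R Rpos, ∃ j : ℕ, γ.1.2 = nu γ.1.1 * j := fun γ => by
    obtain ⟨j, hj⟩ := γ.2.1.2
    have h1 := snd_nonneg_of_mem_affPos γ.2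
    have h2 := hR.nu_pos γ.2.1.1
    have h3 : 0 ≤ j := by
      by_contra! h
      have : (j : ℝ) < 0 := by exact_mod_cast h
      nlinarith
    exact ⟨j.toNat, by rw [hj]; congr 1; exact_mod_cast (Int.toNat_of_nonneg h3).symm⟩
  choose j hj using hex
  let f : affPos R Rpos → R × ℕ := fun γ => (⟨γ.1.1, γ.2.1.1⟩, j γ)
  have hf : Function.Injective f := fun γ δ h => by
    simp only [f, Prod.mk.injEq, Subtype.mk.injEq] at h
    exact Subtype.ext (Prod.ext h.1 (by rw [hj, hj, h.1, h.2]))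
  have hs : Summable fun p : R × ℕ => (1 : ℝ) * q ^ p.2 :=
    Summable.mul_of_nonneg (f := fun _ : R => (1 : ℝ)) (g := fun n : ℕ => q ^ n)
      (Summable.of_finite) (summable_geometric_of_lt_one hq.le hq1)
      (fun _ => zero_le_one) fun _ => by positivity
  refine Summable.of_nonneg_of_le (fun _ => by positivity) (fun γ => ?_) (hs.comp_injective hf)
  simp only [Function.comp, f, one_mul]
  rw [← Real.rpow_natCast]
  refine Real.rpow_le_rpow_of_exponent_ge hq hq1.le ?_
  rw [hj]
  nlinarith [one_le_nu hR γ.2.1.1, Nat.cast_nonneg (α := ℝ) (j γ)]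

/-- If $[\alpha,m]$ is positive and its image is negative, then $0\le m\le(w\alpha,c)$, and the
right-hand side is bounded over the finitely many roots. -/
lemma finite_lambdaSet (hR : IsRootSet R) {Ψ : Set (V × ℝ)} (hΨ : Ψ ⊆ affPos R Rpos)
    {g : (V × ℝ) ≃ₗ[ℝ] (V × ℝ)} (hg : IsAffineIsometry g) : (lambdaSet Ψ g).Finite := by
  obtain ⟨c, w, hw, rfl⟩ := hg
  obtain ⟨C, hC⟩ := (hR.finite.image fun α => ⟪w α, c⟫).bddAbove
  refine (finite_bounded_affRoots hR C).subset fun γ hγ => ?_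
  have h1 := snd_nonneg_of_mem_affPos (hΨ hγ.1)
  have h2 := snd_nonneg_of_mem_affPos (hΨ hγ.2)
  have h3 := hC ⟨γ.1, (hΨ hγ.1).1.1, rfl⟩
  refine ⟨(hΨ hγ.1).1, ?_⟩
  rw [abs_of_nonneg h1]
  simp [extElt] at h2
  linarith

/-! ### Transformation of the products -/

section Ratio

variable [FiniteDimensional ℝ V] {q : ℝ} {k : ℝ → ℂ} {Φ Ψ : Set (V × ℝ)}
  {g : (V × ℝ) ≃ₗ[ℝ] (V × ℝ)}

/-- Up to signs $g$ permutes $\Psi$, and the factor of $g\gamma$ at $gx$ is the factor of $\gamma$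
at $x$. On $\Lambda(g)$ the factor of $-g\gamma$ occurs instead, and
$\frac{1-X^{-1}}{1-tX^{-1}}=\frac{t^{-1}-X}{1-t^{-1}X}\cdot\frac{1-X}{1-tX}$. -/
lemma hasProd_deletedFactor_actPt (hq : 0 < q) (hΨ : IsHalf Φ Ψ) (hg : IsAffineIsometry g)
    (hgΦ : ∀ γ ∈ Φ, g γ ∈ Φ) (hgΦ' : ∀ γ ∈ Φ, g⁻¹ γ ∈ Φ) (hfin : (lambdaSet Ψ g).Finite)
    {S : Set (V × ℝ)} (hS : S ⊆ Ψ) (hgS : g '' S ⊆ Ψ) {x : V →L[ℝ] ℂ}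
    (hx : ∀ γ ∈ lambdaSet Ψ g, 1 - tPar q k γ * X q γ x ≠ 0) {r : ℂ}
    (hr : HasProd (fun γ : Ψ => deletedFactor q k S x γ) r) :
    HasProd (fun γ : Ψ => deletedFactor q k (g '' S) (actPt g x) γ)
      ((∏ᶠ γ ∈ lambdaSet Ψ g, ((tPar q k γ)⁻¹ - X q γ x) / (1 - (tPar q k γ)⁻¹ * X q γ x)) *
        r) := by
  classical
  -- The permutation of $\Psi$ induced by $g$ up to sign.
  let σ : Ψ → Ψ := fun γ => if h : g γ ∈ Ψ then ⟨g γ, h⟩ else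
    ⟨-g γ, (hΨ.total _ (hgΦ _ (hΨ.subset γ.2))).resolve_left h⟩
  have hσ : Function.Bijective σ := by
    constructor
    · intro γ δ h
      by_cases h1 : g γ ∈ Ψ <;> by_cases h2 : g δ ∈ Ψ <;>
        simp only [σ, h1, h2, dif_pos, dif_neg, not_false_eq_true, Subtype.mk.injEq] at h
      · exact Subtype.ext (g.injective h)
      · rw [← map_neg] at h
        exact absurd (g.injective h ▸ γ.2) (hΨ.disjoint _ δ.2)
      · rw [← map_neg] at h
        exact absurd ((g.injective h).symm ▸ δ.2) (hΨ.disjoint _ γ.2)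
      · exact Subtype.ext (g.injective (neg_injective h))
    · intro δ
      have h0 : g (g⁻¹ δ.1) = δ := g.apply_symm_apply _
      rcases hΨ.total _ (hgΦ' _ (hΨ.subset δ.2)) with h | h
      · have h1 : g (g⁻¹ δ.1) ∈ Ψ := h0.symm ▸ δ.2
        refine ⟨⟨_, h⟩, ?_⟩
        simp only [σ, h1, dif_pos]
        exact Subtype.ext h0
      · have h1 : g (-g⁻¹ δ.1) ∉ Ψ := by
          rw [map_neg, h0]; exact hΨ.disjoint _ δ.2
        refine ⟨⟨_, h⟩, ?_⟩
        simp only [σ, h1, dif_neg, not_false_eq_true]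
        exact Subtype.ext ((congrArg Neg.neg (map_neg g _)).trans ((neg_neg _).trans h0))
  let c : V × ℝ → ℂ := fun γ => ((tPar q k γ)⁻¹ - X q γ x) / (1 - (tPar q k γ)⁻¹ * X q γ x)
  have hc : HasProd (fun γ : Ψ => if γ.1 ∈ lambdaSet Ψ g then c γ else 1)
      (∏ᶠ γ ∈ lambdaSet Ψ g, c γ) := by
    have hinj : Function.Injective (Subtype.val : Ψ → V × ℝ) := Subtype.val_injective
    have h1 : HasProd (fun γ : V × ℝ => if γ ∈ lambdaSet Ψ g then c γ else 1)
        (∏ᶠ γ ∈ lambdaSet Ψ g, c γ) := by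
      rw [finprod_mem_eq_finite_toFinset_prod _ hfin, Finset.prod_congr rfl (g := fun γ =>
        if γ ∈ lambdaSet Ψ g then c γ else 1) fun γ hγ => by simp [hfin.mem_toFinset.1 hγ]]
      exact hasProd_prod_of_ne_finset_one fun γ hγ => by
        rw [hfin.mem_toFinset] at hγ; simp [hγ]
    refine (hinj.hasProd_iff fun γ hγ => ?_).2 h1
    exact if_neg fun h => hγ ⟨⟨γ, h.1⟩, rfl⟩
  refine (Equiv.ofBijective σ hσ).hasProd_iff.1 ?_
  convert! hc.mul hr using 1
  funext γ
  by_cases h1 : g γ ∈ Ψ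
  · have h2 : γ.1 ∉ lambdaSet Ψ g := fun h => hΨ.disjoint _ h1 h.2
    simp only [Function.comp, Equiv.ofBijective_apply, σ, h1, dif_pos, h2, if_false, one_mul,
      hg.deletedFactor_actPt]
  · have h3 := (hΨ.total _ (hgΦ _ (hΨ.subset γ.2))).resolve_left h1
    have h2 : γ.1 ∈ lambdaSet Ψ g := ⟨γ.2, h3⟩
    have h4 : γ.1 ∉ S := fun h => h1 (hgS ⟨_, h, rfl⟩)
    have h5 : -g γ ∉ g '' S := by
      rintro ⟨δ, hδ, h⟩
      rw [← map_neg] at h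
      exact hΨ.disjoint _ γ.2 (g.injective h ▸ hS hδ)
    simp only [Function.comp, Equiv.ofBijective_apply, σ, h1, dif_neg, not_false_eq_true, h2,
      if_true, c, deletedFactor, h4, h5, if_false]
    rw [X_neg hq, hg.X_actPt, tPar_neg, hg.tPar_map]
    have h6 := hx _ h2
    have h7 := X_ne_zero hq γ.1 x
    have h8 := tPar_ne_zero hq k γ.1
    have h9 : 1 - tPar q k γ.1 * (X q γ x)⁻¹ =
        -(tPar q k γ.1 * (1 - (tPar q k γ.1)⁻¹ * X q γ x)) / X q γ x := by
      field_simp; ring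
    have h10 : (tPar q k γ.1)⁻¹ - X q γ x = (1 - tPar q k γ.1 * X q γ x) / tPar q k γ.1 := by
      field_simp
    rw [h9, h10]
    -- If $1-t^{-1}X=0$, both sides are $0$ by the convention for division.
    by_cases h11 : 1 - (tPar q k γ.1)⁻¹ * X q γ x = 0
    · simp [h11]
    · generalize 1 - (tPar q k γ.1)⁻¹ * X q γ x = D at h11 ⊢
      generalize 1 - tPar q k γ.1 * X q γ x = E at h6 ⊢
      field_simp
      ring

lemma mu_actPt (hq : 0 < q) (hΨ : IsHalf Φ Ψ) (hadm : Admissible q Ψ) (hg : IsAffineIsometry g)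
    (hgΦ : ∀ γ ∈ Φ, g γ ∈ Φ) (hgΦ' : ∀ γ ∈ Φ, g⁻¹ γ ∈ Φ) (hfin : (lambdaSet Ψ g).Finite)
    {x : V →L[ℝ] ℂ} (hx : ∀ γ ∈ lambdaSet Ψ g, 1 - tPar q k γ * X q γ x ≠ 0) :
    mu q k Ψ (actPt g x) = (∏ᶠ γ ∈ lambdaSet Ψ g,
      ((tPar q k γ)⁻¹ - X q γ x) / (1 - (tPar q k γ)⁻¹ * X q γ x)) * mu q k Ψ x := by
  have h := hasProd_deletedFactor_actPt (k := k) hq hΨ hg hgΦ hgΦ' hfin (Set.empty_subset _)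
    (by simp) hx (hadm.multipliable_deletedFactor hq k ∅ x).hasProd
  simp only [Set.image_empty, deletedFactor_empty] at h
  exact h.tprod_eq

lemma hasValueAt_mu_actPt (hq : 0 < q) (hΨ : IsHalf Φ Ψ) (hadm : Admissible q Ψ)
    (hg : IsAffineIsometry g) (hgΦ : ∀ γ ∈ Φ, g γ ∈ Φ) (hgΦ' : ∀ γ ∈ Φ, g⁻¹ γ ∈ Φ)
    (hfin : (lambdaSet Ψ g).Finite) (hΦ : Φ ⊆ affRoots R) {ξ : V →L[ℝ] ℂ}
    (hcl : ξ ∈ closure (regularPts q k R))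
    (hξ : ∀ γ ∈ lambdaSet Ψ g, 1 - (tPar q k γ)⁻¹ * X q γ ξ ≠ 0) :
    HasValueAt (regularPts q k R) (fun x => mu q k Ψ (actPt g x) / mu q k Ψ x) ξ
      (∏ᶠ γ ∈ lambdaSet Ψ g,
        ((tPar q k γ)⁻¹ - X q γ ξ) / (1 - (tPar q k γ)⁻¹ * X q γ ξ)) := by
  refine ⟨hcl, fun x => ∏ᶠ γ ∈ lambdaSet Ψ g,
    ((tPar q k γ)⁻¹ - X q γ x) / (1 - (tPar q k γ)⁻¹ * X q γ x), ?_,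
    Filter.Eventually.of_forall fun x hx => ?_, rfl⟩
  · simp_rw [finprod_mem_eq_finite_toFinset_prod _ hfin]
    refine Finset.analyticAt_fun_prod _ fun γ hγ => ?_
    exact (analyticAt_const.sub (analyticAt_X hq γ ξ)).div
      (analyticAt_const.sub (analyticAt_const.mul (analyticAt_X hq γ ξ)))
      (hξ γ (hfin.mem_toFinset.1 hγ))
  · have hx' := fun γ hγ => hx γ (hΦ (hΨ.subset hγ))
    beta_reduce
    rw [mu_actPt hq hΨ hadm hg hgΦ hgΦ' hfin fun γ hγ => (hx' γ hγ.1).2]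
    exact mul_div_cancel_right₀ _ (hadm.mu_ne_zero hq k hx')

omit [NormedAddCommGroup V] [InnerProductSpace ℝ V] [FiniteDimensional ℝ V] in
lemma HasProd.of_subset {f : V × ℝ → ℂ} {Ψ' : Set (V × ℝ)} (hs : Ψ' ⊆ Ψ) {s r : ℂ}
    (h : HasProd (fun γ : ↥(Ψ \ Ψ') => f γ) s) (h' : HasProd (fun γ : Ψ' => f γ) r) :
    HasProd (fun γ : Ψ => f γ) (s * r) := by
  have := HasProd.mul_disjoint (f := f) (s := Ψ \ Ψ') (t := Ψ') Set.disjoint_sdiff_left h h'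
  rwa [Set.sdiff_union_of_subset hs] at this

-- The quotient is the product over $\Psi\setminus\Psi'$, where no numerator or denominator vanishes
-- at $\xi$. The same number $s$ therefore relates the deleted products, hence the residues.
omit [FiniteDimensional ℝ V] in
lemma exists_hasValueAt_mu_div (hq : 0 < q) {Ψ' : Set (V × ℝ)} (hs : Ψ' ⊆ Ψ)
    (hΨ : Ψ ⊆ affRoots R) (hadm : Admissible q Ψ) {ξ : V →L[ℝ] ℂ}
    (hcl : ξ ∈ closure (regularPts q k R)) (hv : vanishing q k Ψ ξ ⊆ Ψ')
    (hnum : ∀ γ ∈ Ψ, 1 - X q γ ξ ≠ 0) :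
    ∃ s : ℂ, s ≠ 0 ∧
      HasValueAt (regularPts q k R) (fun x => mu q k Ψ x / mu q k Ψ' x) ξ s ∧
      ∀ S ⊆ Ψ', ∀ r, HasProd (fun γ : Ψ' => deletedFactor q k S ξ γ) r →
        HasProd (fun γ : Ψ => deletedFactor q k S ξ γ) (s * r) := by
  have hd : Admissible q (Ψ \ Ψ') := hadm.mono Set.sdiff_subset
  have hden : ∀ γ ∈ Ψ \ Ψ', 1 - tPar q k γ * X q γ ξ ≠ 0 := fun γ hγ h => hγ.2 (hv ⟨hγ.1, h⟩)
  refine ⟨mu q k (Ψ \ Ψ') ξ, hd.mu_ne_zero hq k fun γ hγ => ⟨hnum γ hγ.1, hden γ hγ⟩,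
    ⟨hcl, mu q k (Ψ \ Ψ'), hd.analyticAt_mu hq k hden, Filter.Eventually.of_forall
      fun x hx => ?_, rfl⟩, fun S hS r hr => ?_⟩
  · have h1 := HasProd.of_subset hs (hd.multipliable_muFactor hq k x).hasProd
      ((hadm.mono hs).multipliable_muFactor hq k x).hasProd
    beta_reduce
    rw [mu, h1.tprod_eq]
    exact mul_div_cancel_right₀ _
      ((hadm.mono hs).mu_ne_zero hq k fun γ hγ => hx γ (hΨ (hs hγ)))
  · refine HasProd.of_subset hs ?_ hr
    have h1 := (hd.multipliable_muFactor hq k ξ).hasProd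
    convert! h1 using 1
    funext γ
    rw [deletedFactor, muFactor, if_neg fun h => γ.2.2 (hS h)]

end Ratio

end Transformations

/-! ### Alcoves of the affine Weyl group -/

section Chambers

variable {V : Type*} [NormedAddCommGroup V] [InnerProductSpace ℝ V] {R Rpos : Set V}

/-- The value of affine functions at a point of `V`. -/
def evalPt (x : V) : (V × ℝ) →ₗ[ℝ] ℝ :=
  ((innerₗ V) x).comp (LinearMap.fst ℝ V ℝ) + LinearMap.snd ℝ V ℝ

lemma evalPt_apply (x : V) (γ : V × ℝ) : evalPt x γ = ⟪x, γ.1⟫ + γ.2 := rfl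

lemma exists_affReflect {γ : V × ℝ} (hγ : γ.1 ≠ 0) :
    ∃ s : (V × ℝ) ≃ₗ[ℝ] (V × ℝ), ∀ z, s z = affReflect γ z := by
  let f : (V × ℝ) →ₗ[ℝ] (V × ℝ) :=
    { toFun := affReflect γ
      map_add' := fun a b => by
        simp only [IsRootSet.affReflect_eq, Prod.fst_add, inner_add_left, add_div, add_smul]; abel
      map_smul' := fun c a => by
        simp only [IsRootSet.affReflect_eq, Prod.smul_fst, inner_smul_left, conj_trivial,
          mul_div_assoc, mul_smul, RingHom.id_apply, smul_sub] }
  exact ⟨LinearEquiv.ofInvolutive f fun z => affReflect_affReflect hγ z, fun z => rfl⟩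

/-- Take $w$ with the fewest bad roots, those positive at $x_1$ with an image negative at $x_2$. If
$\gamma$ were one of them, $ws_\gamma$ would have fewer. Only $x_2$ has to be regular. -/
lemma exists_affWeyl_chamber (hR : IsRootSet R) (x₁ x₂ : V)
    (hx₂ : ∀ γ ∈ affRoots R, evalPt x₂ γ ≠ 0) :
    ∃ w ∈ affWeyl (affRoots R), ∀ γ ∈ affRoots R, 0 < evalPt x₁ γ → 0 < evalPt x₂ (w γ) := by
  let D : ((V × ℝ) ≃ₗ[ℝ] (V × ℝ)) → Set (V × ℝ) := fun w =>
    {γ | γ ∈ affRoots R ∧ 0 < evalPt x₁ γ ∧ evalPt x₂ (w γ) < 0}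
  have hfin : ∀ w ∈ affWeyl (affRoots R), (D w).Finite := by
    intro w hw
    obtain ⟨c, v, hv, rfl⟩ := (affWeyl_induction hR le_rfl hw).1
    obtain ⟨C₁, hC₁⟩ := (hR.finite.image fun α => ⟪x₁, α⟫).bddAbove
    obtain ⟨C₂, hC₂⟩ := (hR.finite.image fun α => ⟪v α, c⟫ - ⟪x₂, v α⟫).bddAbove
    refine (finite_bounded_affRoots hR (max C₁ C₂)).subset fun γ ⟨h0, h1, h2⟩ => ⟨h0, ?_⟩
    have h3 := hC₁ ⟨γ.1, h0.1, rfl⟩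
    have h4 := hC₂ ⟨γ.1, h0.1, rfl⟩
    simp only [evalPt_apply, extElt, LinearEquiv.coe_mk, LinearMap.coe_mk, AddHom.coe_mk] at h1 h2
    simp only at h3 h4
    rw [abs_le]
    constructor
    · linarith [le_max_left C₁ C₂]
    · linarith [le_max_right C₁ C₂]
  obtain ⟨w, hw, hmin⟩ := WellFounded.has_min (measure fun w => (D w).ncard).wf
    (affWeyl (affRoots R) : Set ((V × ℝ) ≃ₗ[ℝ] (V × ℝ))) ⟨1, one_mem _⟩
  obtain ⟨-, hperm, -⟩ := affWeyl_induction hR le_rfl hw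
  refine ⟨w, hw, fun γ hγ h1 => ?_⟩
  by_contra hcon
  have h2 : evalPt x₂ (w γ) < 0 := lt_of_le_of_ne (not_lt.1 hcon) (hx₂ _ (hperm _ hγ))
  have hγ0 := hR.ne_zero _ hγ.1
  obtain ⟨s, hs⟩ := exists_affReflect hγ0
  have hsm : w * s ∈ affWeyl (affRoots R) :=
    mul_mem hw (Subgroup.subset_closure ⟨γ, hγ, hs⟩)
  have hss : ∀ z, s (s z) = z := fun z => by rw [hs, hs, affReflect_affReflect hγ0]
  have hsR : ∀ δ ∈ affRoots R, s δ ∈ affRoots R := fun δ hδ => by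
    rw [hs]; exact hR.affReflect_mem hγ hδ
  have hsγ : s γ = -γ := by
    rw [hs, IsRootSet.affReflect_eq, inner_self_eq_nu, mul_div_assoc,
      div_self (hR.nu_pos hγ.1).ne', mul_one, two_smul]
    abel
  refine hmin (w * s) hsm ?_
  change (D (w * s)).ncard < (D w).ncard
  classical
  -- An injection of the bad roots of $ws_\gamma$ into those of $w$ different from $\gamma$: a root
  -- that is bad for both is kept, any other one is reflected.
  let f : V × ℝ → V × ℝ := fun δ => if evalPt x₂ (w δ) < 0 then δ else s δ
  have hmaps : ∀ δ ∈ D (w * s), f δ ∈ D w \ {γ} := by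
    rintro δ ⟨h3, h4, h5⟩
    rw [LinearEquiv.mul_apply] at h5
    by_cases h6 : evalPt x₂ (w δ) < 0
    · simp only [f, h6, if_true]
      refine ⟨⟨h3, h4, h6⟩, ?_⟩
      rintro rfl
      rw [hsγ, map_neg, map_neg] at h5
      linarith
    · simp only [f, h6, if_false]
      refine ⟨⟨hsR _ h3, ?_, h5⟩, fun h7 => ?_⟩
      · have h8 := hs δ
        rw [IsRootSet.affReflect_eq] at h8
        rw [h8] at h5 ⊢
        rw [map_sub, map_smul, map_sub, map_smul, smul_eq_mul] at h5
        rw [map_sub, map_smul, smul_eq_mul]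
        -- Here $w\delta$ is not negative, but $ws_\gamma\delta$ and $w\gamma$ are. So
        -- $s_\gamma\delta$ is $\delta$ plus a positive multiple of $\gamma$, and remains positive
        -- at $x_1$.
        have h9 : ⟪δ.1, γ.1⟫ / nu γ.1 < 0 := by
          by_contra! h10
          nlinarith
        nlinarith
      · have h8 : δ = -γ := by
          rw [← hsγ, ← Set.mem_singleton_iff.1 h7, hss]
        rw [h8, map_neg] at h4
        linarith
  have hinj : Set.InjOn f (D (w * s)) := by
    rintro δ ⟨_, h3, h4⟩ δ' ⟨_, h3', h4'⟩ hf
    rw [LinearEquiv.mul_apply] at h4 h4'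
    by_cases h5 : evalPt x₂ (w δ) < 0 <;> by_cases h6 : evalPt x₂ (w δ') < 0 <;>
      simp only [f, h5, h6, if_true, if_false] at hf
    · exact hf
    · rw [hf, hss] at h4
      exact absurd h4 h6
    · rw [← hf, hss] at h4'
      exact absurd h4' h5
    · exact s.injective hf
  calc (D (w * s)).ncard ≤ (D w \ {γ}).ncard :=
        Set.ncard_le_ncard_of_injOn f hmaps hinj ((hfin w hw).subset Set.sdiff_subset)
    _ < (D w).ncard := Set.ncard_sdiff_singleton_lt_of_mem ⟨hγ, h1, h2⟩ (hfin w hw)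

lemma exists_pos_smul_lt (hfin : R.Finite) (y : V) :
    ∃ ε : ℝ, 0 < ε ∧ ∀ α ∈ R, |⟪ε • y, α⟫| < 1 := by
  obtain ⟨C, hC⟩ := (hfin.image fun α => |⟪y, α⟫|).bddAbove
  refine ⟨(max C 0 + 1)⁻¹, by positivity, fun α hα => ?_⟩
  have h1 : |⟪y, α⟫| ≤ C := hC ⟨α, hα, rfl⟩
  have h2 : 0 < max C 0 + 1 := by positivity
  rw [inner_smul_left, conj_trivial, abs_mul, abs_of_pos (inv_pos.2 h2), inv_mul_lt_iff₀ h2]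
  linarith [le_max_left C 0]

/-- A point close to the origin, in the alcove that defines the positivity. -/
lemma exists_evalPt_pos_iff (hR : IsRootSet R) {r : V} (hpos : IsPositive R Rpos r) :
    ∃ x : V, ∀ γ ∈ affRoots R, γ ∈ affPos R Rpos ↔ 0 < evalPt x γ := by
  obtain ⟨ε, hε, h⟩ := exists_pos_smul_lt hR.finite r
  refine ⟨ε • r, fun γ hγ => ?_⟩
  obtain ⟨m, hm⟩ := hR.exists_int_snd hγ
  have h1 := abs_lt.1 (h _ hγ.1)
  rw [evalPt_apply]
  have h3 : ⟪ε • r, γ.1⟫ = ε * ⟪r, γ.1⟫ := by rw [inner_smul_left]; rfl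
  rcases lt_trichotomy m 0 with h2 | h2 | h2
  · have h4 : (m : ℝ) ≤ -1 := by exact_mod_cast Int.le_sub_one_of_lt h2
    constructor
    · intro h5
      have := snd_nonneg_of_mem_affPos h5
      linarith
    · intro h5; linarith
  · have h4 : γ.2 = 0 := by rw [hm, h2]; simp
    rw [h4, add_zero, h3]
    constructor
    · intro h5
      have h6 := (hpos.mem_iff _).1 (h5.2.resolve_left (by rw [h4]; exact lt_irrefl _)).2
      exact mul_pos hε h6.2
    · intro h5
      exact ⟨hγ, Or.inr ⟨h4, (hpos.mem_iff _).2 ⟨hγ.1, pos_of_mul_pos_right h5 hε.le⟩⟩⟩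
  · have h4 : (1 : ℝ) ≤ m := by exact_mod_cast h2
    exact ⟨fun _ => by linarith, fun _ => ⟨hγ, Or.inl (by linarith)⟩⟩

lemma evalPt_pos {x : V}
    (hx : ∀ γ ∈ affRoots R, γ ∈ affPos R Rpos ↔ 0 < evalPt x γ) {γ : V × ℝ}
    (hγ : γ ∈ affPos R Rpos) : 0 < evalPt x γ := (hx γ hγ.1).1 hγ

section Simple

variable [FiniteDimensional ℝ V] {κ : Type*} [Fintype κ] {β : κ → V × ℝ}

lemma exists_inner_eq (hli : LinearIndependent ℝ fun i => (β i).1)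
    (hcard : Fintype.card κ = Module.finrank ℝ V) (a : κ → ℝ) :
    ∃ x : V, ∀ i, ⟪x, (β i).1⟫ = a i := by
  let B := basisOfLinearIndependentOfCardEqFinrank' _ hli hcard
  refine ⟨(InnerProductSpace.toDual ℝ V).symm
    (LinearMap.toContinuousLinearMap (B.constr ℝ a)), fun i => ?_⟩
  rw [InnerProductSpace.toDual_symm_apply]
  have h : (β i).1 = B i := by simp [B]
  rw [h]
  exact B.constr_basis ℝ a i

/-- Every set of simple roots of a finite subsystem whose nonaffine components generate the root
lattice is conjugate to a set of simple roots of the affine root system. -/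
lemma exists_affWeyl_simpleRoots (hR : IsRootSet R) {r : V} (hpos : IsPositive R Rpos r)
    (hli : LinearIndependent ℝ fun i => (β i).1) (hcard : Fintype.card κ = Module.finrank ℝ V)
    (hβ : ∀ i, β i ∈ affRoots R)
    (hspan : ∀ α ∈ R, α ∈ Submodule.span ℤ (Set.range fun i => (β i).1))
    (hsimple : IsSimpleSystem (affSpanRoots R β) β) :
    ∃ w ∈ affWeyl (affRoots R), ∀ i, w⁻¹ (β i) ∈ simpleRoots (affPos R Rpos) := by
  obtain ⟨x₁, hx₁⟩ := exists_evalPt_pos_iff hR hpos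
  -- The common zero of the $\tilde\beta_i$; the point $x_0+\varepsilon y$ lies near it, on the
  -- positive side of all of them.
  obtain ⟨x₀, hx₀⟩ := exists_inner_eq hli hcard fun i => -(β i).2
  obtain ⟨y, hy⟩ := exists_inner_eq hli hcard fun _ => 1
  obtain ⟨ε, hε, hεy⟩ := exists_pos_smul_lt hR.finite y
  have h0 : ∀ i, evalPt x₀ (β i) = 0 := fun i => by rw [evalPt_apply, hx₀]; ring
  -- Integrality at $x_0$ comes from the span condition. Together with $|\varepsilon(y,\alpha)|<1$
  -- it means that the sign of an affine root at $x_0+\varepsilon y$ is decided at $x_0$ unless the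
  -- root vanishes there.
  have hint : ∀ γ ∈ affRoots R, ∃ m : ℤ, evalPt x₀ γ = m := by
    intro γ hγ
    obtain ⟨m, hm⟩ := (Submodule.mem_span_range_iff_exists_fun ℤ).1 (hspan _ hγ.1)
    obtain ⟨j, hj⟩ := hR.exists_int_snd hγ
    choose a ha using fun i => hR.exists_int_snd (hβ i)
    refine ⟨∑ i, m i * (-a i) + j, ?_⟩
    rw [evalPt_apply, ← hm, hj, inner_sum]
    push_cast
    congr 1
    refine Finset.sum_congr rfl fun i _ => ?_
    rw [← Int.cast_smul_eq_zsmul ℝ, inner_smul_right, hx₀, ha]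
  -- A root vanishing at $x_0$ is determined by its nonaffine component, so it is an integral
  -- combination of the $\tilde\beta_i$ and belongs to the subsystem.
  have hzero : ∀ γ ∈ affRoots R, evalPt x₀ γ = 0 →
      ∃ n : κ → ℕ, γ = ∑ i, n i • β i ∨ γ = -∑ i, n i • β i := by
    intro γ hγ h
    obtain ⟨m, hm⟩ := (Submodule.mem_span_range_iff_exists_fun ℤ).1 (hspan _ hγ.1)
    refine hsimple.2.2 γ ⟨hγ, (Submodule.mem_span_range_iff_exists_fun ℤ).2 ⟨m, ?_⟩⟩
    have h1 : (∑ i, m i • β i).1 = γ.1 := by rw [← hm, Prod.fst_sum]; rfl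
    refine Prod.ext h1 ?_
    have h2 : evalPt x₀ (∑ i, m i • β i) = 0 := by simp [h0]
    rw [evalPt_apply] at h h2
    rw [h1] at h2
    linarith
  have hyn : ∀ n : κ → ℕ, ⟪y, (∑ i, n i • β i).1⟫ = ∑ i, (n i : ℝ) := fun n => by
    rw [Prod.fst_sum, inner_sum]
    refine Finset.sum_congr rfl fun i _ => ?_
    rw [Prod.smul_fst, ← Nat.cast_smul_eq_nsmul ℝ, inner_smul_right, hy, mul_one]
  have hev : ∀ γ : V × ℝ, evalPt (x₀ + ε • y) γ = evalPt x₀ γ + ε * ⟪y, γ.1⟫ := fun γ => by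
    rw [evalPt_apply, evalPt_apply, inner_add_left, inner_smul_left]; simp; ring
  have hyb : ∀ γ ∈ affRoots R, |ε * ⟪y, γ.1⟫| < 1 := fun γ hγ => by
    have := hεy _ hγ.1
    rwa [inner_smul_left] at this
  have hreg : ∀ γ ∈ affRoots R, evalPt (x₀ + ε • y) γ ≠ 0 := by
    intro γ hγ h
    rw [hev] at h
    obtain ⟨m, hm⟩ := hint γ hγ
    have h1 := abs_lt.1 (hyb γ hγ)
    have hm0 : m = 0 := by
      have h2 : (m : ℝ) < 1 := by linarith
      have h3 : (-1 : ℝ) < m := by linarith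
      have h4 : m < 1 := by exact_mod_cast h2
      have h5 : -1 < m := by exact_mod_cast h3
      omega
    have hγ0 : evalPt x₀ γ = 0 := by rw [hm, hm0]; simp
    rw [hγ0, zero_add] at h
    have h6 := (mul_eq_zero.1 h).resolve_left hε.ne'
    obtain ⟨n, hn⟩ := hzero γ hγ hγ0
    have h7 : ∑ i, (n i : ℝ) = 0 := by
      rw [← hyn]
      rcases hn with hn | hn
      · rw [← hn, h6]
      · rw [← neg_eq_zero, ← inner_neg_right, ← Prod.fst_neg, ← hn, h6]
    have h8 : ∀ i, n i = 0 := fun i => by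
      have := (Finset.sum_eq_zero_iff_of_nonneg fun i _ => Nat.cast_nonneg (α := ℝ) (n i)).1 h7 i
        (Finset.mem_univ i)
      exact_mod_cast this
    refine hR.ne_zero _ hγ.1 ?_
    rcases hn with hn | hn <;> rw [hn] <;> simp [h8]
  obtain ⟨w, hw, hwpos⟩ := exists_affWeyl_chamber hR x₁ (x₀ + ε • y) hreg
  obtain ⟨-, hperm, hperm'⟩ := affWeyl_induction hR le_rfl hw
  have hwi : ∀ γ, w (w⁻¹ γ) = γ := fun γ => w.apply_symm_apply γ
  have hne : ∀ γ ∈ affPos R Rpos, 0 ≤ evalPt x₀ (w γ) ∧ (evalPt x₀ (w γ) = 0 →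
      ∃ n : κ → ℕ, w γ = ∑ i, n i • β i) := by
    intro γ hγ
    have h1 := hwpos γ hγ.1 ((hx₁ γ hγ.1).1 hγ)
    rw [hev] at h1
    have h2 := abs_lt.1 (hyb _ (hperm _ hγ.1))
    obtain ⟨m, hm⟩ := hint _ (hperm _ hγ.1)
    have h3 : (-1 : ℝ) < m := by linarith
    have h4 : -1 < m := by exact_mod_cast h3
    refine ⟨by rw [hm]; exact_mod_cast (show 0 ≤ m by omega), fun h5 => ?_⟩
    obtain ⟨n, hn | hn⟩ := hzero _ (hperm _ hγ.1) h5
    · exact ⟨n, hn⟩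
    · rw [h5, zero_add, hn, Prod.fst_neg, inner_neg_right, hyn] at h1
      have : 0 ≤ ∑ i, (n i : ℝ) := Finset.sum_nonneg fun i _ => Nat.cast_nonneg _
      nlinarith
  refine ⟨w, hw, fun i => ⟨?_, fun hcl => ?_⟩⟩
  · have h1 : w⁻¹ (β i) ∈ affRoots R := hperm' _ (hβ i)
    rw [hx₁ _ h1]
    by_contra hcon
    have hn1 : 0 < evalPt x₁ (-(w⁻¹ (β i))) ∨ evalPt x₁ (w⁻¹ (β i)) = 0 := by
      rw [map_neg]
      rcases (not_lt.1 hcon).lt_or_eq with h | h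
      · left; linarith
      · exact Or.inr h
    have h3 : 0 < evalPt (x₀ + ε • y) (β i) := by
      rw [hev, h0, hy]; simpa using hε
    rcases hn1 with h2 | h2
    · have h4 := hwpos _ (hR.neg_mem_aff h1) h2
      rw [map_neg, hwi, map_neg] at h4
      linarith
    · have hh := (isHalf_affPos hR hpos).total _ h1
      rcases hh with h | h
      · exact hcon ((hx₁ _ h1).1 h)
      · have := (hx₁ _ h.1).1 h
        rw [map_neg, h2] at this
        simp at this
  · classical
    -- This monoid contains the images under $w$ of all positive roots other than
    -- $w^{-1}\tilde\beta_i$, but not $\tilde\beta_i$ itself: at $x_0$ its elements are positive, or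
    -- they are nonnegative combinations of the $\tilde\beta_j$ different from $\tilde\beta_i$. So
    -- $w^{-1}\tilde\beta_i$ is indecomposable.
    let M : AddSubmonoid (V × ℝ) :=
      { carrier := {z | 0 ≤ evalPt x₀ z ∧ (evalPt x₀ z = 0 → ∃ n : κ → ℕ, z = ∑ j, n j • β j ∧
          n ≠ Pi.single i 1)}
        zero_mem' := ⟨by simp, fun _ => ⟨0, by simp, fun h => by
          have := congrFun h i; simp at this⟩⟩
        add_mem' := by
          rintro z z' ⟨h1, h2⟩ ⟨h1', h2'⟩
          refine ⟨by rw [map_add]; positivity, fun h3 => ?_⟩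
          rw [map_add] at h3
          obtain ⟨n, rfl, hn⟩ := h2 (by linarith)
          obtain ⟨n', rfl, hn'⟩ := h2' (by linarith)
          refine ⟨n + n', by simp [add_smul, Finset.sum_add_distrib], fun h4 => ?_⟩
          have h5 : ∀ j, n j + n' j = if j = i then 1 else 0 := fun j => by
            have := congrFun h4 j
            simpa [Pi.single_apply] using this
          have h6 := h5 i
          rw [if_pos rfl] at h6
          rcases Nat.eq_zero_or_pos (n i) with h7 | h7
          · refine hn' (funext fun j => ?_)
            rw [Pi.single_apply]
            have := h5 j
            split_ifs at this ⊢ with hj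
            · subst hj; omega
            · omega
          · refine hn (funext fun j => ?_)
            rw [Pi.single_apply]
            have := h5 j
            split_ifs at this ⊢ with hj
            · subst hj; omega
            · omega }
    have hsingle : ∀ i, β i = ∑ j, (Pi.single i 1 : κ → ℕ) j • β j := fun i => by
      simp [Pi.single_apply, ite_smul]
    have huniq : ∀ n : κ → ℕ, β i = ∑ j, n j • β j → n = Pi.single i 1 := by
      intro n hn
      have h1 := int_coeff_eq (p := LinearMap.fst ℝ V ℝ) hli
        (m := fun j => (n j : ℤ)) (m' := fun j => ((Pi.single i 1 : κ → ℕ) j : ℤ)) (by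
          simp only [natCast_zsmul]; rw [← hn, ← hsingle])
      funext j
      exact_mod_cast congrFun h1 j
    have hle : AddSubmonoid.closure (affPos R Rpos \ {w⁻¹ (β i)}) ≤
        M.comap (w : (V × ℝ) ≃ₗ[ℝ] (V × ℝ)).toLinearMap.toAddMonoidHom := by
      refine AddSubmonoid.closure_le.2 fun γ hγ => ?_
      obtain ⟨h1, h2⟩ := hne γ hγ.1
      refine ⟨h1, fun h3 => ?_⟩
      obtain ⟨n, hn⟩ := h2 h3
      refine ⟨n, hn, fun h4 => hγ.2 ?_⟩
      rw [h4, ← hsingle] at hn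
      exact w.injective (hn.trans (hwi _).symm)
    have hm : w (w⁻¹ (β i)) ∈ M := hle hcl
    rw [hwi] at hm
    obtain ⟨n, hn, hn'⟩ := hm.2 (h0 i)
    exact hn' (huniq n hn)

end Simple

end Chambers

/-! ### Affine simple roots in the irreducible components -/

section Components

variable {V : Type*} [NormedAddCommGroup V] [InnerProductSpace ℝ V] {R Rpos C : Set V}

/-! ### Components -/

namespace IsComponent

lemma subset (h : IsComponent (fun x y : V => ⟪x, y⟫) R C) : C ⊆ R := by
  obtain ⟨α, hα, rfl⟩ := h
  intro β hβ
  rcases Relation.ReflTransGen.cases_tail hβ with h | ⟨γ, -, h⟩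
  · rw [h]; exact hα
  · exact h.2.1

lemma nonempty (h : IsComponent (fun x y : V => ⟪x, y⟫) R C) : C.Nonempty := by
  obtain ⟨α, hα, rfl⟩ := h
  exact ⟨α, Relation.ReflTransGen.refl⟩

lemma mem_of_inner_ne (h : IsComponent (fun x y : V => ⟪x, y⟫) R C) {α β : V} (hα : α ∈ C)
    (hβ : β ∈ R) (hne : ⟪α, β⟫ ≠ 0) : β ∈ C := by
  have hα' := h.subset hα
  obtain ⟨α₀, hα₀, rfl⟩ := h
  exact Relation.ReflTransGen.tail hα ⟨hα', hβ, hne⟩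

lemma isRootSet (h : IsComponent (fun x y : V => ⟪x, y⟫) R C) (hR : IsRootSet R) :
    IsRootSet C where
  finite := hR.finite.subset h.subset
  ne_zero α hα := hR.ne_zero α (h.subset hα)
  exists_nu α hα := hR.exists_nu α (h.subset hα)
  reflect α hα β hβ := by
    by_cases h0 : ⟪β, α⟫ = 0
    · simpa [h0] using hβ
    · refine h.mem_of_inner_ne hα (hR.reflect α (h.subset hα) β (h.subset hβ)) ?_
      rw [inner_sub_right, inner_smul_right, inner_self_eq_nu, real_inner_comm]
      have := (hR.nu_pos (h.subset hα)).ne'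
      field_simp
      intro h1
      exact h0 (by linarith)
  integral α hα β hβ := hR.integral α (h.subset hα) β (h.subset hβ)

/-- A component is not the union of two orthogonal parts. -/
lemma connected (h : IsComponent (fun x y : V => ⟪x, y⟫) R C) {p : V → Prop}
    (hp : ∀ α ∈ C, ∀ β ∈ C, ⟪α, β⟫ ≠ 0 → p α → p β) {α β : V} (hα : α ∈ C) (hβ : β ∈ C)
    (h1 : p α) : p β := by
  have hsub := h.subset
  have hmem := fun {α β : V} => h.mem_of_inner_ne (α := α) (β := β)
  obtain ⟨α₀, hα₀, rfl⟩ := h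
  have hsymm : Relation.ReflTransGen (fun x y => x ∈ R ∧ y ∈ R ∧ ⟪x, y⟫ ≠ 0) α α₀ := by
    refine Relation.ReflTransGen.mono (fun x y h => ?_) _ _
      (Relation.reflTransGen_swap.2 hα)
    exact ⟨h.2.1, h.1, by rw [real_inner_comm]; exact h.2.2⟩
  have hαβ : Relation.ReflTransGen (fun x y => x ∈ R ∧ y ∈ R ∧ ⟪x, y⟫ ≠ 0) α β := hsymm.trans hβ
  have key : Relation.ReflTransGen (fun x y => x ∈ R ∧ y ∈ R ∧ ⟪x, y⟫ ≠ 0) α₀ β ∧ p β := by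
    clear hβ
    induction hαβ with
    | refl => exact ⟨hα, h1⟩
    | tail _ hstep ih =>
      have h2 := Relation.ReflTransGen.tail ih.1 hstep
      exact ⟨h2, hp _ ih.1 _ h2 hstep.2.2 ih.2⟩
  exact key.2

end IsComponent

/-! ### Simple roots of the twisted affine extension -/

/-- A decomposable element is a sum of elements with smaller values of $f$, and there are finitely
many of these, so decomposing repeatedly comes to an end. -/
lemma mem_closure_simpleRoots {Ψ : Set (V × ℝ)} {f : (V × ℝ) →ₗ[ℝ] ℝ}
    (hf : ∀ γ ∈ Ψ, 0 < f γ) (hfin : ∀ γ ∈ Ψ, {δ ∈ Ψ | f δ ≤ f γ}.Finite) {γ : V × ℝ}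
    (hγ : γ ∈ Ψ) : γ ∈ AddSubmonoid.closure (simpleRoots Ψ) := by
  induction hN : {δ ∈ Ψ | f δ ≤ f γ}.ncard using Nat.strong_induction_on generalizing γ with
  | _ N ih =>
  by_cases h : γ ∈ AddSubmonoid.closure (Ψ \ {γ})
  · obtain ⟨s, hs, hsum⟩ := AddSubmonoid.exists_multiset_of_mem_closure h
    rw [← hsum]
    refine AddSubmonoid.multiset_sum_mem _ _ fun δ hδ => ?_
    have hpos : ∀ t : Multiset (V × ℝ), (∀ y ∈ t, y ∈ Ψ \ {γ}) → t ≠ 0 → 0 < f t.sum := by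
      intro t
      induction t using Multiset.induction_on with
      | empty => simp
      | cons a t iht =>
        intro ht _
        rw [Multiset.sum_cons, map_add]
        have h1 := hf a (ht a (Multiset.mem_cons_self a t)).1
        by_cases h0 : t = 0
        · simpa [h0] using h1
        · have := iht (fun y hy => ht y (Multiset.mem_cons_of_mem hy)) h0
          positivity
    obtain ⟨t, rfl⟩ := Multiset.exists_cons_of_mem hδ
    have ht : ∀ y ∈ t, y ∈ Ψ \ {γ} := fun y hy => hs y (Multiset.mem_cons_of_mem hy)
    have hδ' := hs δ hδ
    have hlt : f δ < f γ := by
      rw [← hsum, Multiset.sum_cons, map_add]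
      have : t ≠ 0 := by
        rintro rfl
        exact hδ'.2 (by simpa using hsum)
      linarith [hpos t ht this]
    refine ih _ ?_ hδ'.1 rfl
    rw [← hN]
    refine Set.ncard_lt_ncard ⟨fun x hx => ⟨hx.1, hx.2.trans hlt.le⟩, fun hcon => ?_⟩ (hfin γ hγ)
    exact absurd (hcon ⟨hγ, le_rfl⟩ : γ ∈ {x ∈ Ψ | f x ≤ f δ}).2 (not_le.2 hlt)
  · exact AddSubmonoid.subset_closure ⟨hγ, h⟩

lemma finite_affPos_le (hR : IsRootSet R) (x : V) (a : ℝ) :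
    {γ ∈ affPos R Rpos | evalPt x γ ≤ a}.Finite := by
  obtain ⟨K, hK⟩ := (hR.finite.image fun α => -⟪x, α⟫).bddAbove
  refine (finite_bounded_affRoots hR (K + a)).subset fun γ hγ => ⟨hγ.1.1, ?_⟩
  rw [abs_of_nonneg (snd_nonneg_of_mem_affPos hγ.1)]
  have h1 := hK ⟨γ.1, hγ.1.1.1, rfl⟩
  have h2 := hγ.2
  rw [evalPt_apply] at h2
  simp only at h1
  linarith

section SimpleRoots

variable (hR : IsRootSet R) {r : V} (hpos : IsPositive R Rpos r)
include hR hpos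

lemma closure_simpleRoots {γ : V × ℝ} (hγ : γ ∈ affPos R Rpos) :
    γ ∈ AddSubmonoid.closure (simpleRoots (affPos R Rpos)) := by
  obtain ⟨x, hx⟩ := exists_evalPt_pos_iff hR hpos
  exact mem_closure_simpleRoots (fun γ hγ => evalPt_pos hx hγ)
    (fun γ _ => finite_affPos_le hR x _) hγ

lemma mem_affPos_neg {α : V} (hα : α ∈ R) (h : α ∉ Rpos) : -α ∈ Rpos := by
  rw [hpos.mem_iff] at h ⊢
  refine ⟨hR.neg_mem hα, ?_⟩
  rw [inner_neg_right, neg_pos]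
  exact lt_of_le_of_ne (not_lt.1 fun h1 => h ⟨hα, h1⟩) (hpos.inner_ne α hα)

omit hpos in
lemma mk_nu_mem {α : V} (hα : α ∈ R) : (α, nu α) ∈ affPos R Rpos :=
  ⟨⟨hα, 1, by simp⟩, Or.inl (hR.nu_pos hα)⟩

omit hR hpos in
lemma mk_zero_mem {α : V} (hα : α ∈ Rpos) (hα' : α ∈ R) : (α, 0) ∈ affPos R Rpos :=
  ⟨⟨hα', 0, by simp⟩, Or.inr ⟨rfl, hα⟩⟩

/-- The sum of `[α, 0]` and `[-α, ν_α]`, or of `[α, ν_α]` and `[-α, 0]`. -/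
lemma exists_add_eq_imag {α : V} (hα : α ∈ R) :
    ∃ m, (α, m) ∈ affPos R Rpos ∧ (-α, nu α - m) ∈ affPos R Rpos ∧
      ((α ∈ Rpos ∧ m = 0) ∨ (α ∉ Rpos ∧ m = nu α)) := by
  by_cases h : α ∈ Rpos
  · refine ⟨0, mk_zero_mem h hα, ?_, Or.inl ⟨h, rfl⟩⟩
    have := mk_nu_mem (Rpos := Rpos) hR (hR.neg_mem hα)
    rwa [nu_neg, ← sub_zero (nu α)] at this
  · refine ⟨nu α, mk_nu_mem hR hα, ?_, Or.inr ⟨h, rfl⟩⟩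
    rw [sub_self]
    exact mk_zero_mem (mem_affPos_neg hR hpos hα h) (hR.neg_mem hα)

/-- A simple root is the lowest positive affine root over its nonaffine component. Any other one
decomposes as $[\alpha,m-\nu_\alpha]+[\alpha,m_0]+[-\alpha,\nu_\alpha-m_0]$ with positive summands,
$[\alpha,m_0]$ being the lowest one. -/
lemma snd_of_mem_simpleRoots {γ : V × ℝ} (hγ : γ ∈ simpleRoots (affPos R Rpos)) :
    (γ.1 ∈ Rpos ∧ γ.2 = 0) ∨ (γ.1 ∉ Rpos ∧ γ.2 = nu γ.1) := by
  obtain ⟨m, h1, h2, h3⟩ := exists_add_eq_imag hR hpos hγ.1.1.1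
  suffices γ.2 = m by rwa [this]
  by_contra hne
  refine hγ.2 ?_
  have hν := hR.nu_pos hγ.1.1.1
  obtain ⟨j, hj⟩ := hγ.1.1.2
  have hγ2 := hγ.1.2
  have h0 : 0 ≤ γ.2 - nu γ.1 ∧ (γ.2 - nu γ.1 = 0 → γ.1 ∈ Rpos) := by
    rcases h3 with ⟨h4, rfl⟩ | ⟨h4, rfl⟩
    · have h5 : 0 < γ.2 := hγ2.resolve_right fun h => hne h.1
      have h6 : 0 < j := by
        by_contra! h
        have : (j : ℝ) ≤ 0 := by exact_mod_cast h
        nlinarith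
      have h7 : (1 : ℝ) ≤ j := by exact_mod_cast h6
      exact ⟨by nlinarith, fun _ => h4⟩
    · have h5 : 0 < γ.2 := hγ2.resolve_right fun h => h4 h.2
      have h6 : 0 < j := by
        by_contra! h
        have : (j : ℝ) ≤ 0 := by exact_mod_cast h
        nlinarith
      have h7 : (1 : ℝ) ≤ j := by exact_mod_cast h6
      exact ⟨by nlinarith, fun h8 => absurd (sub_eq_zero.1 h8) hne⟩
  have h4 : (γ.1, γ.2 - nu γ.1) ∈ affPos R Rpos := by
    refine ⟨⟨hγ.1.1.1, j - 1, ?_⟩, ?_⟩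
    · change γ.2 - nu γ.1 = nu γ.1 * _
      rw [hj]; push_cast; ring
    · rcases h0.1.lt_or_eq with h5 | h5
      · exact Or.inl h5
      · exact Or.inr ⟨h5.symm, h0.2 h5.symm⟩
  have h5 : γ = (γ.1, γ.2 - nu γ.1) + ((γ.1, m) + (-γ.1, nu γ.1 - m)) := by
    ext <;> simp
  rw [h5]
  refine add_mem (AddSubmonoid.subset_closure ⟨h4, fun h => ?_⟩)
    (add_mem (AddSubmonoid.subset_closure ⟨h1, fun h => ?_⟩)
      (AddSubmonoid.subset_closure ⟨h2, fun h => ?_⟩))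
  · rw [← h5] at h
    have := congrArg Prod.snd (Set.mem_singleton_iff.1 h)
    simp at this
    linarith
  · rw [← h5] at h
    have := congrArg Prod.snd (Set.mem_singleton_iff.1 h)
    exact hne this.symm
  · rw [← h5] at h
    have := congrArg Prod.fst (Set.mem_singleton_iff.1 h)
    simp only at this
    have h6 := hR.ne_zero _ hγ.1.1.1
    have h7 : (2 : ℝ) • γ.1 = 0 := by rw [two_smul]; nth_rw 1 [← this]; simp
    exact h6 ((smul_eq_zero.1 h7).resolve_left two_ne_zero)

/-- At an acute angle the difference would be an affine root, and whichever of its signs is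
positive, one of the two roots would decompose. -/
lemma inner_simpleRoots_nonpos {γ δ : V × ℝ} (hγ : γ ∈ simpleRoots (affPos R Rpos))
    (hδ : δ ∈ simpleRoots (affPos R Rpos)) (hne : γ ≠ δ) : ⟪γ.1, δ.1⟫ ≤ 0 := by
  by_contra! h
  have hfst : γ.1 ≠ δ.1 := fun h1 => hne <| Prod.ext h1 <| by
    have h2 := snd_of_mem_simpleRoots hR hpos hγ
    have h3 := snd_of_mem_simpleRoots hR hpos hδ
    rw [h1] at h2
    rcases h2 with h2 | h2 <;> rcases h3 with h3 | h3
    · rw [h2.2, h3.2]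
    · exact absurd h2.1 h3.1
    · exact absurd h3.1 h2.1
    · rw [h2.2, h3.2]
  have key : ∀ {γ δ : V × ℝ}, γ ∈ simpleRoots (affPos R Rpos) → δ ∈ simpleRoots (affPos R Rpos) →
      γ ≠ δ → γ - δ ∈ affPos R Rpos → False := by
    intro γ δ hγ hδ hne hm
    refine hγ.2 ?_
    have h1 : γ = δ + (γ - δ) := by abel
    rw [h1]
    refine add_mem (AddSubmonoid.subset_closure ⟨hδ.1, fun h => ?_⟩)
      (AddSubmonoid.subset_closure ⟨hm, fun h => ?_⟩)
    · rw [← h1] at h; exact hne (Set.mem_singleton_iff.1 h).symm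
    · rw [← h1] at h
      have h2 := sub_eq_self.1 (Set.mem_singleton_iff.1 h)
      exact hR.ne_zero _ hδ.1.1.1 (by rw [h2]; rfl)
  have hsub := hR.sub_mem_aff hγ.1.1 hδ.1.1 hfst h
  rcases (isHalf_affPos hR hpos).total _ hsub with h1 | h1
  · exact key hγ hδ hne h1
  · rw [neg_sub] at h1
    exact key hδ hγ hne.symm h1

end SimpleRoots

/-- Write $x=x_+-x_-$ by the signs of the coefficients. Then $(x,x_+)\le0$ by assumption and
$(x_-,x_+)\le0$ by obtuseness, so $(x_+,x_+)\le0$. -/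
lemma nonpos_of_inner_nonpos {κ : Type*} [Fintype κ] {v : κ → V} (hli : LinearIndependent ℝ v)
    (hobt : ∀ i j, i ≠ j → ⟪v i, v j⟫ ≤ 0) {c : κ → ℝ}
    (h : ∀ i, ⟪∑ j, c j • v j, v i⟫ ≤ 0) (i : κ) : c i ≤ 0 := by
  have h1 : ∑ i, c i • v i = ∑ i, (c i)⁺ • v i - ∑ i, (c i)⁻ • v i := by
    rw [← Finset.sum_sub_distrib]
    exact Finset.sum_congr rfl fun i _ => by rw [← sub_smul, posPart_sub_negPart]
  have h2 : ⟪∑ i, c i • v i, ∑ i, (c i)⁺ • v i⟫ ≤ 0 := by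
    rw [inner_sum]
    refine Finset.sum_nonpos fun i _ => ?_
    rw [inner_smul_right]
    exact mul_nonpos_of_nonneg_of_nonpos (posPart_nonneg _) (h i)
  have h3 : ⟪∑ i, (c i)⁻ • v i, ∑ i, (c i)⁺ • v i⟫ ≤ 0 := by
    simp only [inner_sum, sum_inner, inner_smul_left, inner_smul_right, conj_trivial,
      Finset.mul_sum]
    refine Finset.sum_nonpos fun i _ => Finset.sum_nonpos fun j _ => ?_
    by_cases hij : i = j
    · subst hij
      rcases le_total (c i) 0 with h | h
      · simp [posPart_eq_zero.2 h]
      · simp [negPart_eq_zero.2 h]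
    · have h4 := hobt _ _ (Ne.symm hij)
      exact mul_nonpos_of_nonneg_of_nonpos (posPart_nonneg _)
        (mul_nonpos_of_nonneg_of_nonpos (negPart_nonneg _) h4)
  rw [h1, inner_sub_left] at h2
  have h4 : ∑ i, (c i)⁺ • v i = 0 :=
    inner_self_eq_zero.1 (le_antisymm (by linarith) real_inner_self_nonneg)
  exact posPart_eq_zero.1 (Fintype.linearIndependent_iff.1 hli _ h4 i)

section Extension

variable {κ : Type*} [Fintype κ] {γ : κ → V × ℝ}

omit [InnerProductSpace ℝ V] in
lemma simpleRoots_mono {Ψ Ψ' : Set (V × ℝ)} (h : Ψ' ⊆ Ψ) {δ : V × ℝ} (hδ : δ ∈ simpleRoots Ψ)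
    (hδ' : δ ∈ Ψ') : δ ∈ simpleRoots Ψ' :=
  ⟨hδ', fun hcl => hδ.2 (AddSubmonoid.closure_mono (Set.sdiff_subset_sdiff_left h) hcl)⟩

lemma IsPositive.mono (hR : IsPositive R Rpos r) (hC : C ⊆ R) : IsPositive C (C ∩ Rpos) r :=
  ⟨fun α => ⟨fun h => ⟨h.1, ((hR.mem_iff α).1 h.2).2⟩,
    fun h => ⟨h.1, (hR.mem_iff α).2 ⟨hC h.1, h.2⟩⟩⟩, fun α hα => hR.inner_ne α (hC hα)⟩

lemma affRoots_inter_affPos (hC : C ⊆ R) :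
    affRoots C ∩ affPos R Rpos = affPos C (C ∩ Rpos) := by
  ext γ
  constructor
  · rintro ⟨h1, h2⟩
    exact ⟨h1, h2.2.imp_right fun h => ⟨h.1, h1.1, h.2⟩⟩
  · rintro ⟨h1, h2⟩
    exact ⟨h1, ⟨hC h1.1, h1.2⟩, h2.imp_right fun h => ⟨h.1, h.2.2⟩⟩

/-- Linearly independent simple roots of the affine root system that span the space: in every
component, they are all the simple roots but one. -/
lemma existsUnique_simpleRoot (hR : IsRootSet R) {r : V} (hpos : IsPositive R Rpos r)
    (hli : LinearIndependent ℝ fun i => (γ i).1)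
    (hspan : ∀ α : V, ∃ c : κ → ℝ, α = ∑ i, c i • (γ i).1)
    (hγ : ∀ i, γ i ∈ simpleRoots (affPos R Rpos))
    (hC : IsComponent (fun x y : V => ⟪x, y⟫) R C) :
    ∃! δ : V × ℝ, δ ∈ simpleRoots (affRoots C ∩ affPos R Rpos) ∧ δ ∉ Set.range γ := by
  have hCR := hC.isRootSet hR
  have hCpos := hpos.mono hC.subset
  rw [affRoots_inter_affPos hC.subset]
  have hsub : affPos C (C ∩ Rpos) ⊆ affPos R Rpos := by
    rw [← affRoots_inter_affPos hC.subset]; exact Set.inter_subset_right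
  set S := simpleRoots (affPos C (C ∩ Rpos)) with hS
  have hobt : ∀ i j, i ≠ j → ⟪(γ i).1, (γ j).1⟫ ≤ 0 := fun i j hij =>
    inner_simpleRoots_nonpos hR hpos (hγ i) (hγ j) fun h => hij
      (hli.injective (congrArg Prod.fst h))
  have hSγ : ∀ δ ∈ S, δ ∉ Set.range γ → ∀ i, ⟪δ.1, (γ i).1⟫ ≤ 0 := by
    intro δ hδ hδ' i
    by_cases h0 : ⟪δ.1, (γ i).1⟫ = 0
    · exact h0.le
    have h1 := hC.mem_of_inner_ne hδ.1.1.1 (hγ i).1.1.1 h0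
    have h2 : γ i ∈ affPos C (C ∩ Rpos) := by
      rw [← affRoots_inter_affPos hC.subset]
      exact ⟨⟨h1, (hγ i).1.1.2⟩, (hγ i).1⟩
    exact inner_simpleRoots_nonpos hCR hCpos hδ (simpleRoots_mono hsub (hγ i) h2)
      fun h => hδ' ⟨i, h.symm⟩
  -- If no simple root of the component were missing, the imaginary element
  -- $[\alpha,m]+[-\alpha,\nu_\alpha-m]=[0,\nu_\alpha]$ would be a nonnegative combination of the
  -- $\gamma_i$, against their linear independence.
  obtain ⟨δ, hδ, hδ'⟩ : ∃ δ ∈ S, δ ∉ Set.range γ := by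
    by_contra! hcon
    obtain ⟨α, hα⟩ := hC.nonempty
    obtain ⟨m, h1, h2, -⟩ := exists_add_eq_imag hCR hCpos hα
    have h3 : AddSubmonoid.closure S ≤ AddSubmonoid.closure (Set.range γ) :=
      AddSubmonoid.closure_mono hcon
    have h4 := add_mem (h3 (closure_simpleRoots hCR hCpos h1))
      (h3 (closure_simpleRoots hCR hCpos h2))
    obtain ⟨n, hn⟩ := AddSubmonoid.mem_closure_range_iff_of_fintype.1 h4
    have h5 : ∑ i, (n i : ℝ) • (γ i).1 = 0 := by
      have := congrArg Prod.fst hn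
      simpa [Prod.fst_sum, Nat.cast_smul_eq_nsmul] using this.symm
    have h6 : ∀ i, n i = 0 := fun i => by
      exact_mod_cast Fintype.linearIndependent_iff.1 hli _ h5 i
    have h7 := congrArg Prod.snd hn
    simp [h6] at h7
    exact (hCR.nu_pos hα).ne' h7
  refine ⟨δ, ⟨hδ, hδ'⟩, ?_⟩
  rintro δ' ⟨hS', hδ'r⟩
  by_contra hne
  obtain ⟨c, hc⟩ := hspan δ.1
  obtain ⟨c', hc'⟩ := hspan δ'.1
  have hc0 : ∀ i, c i ≤ 0 := nonpos_of_inner_nonpos hli hobt fun i => hc ▸ hSγ δ hδ hδ' i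
  -- The $\gamma_i$ on which $\delta$ depends span $U$. Since $\delta$ is a nonpositive combination
  -- of them, every other simple root of the component is orthogonal to $U$; a second missing root
  -- would be such. It remains to carry this splitting over to all roots of the component.
  let U : Submodule ℝ V := Submodule.span ℝ {v | ∃ i, c i ≠ 0 ∧ v = (γ i).1}
  have hδU : δ.1 ∈ U := by
    rw [hc]
    refine Submodule.sum_mem _ fun i _ => ?_
    by_cases h : c i = 0
    · simp [h]
    · exact Submodule.smul_mem _ _ (Submodule.subset_span ⟨i, h, rfl⟩)
  -- a vector obtuse to the spanning vectors of `U` and to `δ` is orthogonal to `U`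
  have horth : ∀ v : V, (∀ i, c i ≠ 0 → ⟪v, (γ i).1⟫ ≤ 0) → ⟪v, δ.1⟫ ≤ 0 → v ∈ Uᗮ := by
    intro v hv hvδ
    have h1 : ∑ i, c i * ⟪v, (γ i).1⟫ ≤ 0 := by
      rw [hc, inner_sum] at hvδ
      simpa only [inner_smul_right] using hvδ
    have h2 : ∀ i, 0 ≤ c i * ⟪v, (γ i).1⟫ := fun i => by
      by_cases h : c i = 0
      · simp [h]
      · exact mul_nonneg_of_nonpos_of_nonpos (hc0 i) (hv i h)
    have h3 : ∀ i, c i * ⟪v, (γ i).1⟫ = 0 := fun i =>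
      (Finset.sum_eq_zero_iff_of_nonneg fun i _ => h2 i).1
        (le_antisymm h1 (Finset.sum_nonneg fun i _ => h2 i)) i (Finset.mem_univ i)
    rw [Submodule.mem_orthogonal']
    intro u hu
    induction hu using Submodule.span_induction with
    | mem u hu =>
      obtain ⟨i, hi, rfl⟩ := hu
      exact (mul_eq_zero.1 (h3 i)).resolve_left hi
    | zero => exact inner_zero_right _
    | add u u' _ _ hu hu' => rw [inner_add_right, hu, hu', add_zero]
    | smul a u _ hu => rw [inner_smul_right, hu, mul_zero]
  have hsplit : ∀ s ∈ S, s.1 ∈ U ∨ s.1 ∈ Uᗮ := by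
    intro s hs
    by_cases hsr : s ∈ Set.range γ
    · obtain ⟨i, rfl⟩ := hsr
      by_cases hi : c i = 0
      · right
        refine horth _ (fun j hj => hobt i j fun h => hj (h ▸ hi)) ?_
        rw [real_inner_comm]
        exact hSγ δ hδ hδ' i
      · exact Or.inl (Submodule.subset_span ⟨i, hi, rfl⟩)
    · by_cases hsδ : s = δ
      · rw [hsδ]; exact Or.inl hδU
      · exact Or.inr (horth _ (fun i _ => hSγ s hs hsr i)
          (inner_simpleRoots_nonpos hCR hCpos hs hδ hsδ))
  have hdisj : ∀ v ∈ C, v ∈ U → v ∉ Uᗮ := fun v hv h1 h2 =>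
    hCR.ne_zero v hv (inner_self_eq_zero.1 (Submodule.inner_right_of_mem_orthogonal h1 h2))
  have hδ'U : δ'.1 ∈ Uᗮ := horth _ (fun i _ => hSγ δ' hS' hδ'r i)
    (inner_simpleRoots_nonpos hCR hCpos hS' hδ hne)
  obtain ⟨x, hx⟩ := exists_evalPt_pos_iff hCR hCpos
  -- Induction on the value at an alcove point: some simple root $s$ is acute to $a$, and unless $a$
  -- and $s$ have the same nonaffine component, $a-s$ is a smaller positive root.
  have hall : ∀ a ∈ affPos C (C ∩ Rpos), a.1 ∈ U ∨ a.1 ∈ Uᗮ := by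
    intro a ha
    induction hN : {b ∈ affPos C (C ∩ Rpos) | evalPt x b ≤ evalPt x a}.ncard using
      Nat.strong_induction_on generalizing a with
    | _ N ih =>
    have ih' : ∀ b ∈ affPos C (C ∩ Rpos), evalPt x b < evalPt x a → b.1 ∈ U ∨ b.1 ∈ Uᗮ := by
      intro b hb hlt
      refine ih _ ?_ b hb rfl
      rw [← hN]
      refine Set.ncard_lt_ncard ⟨fun y hy => ⟨hy.1, hy.2.trans hlt.le⟩, fun hcon => ?_⟩
        (finite_affPos_le hCR x _)
      exact absurd (hcon ⟨ha, le_rfl⟩ : a ∈ {y ∈ affPos C (C ∩ Rpos) | evalPt x y ≤ evalPt x b}).2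
        (not_le.2 hlt)
    obtain ⟨t, ht, hsum⟩ := AddSubmonoid.exists_multiset_of_mem_closure
      (closure_simpleRoots hCR hCpos ha)
    obtain ⟨s, hs, hin⟩ : ∃ s ∈ t, 0 < ⟪a.1, s.1⟫ := by
      by_contra! hcon
      have h1 : ∀ t' : Multiset (V × ℝ), (∀ s ∈ t', ⟪a.1, s.1⟫ ≤ 0) → ⟪a.1, t'.sum.1⟫ ≤ 0 := by
        intro t'
        induction t' using Multiset.induction_on with
        | empty => simp
        | cons b t' iht =>
          intro hb
          rw [Multiset.sum_cons, Prod.fst_add, inner_add_right]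
          have := hb b (Multiset.mem_cons_self _ _)
          have := iht fun s hs => hb s (Multiset.mem_cons_of_mem hs)
          linarith
      have h2 := h1 t hcon
      rw [hsum, inner_self_eq_nu] at h2
      linarith [hCR.nu_pos ha.1.1]
    have hsS := ht s hs
    by_cases hfst : a.1 = s.1
    · rw [hfst]; exact hsplit s hsS
    have hsub' := hCR.sub_mem_aff ha.1 hsS.1.1 hfst hin
    have hnn : ∀ t' : Multiset (V × ℝ), (∀ s ∈ t', s ∈ S) → 0 ≤ evalPt x t'.sum := by
      intro t'
      induction t' using Multiset.induction_on with
      | empty => simp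
      | cons b t' iht =>
        intro hb
        rw [Multiset.sum_cons, map_add]
        have := evalPt_pos hx (hb b (Multiset.mem_cons_self _ _)).1
        have := iht fun s hs => hb s (Multiset.mem_cons_of_mem hs)
        linarith
    have hapos : a - s ∈ affPos C (C ∩ Rpos) := by
      rcases (isHalf_affPos hCR hCpos).total _ hsub' with h | h
      · exact h
      · have h1 := evalPt_pos hx h
        obtain ⟨t', rfl⟩ := Multiset.exists_cons_of_mem hs
        have h2 := hnn t' fun s hs => ht s (Multiset.mem_cons_of_mem hs)
        rw [← hsum, Multiset.sum_cons, neg_sub, sub_add_cancel_left, map_neg] at h1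
        linarith
    have hevs := evalPt_pos hx hsS.1
    have heva := evalPt_pos hx hapos
    rw [map_sub] at heva
    have hsa := hsplit s hsS
    have hda := ih' _ hapos (by rw [map_sub]; linarith)
    have hadd : a.1 = (a - s).1 + s.1 := by simp
    -- If $a-s$ and $s$ lie in different parts, they are orthogonal and the reflection $a-2s$ is
    -- again a root. It would lie in neither part, while it or its negative falls under the
    -- induction.
    have hmix : ⟪(a - s).1, s.1⟫ = 0 → (a - s - s).1 ∈ U ∨ (a - s - s).1 ∈ Uᗮ := by
      intro h0
      have h1 : ⟪a.1, s.1⟫ = 2 * nu s.1 := by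
        rw [hadd, inner_add_left, h0, inner_self_eq_nu, zero_add]
      have h2 : affReflect s a = a - s - s := by
        rw [IsRootSet.affReflect_eq, h1, mul_div_assoc, div_self (hCR.nu_pos hsS.1.1.1).ne',
          mul_one, two_smul]
        abel
      have h3 : a - s - s ∈ affRoots C := h2 ▸ hCR.affReflect_mem hsS.1.1 ha.1
      rcases (isHalf_affPos hCR hCpos).total _ h3 with h | h
      · exact ih' _ h (by rw [map_sub, map_sub]; linarith)
      · have := ih' _ h (by rw [map_neg, map_sub, map_sub]; linarith)
        simpa only [Prod.fst_neg, Submodule.neg_mem_iff] using this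
    have hs0 := hdisj _ hsS.1.1.1
    have hd0 := hdisj _ hapos.1.1
    have hsub2 : (a - s - s).1 = (a - s).1 - s.1 := rfl
    rw [hsub2] at hmix
    rcases hsa with h1 | h1 <;> rcases hda with h2 | h2
    · left; rw [hadd]; exact add_mem h2 h1
    · rcases hmix (Submodule.inner_left_of_mem_orthogonal h1 h2) with h3 | h3
      · exact absurd h2 (hd0 ((Submodule.sub_mem_iff_left U h1).1 h3))
      · exact absurd ((Submodule.sub_mem_iff_right Uᗮ h2).1 h3) (hs0 h1)
    · rcases hmix (Submodule.inner_right_of_mem_orthogonal h2 h1) with h3 | h3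
      · exact absurd h1 (hs0 ((Submodule.sub_mem_iff_right U h2).1 h3))
      · exact absurd ((Submodule.sub_mem_iff_left Uᗮ h1).1 h3) (hd0 h2)
    · right; rw [hadd]; exact add_mem h2 h1
  have hCU : ∀ α ∈ C, α ∈ U ∨ α ∈ Uᗮ := fun α hα => by
    obtain ⟨m, hm, -⟩ := exists_add_eq_imag hCR hCpos hα
    exact hall _ hm
  refine hdisj δ'.1 hS'.1.1.1 (hC.connected (p := (· ∈ U)) ?_ hδ.1.1.1 hS'.1.1.1 hδU) hδ'U
  intro α hα β hβ hne hαU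
  exact (hCU β hβ).resolve_right fun h => hne (Submodule.inner_right_of_mem_orthogonal hαU h)

end Extension

end Components

/-! ### The subsystem spanned by the poles -/

section Subsystem

variable {V : Type*} [NormedAddCommGroup V] [InnerProductSpace ℝ V] {R Rpos : Set V}
  {q : ℝ} {k : ℝ → ℂ} {νlng : ℕ} {ξ : V →L[ℝ] ℂ}

/-- For generic `q`, the relations between the roots at which `t X = 1` are homogeneous. -/
lemma eq_sum_of_pole (hR : IsRootSet R) (hν : ∀ α ∈ R, nu α = 1 ∨ nu α = νlng) (hq : 0 < q)
    (hgen : ∀ m l₁ l₂ : ℤ, m ≠ 0 → (q : ℂ) ^ m ≠ tOf q k 1 ^ l₁ * tOf q k νlng ^ l₂)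
    {κ : Type*} [Fintype κ] {β : κ → V × ℝ} (hβ : ∀ i, β i ∈ affRoots R)
    (hpole : ∀ i, tPar q k (β i) * X q (β i) ξ = 1) {δ : V × ℝ} (hδ : δ ∈ affRoots R)
    (hδp : tPar q k δ * X q δ ξ = 1) {m : κ → ℤ} (hm : δ.1 = ∑ i, m i • (β i).1) :
    δ = ∑ i, m i • β i ∧ tPar q k δ = ∏ i, tPar q k (β i) ^ m i := by
  choose a ha using fun i => hR.exists_int_snd (hβ i)
  obtain ⟨d, hd⟩ := hR.exists_int_snd hδ
  have h1 : δ = ∑ i, m i • β i + (0, ((d - ∑ i, m i * a i : ℤ) : ℝ)) := by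
    refine Prod.ext ?_ ?_
    · simp [hm, Prod.fst_sum]
    · simp [hd, Prod.snd_sum, ha]
  have hX : ∀ i, X q (β i) ξ = (tPar q k (β i))⁻¹ := fun i =>
    eq_inv_of_mul_eq_one_right (hpole i)
  have hP : ∏ i, tPar q k (β i) ^ m i ≠ 0 :=
    Finset.prod_ne_zero_iff.2 fun i _ => zpow_ne_zero _ (tPar_ne_zero hq k _)
  have h2 : X q δ ξ = (∏ i, tPar q k (β i) ^ m i)⁻¹ * (q : ℂ) ^ (d - ∑ i, m i * a i) := by
    rw [h1, X_add hq, X_imag, X_sum_zsmul hq, ← Finset.prod_inv_distrib]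
    congr 1
    exact Finset.prod_congr rfl fun i _ => by rw [hX, inv_zpow]
  have ht := tPar_ne_zero hq k δ
  -- Otherwise a nonzero power of $q$ would be a monomial in $t_{sht},t_{lng}$. The index type
  -- `Option κ` adjoins $\delta$, with exponent $-1$, to the family.
  have h3 : d - ∑ i, m i * a i = 0 := by
    by_contra h0
    obtain ⟨l₁, l₂, h4⟩ := exists_prod_zpow_tPar (k := k) (κ := Option κ) hν hq
      (β := fun o => o.elim δ β) (fun o => by cases o; exacts [hδ.1, (hβ _).1]) Finset.univ
      fun o => o.elim (-1) m
    refine hgen _ l₁ l₂ h0 ?_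
    rw [← h4, Fintype.prod_option]
    simp only [Option.elim]
    rw [h2] at hδp
    rw [zpow_neg_one]
    field_simp at hδp ⊢
    exact hδp
  rw [h3] at h1 h2
  refine ⟨by rwa [Int.cast_zero, ← Prod.zero_eq_mk, add_zero] at h1, ?_⟩
  rw [h2] at hδp
  field_simp at hδp
  simpa using hδp

section

variable {κ : Type*} {β : κ → V × ℝ}

lemma isRootSet_spanRoots (hR : IsRootSet R) (β : κ → V × ℝ) : IsRootSet (spanRoots R β) where
  finite := hR.finite.subset fun _ h => h.1
  ne_zero α hα := hR.ne_zero α hα.1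
  exists_nu α hα := hR.exists_nu α hα.1
  reflect α hα δ hδ := by
    refine ⟨hR.reflect α hα.1 δ hδ.1, ?_⟩
    obtain ⟨m, hm⟩ := hR.integral α hα.1 δ hδ.1
    rw [hm, mul_div_cancel_left₀ _ (hR.nu_pos hα.1).ne', Int.cast_smul_eq_zsmul]
    exact Submodule.sub_mem _ hδ.2 (Submodule.smul_mem _ _ hα.2)
  integral α hα δ hδ := hR.integral α hα.1 δ hδ.1

lemma affSpanRoots_spanRoots : affSpanRoots (spanRoots R β) β = affSpanRoots R β := by
  ext γ
  refine ⟨fun h => ⟨⟨h.1.1.1, h.1.2⟩, h.2⟩, fun h => ⟨⟨⟨h.1.1, ?_⟩, h.1.2⟩, h.2⟩⟩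
  obtain ⟨-, h1⟩ := h
  induction h1 using Submodule.span_induction with
  | mem x hx => obtain ⟨i, rfl⟩ := hx; exact Submodule.subset_span ⟨i, rfl⟩
  | zero => exact Submodule.zero_mem _
  | add x y _ _ hx hy => exact Submodule.add_mem _ hx hy
  | smul a x _ hx => exact Submodule.smul_mem _ a hx

lemma IsAffineIsometry.linearIndependent_fst {g : (V × ℝ) ≃ₗ[ℝ] (V × ℝ)}
    (hg : IsAffineIsometry g) (hli : LinearIndependent ℝ fun i => (β i).1) :
    LinearIndependent ℝ fun i => (g (β i)).1 := by
  obtain ⟨c, w, -, rfl⟩ := hg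
  exact hli.map' w.toLinearMap w.ker

variable [Fintype κ]

omit [Fintype κ] in
lemma PoleData.one_lt_norm_tPar (h : PoleData R q k νlng ξ β) (hn : 1 < ‖tOf q k 1‖) {γ : V × ℝ}
    (hγ : γ.1 ∈ R) : 1 < ‖tPar q k γ‖ := by
  rcases tPar_eq_or h.nu_eq k hγ with h1 | h1
  · rwa [h1]
  · rcases h.param with h2 | h2
    · rwa [h1, ← h2]
    · rw [h1, ← h2, norm_pow]
      exact one_lt_pow₀ hn (by have := h.one_le; omega)

lemma exists_sum_smul_eq [FiniteDimensional ℝ V] {v : κ → V} (hli : LinearIndependent ℝ v)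
    (hcard : Fintype.card κ = Module.finrank ℝ V) (α : V) : ∃ c : κ → ℝ, α = ∑ i, c i • v i := by
  have h1 : α ∈ Submodule.span ℝ (Set.range v) := by
    rw [hli.span_eq_top_of_card_eq_finrank' hcard]; trivial
  obtain ⟨c, hc⟩ := (Submodule.mem_span_range_iff_exists_fun ℝ).1 h1
  exact ⟨c, hc.symm⟩

variable [FiniteDimensional ℝ V]

omit [FiniteDimensional ℝ V] in
/-- The roots of the subsystem at which `t X = 1` are positive. -/
lemma PoleData.mem_range_of_pole (h : PoleData R q k νlng ξ β) {r : V}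
    (hpos : IsPositive R Rpos r) (hli : LinearIndependent ℝ fun i => (β i).1)
    (hv : Set.range β = vanishing q k (affPos R Rpos) ξ) (hn : 1 < ‖tOf q k 1‖) {δ : V × ℝ}
    (hδ : δ ∈ affRoots (spanRoots R β)) (hδp : 1 - tPar q k δ * X q δ ξ = 0) :
    δ ∈ Set.range β := by
  have hδR : δ ∈ affRoots R := ⟨hδ.1.1, hδ.2⟩
  rw [hv]
  refine ⟨?_, hδp⟩
  refine ((isHalf_affPos h.root hpos).total δ hδR).resolve_right fun hneg => ?_
  have hp : tPar q k δ * X q δ ξ = 1 := (sub_eq_zero.1 hδp).symm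
  obtain ⟨m, hm⟩ := (Submodule.mem_span_range_iff_exists_fun ℤ).1 hδ.1.2
  obtain ⟨h1, -⟩ := eq_sum_of_pole h.root h.nu_eq h.q_pos h.generic h.mem h.pole hδR hp hm.symm
  have hspan : δ ∈ affSpanRoots R β :=
    ⟨hδR, (Submodule.mem_span_range_iff_exists_fun ℤ).2 ⟨m, h1.symm⟩⟩
  obtain ⟨x, hx⟩ := exists_evalPt_pos_iff h.root hpos
  have hβpos : ∀ i, 0 < evalPt x (β i) := fun i =>
    evalPt_pos hx (hv.subset ⟨i, rfl⟩ : β i ∈ vanishing q k (affPos R Rpos) ξ).1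
  have hδneg := evalPt_pos hx hneg
  rw [map_neg] at hδneg
  obtain ⟨n, h2 | h2⟩ := (h.isSimpleSystem_affSpanRoots hli).2.2 δ hspan
  · have h3 : 0 ≤ evalPt x δ := by
      rw [h2, map_sum]
      refine Finset.sum_nonneg fun i _ => ?_
      rw [map_nsmul]
      exact nsmul_nonneg (hβpos i).le _
    linarith
  -- Here $t_\delta=X_{-\delta}(q^\xi)$ would be a product of inverses of the $t_{\tilde\beta_i}$,
  -- of modulus at most $1$, whereas $|t_\delta|>1$.
  · have h3 : X q (-δ) ξ = ∏ i, (tPar q k (β i))⁻¹ ^ (n i : ℤ) := by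
      have h4 : -δ = ∑ i, (n i : ℤ) • β i := by rw [h2, neg_neg]; simp
      rw [h4, X_sum_zsmul h.q_pos]
      exact Finset.prod_congr rfl fun i _ => by rw [h.X_eq]
    rw [X_neg h.q_pos, ← eq_inv_of_mul_eq_one_left hp] at h3
    have h4 := h.one_lt_norm_tPar hn hδR.1
    rw [h3, norm_prod] at h4
    refine absurd h4 (not_lt.2 (Finset.prod_le_one (fun _ _ => norm_nonneg _) fun i _ => ?_))
    rw [zpow_natCast, norm_pow, norm_inv]
    exact pow_le_one₀ (by positivity) (inv_le_one_of_one_le₀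
      (h.one_lt_norm_tPar hn (h.mem i).1).le)

/-- Poles of `μ` with `n` vanishing binomials: reduction to the simple roots of the subsystem. -/
theorem PoleData.exists_affWeyl_residue [DecidableEq κ] (h : PoleData R q k νlng ξ β) {r : V}
    (hpos : IsPositive R Rpos r) (hq1 : q < 1) (hli : LinearIndependent ℝ fun i => (β i).1)
    (hcard : Fintype.card κ = Module.finrank ℝ V)
    (hv : Set.range β = vanishing q k (affPos R Rpos) ξ) (hn : 1 < ‖tOf q k 1‖)
    {Rt' Rtpos' : Set (V × ℝ)} (hRt' : Rt' = affRoots (spanRoots R β))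
    (hRtpos' : Rtpos' = Rt' ∩ affPos R Rpos) :
    ∃ w' ∈ affWeyl Rt',
      (∀ i, w'⁻¹ (β i) ∈ simpleRoots Rtpos') ∧
      (∀ C : Set V, IsComponent (fun x y => inner ℝ x y) (spanRoots R β) C →
        ∃! γ : V × ℝ, γ ∈ simpleRoots (affRoots C ∩ affPos R Rpos) ∧
          γ ∉ Set.range fun i => w'⁻¹ (β i)) ∧
      (∀ ξ₀ : V →L[ℝ] ℂ, ξ₀ = actPt w'⁻¹ ξ →
        ∃ s v r₀ : ℂ,
          HasProd (fun γ : Rtpos' => deletedFactor q k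
            (Set.range fun i => w'⁻¹ (β i)) ξ₀ γ) r₀ ∧
          HasMuResidue q k (mu q k Rtpos') (fun i => w'⁻¹ (β i)) ξ₀ r₀ ∧
          v = ∏ᶠ γ ∈ lambdaSet Rtpos' w',
            ((tPar q k γ)⁻¹ - X q γ ξ₀) / (1 - (tPar q k γ)⁻¹ * X q γ ξ₀) ∧
          HasValueAt (regularPts q k R)
            (fun x => mu q k Rtpos' (actPt w' x) / mu q k Rtpos' x) ξ₀ v ∧
          HasMuResidue q k (mu q k Rtpos') β ξ (v * r₀) ∧
          s ≠ 0 ∧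
          HasValueAt (regularPts q k R) (fun x => mu q k (affPos R Rpos) x / mu q k Rtpos' x) ξ s ∧
          HasMuResidue q k (mu q k (affPos R Rpos)) β ξ (s * (v * r₀))) := by
  have hR' := isRootSet_spanRoots h.root β
  have hsub : spanRoots R β ⊆ R := fun _ hα => hα.1
  have hpos' := hpos.mono hsub
  have hΨ : Rtpos' = affPos (spanRoots R β) (spanRoots R β ∩ Rpos) := by
    rw [hRtpos', hRt', affRoots_inter_affPos hsub]
  have hΨR : Rtpos' ⊆ affPos R Rpos := by rw [hRtpos']; exact Set.inter_subset_right
  have hhalf : IsHalf (affRoots (spanRoots R β)) Rtpos' := hΨ ▸ isHalf_affPos hR' hpos'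
  have hβ' : ∀ i, β i ∈ affRoots (spanRoots R β) := fun i =>
    ⟨⟨(h.mem i).1, Submodule.subset_span ⟨i, rfl⟩⟩, (h.mem i).2⟩
  have hβv : ∀ i, β i ∈ vanishing q k (affPos R Rpos) ξ := fun i => hv.subset ⟨i, rfl⟩
  have hβpos : ∀ i, β i ∈ Rtpos' := fun i => by
    rw [hRtpos', hRt']; exact ⟨hβ' i, (hβv i).1⟩
  obtain ⟨w', hw', hsimple⟩ := exists_affWeyl_simpleRoots hR' hpos' hli hcard hβ'
    (fun α hα => hα.2) (by rw [affSpanRoots_spanRoots]; exact h.isSimpleSystem_affSpanRoots hli)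
  obtain ⟨hiso, hperm, hperm'⟩ := affWeyl_induction hR' le_rfl hw'
  have hli' : LinearIndependent ℝ fun i => (w'⁻¹ (β i)).1 := hiso.inv.linearIndependent_fst hli
  have hwi : ∀ γ, w' (w'⁻¹ γ) = γ := fun γ => w'.apply_symm_apply γ
  have hiw : ∀ γ, w'⁻¹ (w' γ) = γ := fun γ => w'.symm_apply_apply γ
  refine ⟨w', hRt' ▸ hw', fun i => hΨ ▸ hsimple i, fun C hC => ?_, ?_⟩
  · have h1 := existsUnique_simpleRoot hR' hpos' hli' (exists_sum_smul_eq hli' hcard) hsimple hC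
    rw [affRoots_inter_affPos hC.subset, ← Set.inter_assoc,
      Set.inter_eq_left.2 hC.subset] at h1
    rwa [affRoots_inter_affPos (hC.subset.trans hsub)]
  rintro ξ₀ rfl
  have hadm := admissible_affPos (Rpos := Rpos) h.root h.q_pos hq1
  have hadm' := hadm.mono hΨR
  have hX₀ : ∀ γ, X q γ (actPt w'⁻¹ ξ) = X q (w' γ) ξ := fun γ => by
    rw [hiso.inv.X_actPt', inv_inv]
  have hξ : actPt w' (actPt w'⁻¹ ξ) = ξ := actPt_actPt_inv hiso ξ
  have hpole₀ : ∀ γ ∈ affRoots (spanRoots R β), 1 - tPar q k γ * X q γ (actPt w'⁻¹ ξ) = 0 →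
      ∃ i, w'⁻¹ (β i) = γ := by
    intro γ hγ h1
    rw [hX₀, ← hiso.tPar_map] at h1
    obtain ⟨i, hi⟩ := h.mem_range_of_pole hpos hli hv hn (hperm _ hγ) h1
    exact ⟨i, by rw [hi, hiw]⟩
  have hsmem : ∀ i, w'⁻¹ (β i) ∈ Rtpos' := fun i => hΨ ▸ (hsimple i).1
  have hv₀ : vanishing q k Rtpos' (actPt w'⁻¹ ξ) = Set.range fun i => w'⁻¹ (β i) := by
    ext γ
    constructor
    · intro hγ
      exact hpole₀ γ (hhalf.subset hγ.1) hγ.2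
    · rintro ⟨i, rfl⟩
      refine ⟨hsmem i, ?_⟩
      rw [hX₀, hwi, hiso.inv.tPar_map]
      exact (hβv i).2
  have hv' : vanishing q k Rtpos' ξ = Set.range β := by
    ext γ
    rw [hv]
    constructor
    · exact fun hγ => ⟨hΨR hγ.1, hγ.2⟩
    · intro hγ
      obtain ⟨i, rfl⟩ := hv.symm.subset hγ
      exact ⟨hβpos i, hγ.2⟩
  have hfin : (lambdaSet Rtpos' w').Finite := hΨ ▸ finite_lambdaSet hR' le_rfl hiso
  have hcl : ∀ x, x ∈ closure (regularPts q k R) := fun x =>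
    mem_closure_regularPts h.q_pos hq1 k h.root.finite hpos.inner_ne x
  have hr₀ := (hadm'.multipliable_deletedFactor h.q_pos k (Set.range fun i => w'⁻¹ (β i))
    (actPt w'⁻¹ ξ)).hasProd
  have himg : w' '' (Set.range fun i => w'⁻¹ (β i)) = Set.range β := by
    rw [← Set.range_comp]
    congr 1
    exact funext fun i => hwi _
  -- No binomial of $\Lambda(w')$ vanishes at $\xi_0$: it would belong to some
  -- $(w')^{-1}\tilde\beta_i$, whose image $\tilde\beta_i$ is positive.
  have hβr := hasProd_deletedFactor_actPt h.q_pos hhalf hiso hperm hperm' hfin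
    (S := Set.range fun i => w'⁻¹ (β i)) (by rintro _ ⟨i, rfl⟩; exact hsmem i)
    (by rw [himg]; rintro _ ⟨i, rfl⟩; exact hβpos i) (x := actPt w'⁻¹ ξ)
    (fun γ hγ h1 => by
      obtain ⟨i, rfl⟩ := hpole₀ γ (hhalf.subset hγ.1) h1
      have := hγ.2
      rw [hwi] at this
      exact hhalf.disjoint _ (hβpos i) this) hr₀
  rw [himg, hξ] at hβr
  obtain ⟨s, hs, hsval, hsprod⟩ := exists_hasValueAt_mu_div (k := k) h.q_pos hΨR
    (fun γ hγ => hγ.1) hadm (hcl ξ) (by rw [← hv]; rintro _ ⟨i, rfl⟩; exact hβpos i)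
    fun γ hγ => sub_ne_zero.2 (h.numerator γ hγ.1).symm
  refine ⟨s, _, _, hr₀, hadm'.hasMuResidue h.q_pos hq1 k hli' hcard _ hv₀ hr₀, rfl,
    hasValueAt_mu_actPt h.q_pos hhalf hadm' hiso hperm hperm' hfin
      (fun γ hγ => ⟨hsub hγ.1, hγ.2⟩) (hcl _) fun γ hγ h1 => ?_,
    hadm'.hasMuResidue h.q_pos hq1 k hli hcard _ hv' hβr, hs, hsval,
    hadm.hasMuResidue h.q_pos hq1 k hli hcard _ hv.symm (hsprod _ ?_ _ hβr)⟩
  -- If $1-t^{-1}X_\gamma$ vanished at $\xi_0$, then $-w'\gamma$ would be one of the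
  -- $\tilde\beta_i$, and $-\gamma$ would be positive together with $\gamma$.
  · have h2 : 1 - tPar q k (-(w' γ)) * X q (-(w' γ)) ξ = 0 := by
      rw [hX₀] at h1
      have h3 := tPar_ne_zero h.q_pos k γ
      have h4 := X_ne_zero h.q_pos (w' γ) ξ
      rw [tPar_neg, hiso.tPar_map, X_neg h.q_pos]
      field_simp at h1 ⊢
      linear_combination -h1
    have h5 : -(w' γ) ∈ vanishing q k Rtpos' ξ := ⟨hγ.2, h2⟩
    rw [hv'] at h5
    obtain ⟨i, hi⟩ := h5
    refine hhalf.disjoint _ hγ.1 ?_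
    have : -γ = w'⁻¹ (β i) := by rw [hi, map_neg, hiw]
    rw [this]; exact hsmem i
  · rintro _ ⟨i, rfl⟩; exact hβpos i

end

end Subsystem

/-! ### Simple roots and descent; systems with one short simple root -/

section SimpleRootData

variable {V : Type*} [NormedAddCommGroup V] [InnerProductSpace ℝ V] {R Rpos : Set V} {r : V}
  {κ : Type*} [Fintype κ] {v : κ → V} {νlng : ℕ}

/-- A reduced irreducible root system with simple roots `v`, at most two root lengths, and the
short roots normalized by `ν = 1`. -/
structure SimpleData (R Rpos : Set V) (r : V) (v : κ → V) (νlng : ℕ) : Prop where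
  root : IsRootSet R
  simple : IsSimpleSystem R v
  pos : IsPositive R Rpos r
  height : ∀ i, ⟪r, v i⟫ = 1
  nu_eq : ∀ α ∈ R, nu α = 1 ∨ nu α = νlng
  nulng : νlng = 1 ∨ νlng = 2 ∨ νlng = 3
  connected : ∀ (p : κ → Prop) (i j : κ), p i → (∀ i j, p i → ⟪v i, v j⟫ ≠ 0 → p j) → p j

/-- Both $\alpha-\beta$ and $\alpha+\beta$ are nonzero, so $\nu_\alpha+\nu_\beta\mp m\nu_\beta>0$
for $m=(\alpha,\beta^\vee)$; with $\nu_\alpha\le\nu_\beta$ this gives $|m|<2$. -/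
lemma inner_cases (hR : IsRootSet R) {α β : V} (hα : α ∈ R) (hβ : β ∈ R) (hle : nu α ≤ nu β)
    (hne : α ≠ β) (hne' : α ≠ -β) : ⟪α, β⟫ = 0 ∨ ⟪α, β⟫ = nu β ∨ ⟪α, β⟫ = -nu β := by
  obtain ⟨m, hm⟩ := hR.integral β hβ α hα
  have h1 : 0 < nu (α - β) := by
    rw [nu]; exact div_pos (real_inner_self_pos.2 (sub_ne_zero.2 hne)) two_pos
  have h2 : 0 < nu (α - -β) := by
    rw [nu]; exact div_pos (real_inner_self_pos.2 (sub_ne_zero.2 hne')) two_pos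
  rw [nu_sub, hm] at h1
  rw [nu_sub, nu_neg, inner_neg_right, hm] at h2
  have hβ0 := hR.nu_pos hβ
  have h3 : (m : ℝ) < 2 := by nlinarith
  have h4 : (-2 : ℝ) < m := by nlinarith
  have h5 : m < 2 := by exact_mod_cast h3
  have h6 : -2 < m := by exact_mod_cast h4
  rw [hm]
  obtain rfl | rfl | rfl : m = 0 ∨ m = 1 ∨ m = -1 := by omega
  · simp
  · simp
  · simp

lemma reflect_of_inner_eq (hR : IsRootSet R) {α β : V} (hα : α ∈ R) (hβ : β ∈ R) {c : ℝ}
    (h : ⟪β, α⟫ = c * nu α) : β - c • α ∈ R := by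
  have := hR.reflect α hα β hβ
  rwa [h, mul_div_cancel_right₀ _ (hR.nu_pos hα).ne'] at this

lemma nu_reflect {α β : V} {c : ℝ} (hc : ⟪α, β⟫ = c * nu β) : nu (α - c • β) = nu α := by
  have : nu (c • β) = c ^ 2 * nu β := by
    simp only [nu, inner_smul_left, inner_smul_right]; simp; ring
  rw [nu_sub, inner_smul_right, hc, this]; ring

lemma inner_self_pos_of_inner_pos {w : V} (hw : 0 < ⟪r, w⟫) : 0 < ⟪w, w⟫ :=
  real_inner_self_pos.2 fun h0 => by simp [h0] at hw

namespace SimpleData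

variable (h : SimpleData R Rpos r v νlng)
include h

lemma mem (i : κ) : v i ∈ R := h.simple.2.1 i

lemma mem_pos (i : κ) : v i ∈ Rpos :=
  (h.pos.mem_iff _).2 ⟨h.mem i, by rw [h.height]; exact one_pos⟩

lemma mem_of_pos {α : V} (hα : α ∈ Rpos) : α ∈ R := ((h.pos.mem_iff _).1 hα).1

lemma inner_sum_nat (m : κ → ℕ) : ⟪r, ∑ i, m i • v i⟫ = ∑ i, (m i : ℝ) := by
  rw [inner_sum]
  refine Finset.sum_congr rfl fun i _ => ?_
  rw [← Nat.cast_smul_eq_nsmul ℝ, inner_smul_right, h.height, mul_one]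

lemma exists_nat {α : V} (hα : α ∈ Rpos) : ∃ m : κ → ℕ, α = ∑ i, m i • v i := by
  obtain ⟨h1, h2⟩ := (h.pos.mem_iff α).1 hα
  obtain ⟨m, hm | hm⟩ := h.simple.2.2 α h1
  · exact ⟨m, hm⟩
  · rw [hm, inner_neg_right, h.inner_sum_nat] at h2
    have : 0 ≤ ∑ i, (m i : ℝ) := Finset.sum_nonneg fun _ _ => Nat.cast_nonneg _
    linarith

lemma neg_mem_pos {α : V} (hα : α ∈ R) (hα' : α ∉ Rpos) : -α ∈ Rpos :=
  mem_affPos_neg h.root h.pos hα hα'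

lemma neg_notMem_pos {α : V} (hα : α ∈ Rpos) : -α ∉ Rpos := fun h1 => by
  have h2 := ((h.pos.mem_iff _).1 hα).2
  have h3 := ((h.pos.mem_iff _).1 h1).2
  rw [inner_neg_right] at h3
  linarith

lemma inner_nonpos {x α : V} (hx : ∀ i, ⟪x, v i⟫ ≤ 0) (hα : α ∈ Rpos) : ⟪x, α⟫ ≤ 0 := by
  obtain ⟨m, rfl⟩ := h.exists_nat hα
  rw [inner_sum]
  refine Finset.sum_nonpos fun i _ => ?_
  rw [← Nat.cast_smul_eq_nsmul ℝ, inner_smul_right]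
  exact mul_nonpos_of_nonneg_of_nonpos (Nat.cast_nonneg _) (hx i)

lemma exists_inner_pos {α : V} (hα : α ∈ Rpos) : ∃ i, 0 < ⟪α, v i⟫ := by
  by_contra! hcon
  have h1 := h.inner_nonpos hcon hα
  rw [inner_self_eq_nu] at h1
  linarith [h.root.nu_pos (h.mem_of_pos hα)]

lemma one_le_nulng : (1 : ℝ) ≤ νlng := by
  rcases h.nulng with h1 | h1 | h1 <;> rw [h1] <;> norm_num

lemma eq_of_eq_nsmul {α : V} (hα : α ∈ R) {m : ℕ} {i : κ} (hm : α = m • v i) : α = v i := by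
  have h1 : nu α = m ^ 2 * nu (v i) := by
    rw [hm, ← Nat.cast_smul_eq_nsmul ℝ, nu, nu, inner_smul_left, inner_smul_right]
    simp; ring
  have hm1 : m = 1 := by
    rcases Nat.lt_or_ge m 2 with h2 | h2
    · obtain rfl | rfl : m = 0 ∨ m = 1 := by omega
      · rw [zero_smul] at hm
        exact absurd hm (h.root.ne_zero α hα)
      · rfl
    · have h3 : (2 : ℝ) ≤ m := by exact_mod_cast h2
      have h4 := one_le_nu h.root (h.mem i)
      have h5 : nu α ≤ 3 := by
        rcases h.nu_eq α hα with h5 | h5 <;> rw [h5]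
        · norm_num
        · rcases h.nulng with h6 | h6 | h6 <;> rw [h6] <;> norm_num
      nlinarith
  rw [hm, hm1, one_smul]

/-- The coefficients at the other simple roots do not change, and one of them is positive because
the only root proportional to $v_i$ and positive is $v_i$; it determines the sign. -/
lemma sub_zsmul_mem_pos {α : V} (hα : α ∈ Rpos) {i : κ} (hne : α ≠ v i) {c : ℤ}
    (hm : α - c • v i ∈ R) : α - c • v i ∈ Rpos := by
  classical
  by_contra hcon
  obtain ⟨m, hm'⟩ := h.exists_nat hα
  obtain ⟨n, hn⟩ := h.exists_nat (h.neg_mem_pos hm hcon)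
  have h1 : ∑ j, ((m j : ℝ) + n j - if j = i then (c : ℝ) else 0) • v j = 0 := by
    simp only [sub_smul, add_smul, Finset.sum_sub_distrib, Finset.sum_add_distrib, ite_smul,
      zero_smul, Finset.sum_ite_eq', Finset.mem_univ, if_true, Nat.cast_smul_eq_nsmul,
      Int.cast_smul_eq_zsmul]
    rw [← hn, ← hm']
    abel
  have h2 : ∀ j, j ≠ i → m j = 0 := fun j hj => by
    have := Fintype.linearIndependent_iff.1 h.simple.1 _ h1 j
    rw [if_neg hj, sub_zero] at this
    have h3 : m j + n j = 0 := by exact_mod_cast this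
    omega
  refine hne (h.eq_of_eq_nsmul (h.mem_of_pos hα) (m := m i) ?_)
  rw [hm', Finset.sum_eq_single i (fun j _ hj => by rw [h2 j hj, zero_smul]) (by simp)]

lemma reflect_mem_pos {α : V} (hα : α ∈ Rpos) {i : κ} (hne : α ≠ v i) {c : ℤ}
    (hc : ⟪α, v i⟫ = c * nu (v i)) : α - (c : ℝ) • v i ∈ Rpos := by
  have h1 := reflect_of_inner_eq h.root (h.mem i) (h.mem_of_pos hα) hc
  rw [Int.cast_smul_eq_zsmul] at h1 ⊢
  exact h.sub_zsmul_mem_pos hα hne h1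

/-- Induction over the positive roots, by reflections that lower the height. -/
lemma descent {p : V → Prop} (h1 : ∀ i, p (v i))
    (h2 : ∀ α ∈ Rpos, ∀ (i : κ) (c : ℤ), α ≠ v i → 0 < c → ⟪α, v i⟫ = c * nu (v i) →
      α - (c : ℝ) • v i ∈ Rpos → p (α - (c : ℝ) • v i) → p α) {α : V} (hα : α ∈ Rpos) : p α := by
  obtain ⟨N, hN⟩ : ∃ N : ℕ, ⟪r, α⟫ = N := by
    obtain ⟨m, hm⟩ := h.exists_nat hα
    exact ⟨∑ i, m i, by rw [hm, h.inner_sum_nat]; push_cast; rfl⟩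
  induction N using Nat.strong_induction_on generalizing α with
  | _ N ih =>
  obtain ⟨i, hi⟩ := h.exists_inner_pos hα
  by_cases hne : α = v i
  · rw [hne]; exact h1 i
  obtain ⟨c, hc⟩ := h.root.integral (v i) (h.mem i) α (h.mem_of_pos hα)
  rw [mul_comm] at hc
  have hc0 : 0 < c := by
    by_contra! h0
    have h3 : (c : ℝ) ≤ 0 := by exact_mod_cast h0
    have := h.root.nu_pos (h.mem i)
    rw [hc] at hi
    nlinarith
  have h3 := h.reflect_mem_pos hα hne hc
  obtain ⟨m, hm⟩ := h.exists_nat h3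
  have h4 : ⟪r, α - (c : ℝ) • v i⟫ = (∑ i, m i : ℕ) := by rw [hm, h.inner_sum_nat]; push_cast; rfl
  refine h2 α hα i c hne hc0 hc h3 (ih _ ?_ h3 h4)
  rw [inner_sub_right, inner_smul_right, h.height, hN] at h4
  have h5 : (1 : ℝ) ≤ c := by exact_mod_cast hc0
  have h6 : ((∑ i, m i : ℕ) : ℝ) < N := by linarith
  exact_mod_cast h6

lemma exists_simple_nu_eq {α : V} (hα : α ∈ Rpos) : ∃ i, nu (v i) = nu α := by
  refine h.descent (p := fun α => ∃ i, nu (v i) = nu α) (fun i => ⟨i, rfl⟩) ?_ hα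
  rintro α - i c - - hc - ⟨j, hj⟩
  exact ⟨j, by rw [hj, nu_reflect hc]⟩

lemma ne_neg {α β : V} (hα : α ∈ Rpos) (hβ : β ∈ Rpos) : α ≠ -β := fun h1 =>
  h.neg_notMem_pos hβ (h1 ▸ hα)

lemma injective : Function.Injective v := h.simple.1.injective

lemma inner_simple_nonpos {i j : κ} (hij : i ≠ j) : ⟪v i, v j⟫ ≤ 0 := by
  by_contra! h1
  have hne : v i ≠ v j := fun h2 => hij (h.injective h2)
  have h2 := h.root.sub_mem (h.mem i) (h.mem j) hne h1
  rcases (em (v i - v j ∈ Rpos)) with h3 | h3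
  · obtain ⟨m, hm⟩ := h.exists_nat h3
    have h4 := congrArg (fun x => ⟪r, x⟫) hm
    simp only [inner_sub_right, h.height, h.inner_sum_nat, sub_self] at h4
    refine h.root.ne_zero _ h2 ?_
    rw [hm]
    refine Finset.sum_eq_zero fun x _ => ?_
    have := (Finset.sum_eq_zero_iff_of_nonneg fun i _ => Nat.cast_nonneg (α := ℝ) (m i)).1 h4.symm
      x (Finset.mem_univ x)
    rw [Nat.cast_eq_zero.1 this, zero_smul]
  · have h4 := ((h.pos.mem_iff _).1 (h.neg_mem_pos h2 h3)).2
    simp [inner_sub_right, h.height] at h4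

/-- Inner products of simple roots. -/
lemma inner_simple {i j : κ} (hij : i ≠ j) (hle : nu (v i) ≤ nu (v j)) :
    ⟪v i, v j⟫ = 0 ∨ ⟪v i, v j⟫ = -nu (v j) := by
  have h1 := h.inner_simple_nonpos hij
  rcases inner_cases h.root (h.mem i) (h.mem j) hle (fun h2 => hij (h.injective h2))
    (h.ne_neg (h.mem_pos i) (h.mem_pos j)) with h2 | h2 | h2
  · exact Or.inl h2
  · linarith [h.root.nu_pos (h.mem j)]
  · exact Or.inr h2

end SimpleData

/-! ### Specializations of the roots -/

/-- A character of the root lattice that is not `1` at the roots. -/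
structure Specialization (R : Set V) (v : κ → V) (νlng : ℕ) (T : V → ℂ) (ts tl : ℂ) : Prop where
  map_add : ∀ x y, T (x + y) = T x * T y
  ne_zero : ∀ x, T x ≠ 0
  ne_one : ∀ α ∈ R, T α ≠ 1
  short : ∀ i, nu (v i) = 1 → T (v i) = ts
  long : ∀ i, nu (v i) = νlng → T (v i) = tl

namespace Specialization

variable {T : V → ℂ} {ts tl : ℂ} (hT : Specialization R v νlng T ts tl)
include hT

omit [Fintype κ] in
lemma map_zero : T 0 = 1 := by
  have h1 := hT.map_add 0 0
  rw [add_zero] at h1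
  exact (mul_eq_left₀ (hT.ne_zero 0)).1 h1.symm

omit [Fintype κ] in
lemma map_sub (x y : V) : T (x - y) = T x / T y := by
  rw [eq_div_iff (hT.ne_zero y), ← hT.map_add, sub_add_cancel]

omit [Fintype κ] in
lemma map_nsmul (n : ℕ) (x : V) : T (n • x) = T x ^ n := by
  induction n with
  | zero => rw [zero_smul, pow_zero, hT.map_zero]
  | succ n ih => rw [succ_nsmul, hT.map_add, ih, pow_succ]

variable (h : SimpleData R Rpos r v νlng)
include h

/-- If `T` takes at a nonsimple positive root the value that it takes at simple roots of the same
length, then this root is obtuse to these simple roots. -/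
lemma inner_nonpos_of_eq {α : V} (hα : α ∈ Rpos) (hns : ∀ i, α ≠ v i) {j : κ}
    (hj : T (v j) = T α) : ⟪α, v j⟫ ≤ 0 := by
  by_contra! h1
  refine hT.ne_one _ (h.root.sub_mem (h.mem_of_pos hα) (h.mem j) (hns j) h1) ?_
  rw [hT.map_sub, hj, div_self (hT.ne_zero _)]

/-- The system has one short simple root, and `ν_lng = 2`: short roots. -/
lemma short_of_unique_short (hν : νlng = 2) (hb : ∀ i j, nu (v i) = 1 → nu (v j) = 1 → i = j)
    {α : V} (hα : α ∈ Rpos) (hα1 : nu α = 1) (hns : ∀ i, α ≠ v i) : T α ≠ ts := by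
  obtain ⟨s, hs⟩ := h.exists_simple_nu_eq hα
  rw [hα1] at hs
  have hlong : ∀ i, i ≠ s → nu (v i) = 2 := fun i hi => by
    have := (h.nu_eq _ (h.mem i)).resolve_left fun h1 => hi (hb _ _ h1 hs)
    rw [this, hν]; norm_num
  -- a short root is orthogonal or proportional to the short simple root
  have horth : ∀ β ∈ Rpos, nu β = 1 → β ≠ v s → ⟪β, v s⟫ = 0 := by
    intro β hβ hβ1 hne
    -- Long simple roots have inner product $0$ or $-2$ with $v_s$, and $(v_s,v_s)=2$. A short root
    -- different from $\pm v_s$ would have $0$ or $\pm1$, so parity leaves $0$.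
    have heven : ∀ γ ∈ Rpos, ∃ m : ℤ, ⟪γ, v s⟫ = 2 * m := by
      intro γ hγ
      obtain ⟨m, rfl⟩ := h.exists_nat hγ
      have h1 : ∀ i, ∃ a : ℤ, ⟪v i, v s⟫ = 2 * a := fun i => by
        by_cases hi : i = s
        · exact ⟨1, by rw [hi, inner_self_eq_nu, hs]; simp⟩
        · have := h.inner_simple (Ne.symm hi) (by rw [hs, hlong i hi]; norm_num)
          rw [real_inner_comm, hlong i hi] at this
          rcases this with h2 | h2
          · exact ⟨0, by rw [h2]; simp⟩
          · exact ⟨-1, by rw [h2]; simp⟩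
      choose a ha using h1
      refine ⟨∑ i, m i * a i, ?_⟩
      rw [sum_inner]
      push_cast
      rw [Finset.mul_sum]
      refine Finset.sum_congr rfl fun i _ => ?_
      rw [← Nat.cast_smul_eq_nsmul ℝ, inner_smul_left, ha]
      simp; ring
    obtain ⟨m, hm⟩ := heven β hβ
    rcases inner_cases h.root (h.mem_of_pos hβ) (h.mem s) (by rw [hβ1, hs]) hne
      (h.ne_neg hβ (h.mem_pos s)) with h1 | h1 | h1
    · exact h1
    · rw [hs, hm] at h1
      have : 2 * m = 1 := by exact_mod_cast h1
      omega
    · rw [hs, hm] at h1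
      have : 2 * m = -1 := by exact_mod_cast h1
      omega
  -- Descent through long simple roots $v_i$: the orthogonality relations give $v_i\perp v_s$, so
  -- the reflection of $\beta-v_i-v_s$ in $v_i$ is $\beta-v_s$.
  have key : ∀ β ∈ Rpos, nu β = 1 → β ≠ v s → β - v s ∈ R := by
    intro β hβ
    refine h.descent (p := fun β => nu β = 1 → β ≠ v s → β - v s ∈ R) (fun i hi hne => ?_) ?_ hβ
    · exact absurd (congrArg v (hb i s hi hs)) hne
    intro β hβ i c hne hc0 hc hβ' ih hβ1 hβs
    have hβs0 := horth β hβ hβ1 hβs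
    have his : i ≠ s := by
      rintro rfl
      rw [hβs0, hs] at hc
      have h1 : (c : ℝ) = 0 := by linarith
      have : c = 0 := by exact_mod_cast h1
      omega
    have hi2 := hlong i his
    have hc1 : c = 1 := by
      have h1 : (0 : ℝ) < c := by exact_mod_cast hc0
      rcases inner_cases h.root (h.mem_of_pos hβ) (h.mem i) (by rw [hβ1, hi2]; norm_num) hne
        (h.ne_neg hβ (h.mem_pos i)) with h2 | h2 | h2
      · rw [hc, hi2] at h2; linarith
      · rw [hc, hi2] at h2
        have h3 : (c : ℝ) = 1 := by linarith
        exact_mod_cast h3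
      · rw [hc, hi2] at h2; linarith
    subst hc1
    rw [Int.cast_one, one_smul] at hβ' ih
    have hn1 : nu (β - v i) = 1 := by
      have := nu_reflect hc
      rwa [Int.cast_one, one_smul, hβ1] at this
    by_cases h1 : β - v i = v s
    · have : β - v s = v i := by rw [← h1]; abel
      rw [this]; exact h.mem i
    have h2 := horth _ hβ' hn1 h1
    rw [inner_sub_left, hβs0, zero_sub, neg_eq_zero] at h2
    have h3 := ih hn1 h1
    have h4 : ⟪β - v i - v s, v i⟫ = (-1) * nu (v i) := by
      rw [inner_sub_left, inner_sub_left, hc, inner_self_eq_nu, real_inner_comm, h2]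
      push_cast; ring
    have h5 := reflect_of_inner_eq h.root (h.mem i) h3 h4
    rwa [neg_one_smul, sub_neg_eq_add, sub_add_eq_add_sub, sub_add_cancel] at h5
  intro hTα
  refine hT.ne_one _ (key α hα hα1 (hns s)) ?_
  rw [hT.map_sub, hTα, hT.short s hs, div_self]
  exact hT.short s hs ▸ hT.ne_zero _

/-- The system has one short simple root, and `ν_lng = 2`: long roots. -/
lemma long_of_unique_short (hν : νlng = 2) (hb : ∀ i j, nu (v i) = 1 → nu (v j) = 1 → i = j)
    (hts : ts ^ 2 ≠ 1) {α : V} (hα : α ∈ Rpos) (hα2 : nu α = 2) (hns : ∀ i, α ≠ v i) :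
    T α ≠ tl := by
  intro hTα
  have hν' : ((νlng : ℕ) : ℝ) = 2 := by rw [hν]; norm_num
  have hopp : ∀ i, nu (v i) = 2 → ⟪α, v i⟫ ≤ 0 := fun i hi =>
    hT.inner_nonpos_of_eq h hα hns (by rw [hTα, hT.long i (by rw [hi, hν'])])
  obtain ⟨s, hs⟩ := h.exists_inner_pos hα
  have hs1 : nu (v s) = 1 := by
    refine (h.nu_eq _ (h.mem s)).resolve_right fun h1 => ?_
    exact absurd hs (not_lt.2 (hopp s (by rw [h1, hν'])))
  have hlong : ∀ i, i ≠ s → nu (v i) = 2 := fun i hi => by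
    have := (h.nu_eq _ (h.mem i)).resolve_left fun h1 => hi (hb _ _ h1 hs1)
    rw [this, hν']
  have hin : ⟪α, v s⟫ = 2 := by
    have := inner_cases h.root (h.mem s) (h.mem_of_pos hα) (by rw [hs1, hα2]; norm_num)
      (hns s).symm (h.ne_neg (h.mem_pos s) hα)
    rw [real_inner_comm, hα2] at this
    rcases this with h1 | h1 | h1 <;> linarith
  have hβ : α - ((2 : ℤ) : ℝ) • v s ∈ Rpos :=
    h.reflect_mem_pos hα (hns s) (by rw [hin, hs1]; norm_num)
  have hβ2 : nu (α - ((2 : ℤ) : ℝ) • v s) = 2 := by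
    rw [nu_reflect (by rw [hin, hs1]; norm_num), hα2]
  -- If $\beta$ is simple, comparison of the values of $T$ gives $t_{sht}^2=1$. Otherwise
  -- $\beta+v_s$ is obtuse to all simple roots, although its inner product with the positive root
  -- $\beta$ is $4-2$.
  set β := α - ((2 : ℤ) : ℝ) • v s with hβd
  have hβα : α = β + 2 • v s := by
    rw [hβd, Int.cast_smul_eq_zsmul]; abel
  by_cases hβs : ∃ i, β = v i
  · obtain ⟨i, hi⟩ := hβs
    refine hts ?_
    have h1 : T α = tl * ts ^ 2 := by
      rw [hβα, hT.map_add, hT.map_nsmul, hi, hT.short s hs1, hT.long i (by rw [← hi, hβ2, hν'])]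
    have htl : tl ≠ 0 := hTα ▸ hT.ne_zero α
    rw [hTα] at h1
    exact (mul_eq_left₀ htl).1 h1.symm
  · push Not at hβs
    have hx : ∀ i, ⟪β + v s, v i⟫ ≤ 0 := by
      intro i
      by_cases hi : i = s
      · rw [hi, hβd, inner_add_left, inner_sub_left, inner_smul_left, hin, inner_self_eq_nu, hs1]
        norm_num
      · have hi2 := hlong i hi
        have hαi := hopp i hi2
        have hβi : ⟪β, v i⟫ = ⟪α, v i⟫ - 2 * ⟪v s, v i⟫ := by
          rw [hβd, inner_sub_left, inner_smul_left]; norm_num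
        rw [inner_add_left]
        rcases h.inner_simple (Ne.symm hi) (by rw [hs1, hi2]; norm_num) with h1 | h1
        · rw [hβi, h1]; linarith
        · rw [h1, hi2]
          rcases inner_cases h.root (h.mem_of_pos hβ) (h.mem i) (by rw [hβ2, hi2]) (hβs i)
            (h.ne_neg hβ (h.mem_pos i)) with h2 | h2 | h2 <;> rw [h2] <;> linarith
    have h1 := h.inner_nonpos hx hβ
    have h2 : ⟪v s, β⟫ = -2 := by
      rw [hβd, inner_sub_right, inner_smul_right, real_inner_comm, hin, inner_self_eq_nu, hs1]
      norm_num
    rw [inner_add_left, inner_self_eq_nu, hβ2, h2] at h1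
    norm_num at h1

end Specialization

end SimpleRootData

/-! ### One long simple root: the chain of long roots, type C -/

section UniqueLong

variable {V : Type*} [NormedAddCommGroup V] [InnerProductSpace ℝ V] {R Rpos : Set V} {r : V}
  {κ : Type*} [Fintype κ] {v : κ → V} {T : V → ℂ} {ts tl : ℂ} {l : κ}

/-- The Cartan integers of the simple roots `v` are those of type `C`. -/
def HasCartanC (v : κ → V) : Prop :=
  ∃ e : κ ≃ Fin (Fintype.card κ), ∀ i j,
    (CartanMatrix.C (Fintype.card κ) (e i) (e j) : ℝ) = ⟪v i, v j⟫ / nu (v j)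

-- Below each value all smaller natural numbers are attained too, so $f$ has at least $f(i)+1$
-- different values.
omit [Fintype κ] in
lemma lt_card_of_lower {κ : Type*} [Fintype κ] {f : κ → ℕ}
    (hlow : ∀ i p, f i = p + 1 → ∃ j, f j = p) (i : κ) : f i < Fintype.card κ := by
  classical
  have h1 : ∀ p i, f i = p → Finset.range (p + 1) ⊆ Finset.univ.image f := by
    intro p
    induction p with
    | zero =>
      intro i hi x hx
      rw [Finset.mem_range] at hx
      exact Finset.mem_image.2 ⟨i, Finset.mem_univ _, by omega⟩
    | succ p ih =>
      intro i hi x hx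
      rw [Finset.mem_range] at hx
      rcases Nat.lt_or_ge x (p + 1) with h2 | h2
      · obtain ⟨j, hj⟩ := hlow i p hi
        exact ih j hj (Finset.mem_range.2 h2)
      · exact Finset.mem_image.2 ⟨i, Finset.mem_univ _, by omega⟩
  have h2 := Finset.card_le_card (h1 _ i rfl)
  rw [Finset.card_range] at h2
  have h3 := Finset.card_image_le (s := Finset.univ) (f := f)
  rw [Finset.card_univ] at h3
  omega

namespace SimpleData

variable (h : SimpleData R Rpos r v 2) (hl : nu (v l) = 2) (ha : ∀ i, nu (v i) = 2 → i = l)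
include h hl ha

omit hl in
lemma nu_of_ne {i : κ} (hi : i ≠ l) : nu (v i) = 1 :=
  (h.nu_eq _ (h.mem i)).resolve_right fun h1 => hi (ha i (by rw [h1]; norm_num))

/-- A long positive root is the sum of the long simple root and of twice a combination of the
short ones. -/
lemma long_form {α : V} (hα : α ∈ Rpos) (hα2 : nu α = 2) :
    ∃ m : κ → ℕ, m l = 0 ∧ α = v l + 2 • ∑ i, m i • v i := by
  classical
  refine h.descent (p := fun α => nu α = 2 → ∃ m : κ → ℕ, m l = 0 ∧
    α = v l + 2 • ∑ i, m i • v i) (fun i hi => ?_) ?_ hα hα2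
  · exact ⟨0, rfl, by rw [ha i hi]; simp⟩
  intro α hα i c hne hc0 hc hβ ih hα2
  have hc1 : (0 : ℝ) < c := by exact_mod_cast hc0
  obtain ⟨m, hm0, hm⟩ := ih (by rw [nu_reflect hc, hα2])
  -- A descent through the long simple root does not occur: $(\alpha,v_l)$ would be $2$ and at the
  -- same time divisible by $4$.
  by_cases hi : i = l
  · subst hi
    exfalso
    have h1 : ⟪α, v i⟫ = 2 := by
      rcases inner_cases h.root (h.mem_of_pos hα) (h.mem i) (by rw [hα2, hl]) hne
        (h.ne_neg hα (h.mem_pos i)) with h2 | h2 | h2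
      · rw [hc, hl] at h2; linarith
      · rw [h2, hl]
      · rw [hc, hl] at h2; linarith
    have h2 : ∃ a : ℤ, ⟪∑ j, m j • v j, v i⟫ = 2 * a := by
      have h3 : ∀ j, ∃ a : ℤ, ⟪m j • v j, v i⟫ = 2 * a := fun j => by
        by_cases hj : j = i
        · exact ⟨0, by rw [hj, hm0]; simp⟩
        · rw [← Nat.cast_smul_eq_nsmul ℝ, inner_smul_left]
          rcases h.inner_simple hj (by rw [h.nu_of_ne ha hj, hl]; norm_num) with h4 | h4
          · exact ⟨0, by rw [h4]; simp⟩
          · exact ⟨-m j, by rw [h4, hl]; simp; ring⟩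
      choose a ha' using h3
      refine ⟨∑ j, a j, ?_⟩
      rw [sum_inner, Finset.sum_congr rfl fun j _ => ha' j, ← Finset.mul_sum]
      push_cast; rfl
    obtain ⟨a, ha'⟩ := h2
    have h3 : (c : ℝ) = 1 := by rw [hc, hl] at h1; linarith
    rw [h3, one_smul, sub_eq_iff_eq_add] at hm
    rw [hm, inner_add_left, inner_add_left, ← Nat.cast_smul_eq_nsmul ℝ, inner_smul_left, ha',
      inner_self_eq_nu, hl] at h1
    simp at h1
    have h4 : ((4 + 2 * (2 * a) + 4 : ℤ) : ℝ) = (2 : ℤ) := by push_cast; linarith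
    rw [Int.cast_inj] at h4
    omega
  · have hi1 := h.nu_of_ne ha hi
    have h1 : (c : ℝ) = 2 := by
      have := inner_cases h.root (h.mem i) (h.mem_of_pos hα) (by rw [hα2, hi1]; norm_num) hne.symm
        (h.ne_neg (h.mem_pos i) hα)
      rw [real_inner_comm, hc, hi1, hα2] at this
      rcases this with h2 | h2 | h2 <;> linarith
    refine ⟨m + Pi.single i 1, by simp [hm0, Ne.symm hi], ?_⟩
    rw [sub_eq_iff_eq_add] at hm
    have h2 : ∑ j, (m + Pi.single i 1 : κ → ℕ) j • v j = ∑ j, m j • v j + v i := by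
      simp [add_smul, Finset.sum_add_distrib, Pi.single_apply, ite_smul]
    rw [h2, hm, h1, smul_add, ← Nat.cast_smul_eq_nsmul ℝ 2 (v i), add_assoc]
    norm_num

/-- Long positive roots are congruent to $v_l$ modulo twice the root lattice, which makes their
inner products divisible by $4$; but two different ones can only have $0$ or $\pm2$. -/
lemma long_orthogonal {α β : V} (hα : α ∈ Rpos) (hα2 : nu α = 2) (hβ : β ∈ Rpos) (hβ2 : nu β = 2)
    (hne : α ≠ β) : ⟪α, β⟫ = 0 := by
  obtain ⟨m, hm0, hm⟩ := h.long_form hl ha hα hα2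
  have hsm : ∑ i, m i • v i ∈ Submodule.span ℤ (Set.range v) :=
    Submodule.sum_mem _ fun i _ => nsmul_mem (Submodule.subset_span (Set.mem_range_self i)) _
  have hint : ∀ x ∈ Submodule.span ℤ (Set.range v), ∃ a : ℤ, ⟪x, β⟫ = 2 * a := by
    intro x hx
    induction hx using Submodule.span_induction with
    | mem x hx =>
      obtain ⟨i, rfl⟩ := hx
      obtain ⟨a, ha'⟩ := h.root.integral β (h.mem_of_pos hβ) (v i) (h.mem i)
      exact ⟨a, by rw [ha', hβ2]⟩
    | zero => exact ⟨0, by simp⟩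
    | add x y _ _ hx hy =>
      obtain ⟨a, hx⟩ := hx
      obtain ⟨b, hy⟩ := hy
      exact ⟨a + b, by rw [inner_add_left, hx, hy]; push_cast; ring⟩
    | smul c x _ hx =>
      obtain ⟨a, hx⟩ := hx
      refine ⟨c * a, ?_⟩
      rw [← Int.cast_smul_eq_zsmul ℝ, inner_smul_left, hx]
      simp; ring
  have hlβ : ∃ a : ℤ, ⟪v l, β⟫ = 4 * a := by
    obtain ⟨n, hn0, hn⟩ := h.long_form hl ha hβ hβ2
    have h1 : ∀ i, i ≠ l → ∃ a : ℤ, ⟪v l, v i⟫ = 2 * a := fun i hi => by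
      rcases h.inner_simple hi (by rw [h.nu_of_ne ha hi, hl]; norm_num) with h4 | h4
      · exact ⟨0, by rw [real_inner_comm, h4]; simp⟩
      · exact ⟨-1, by rw [real_inner_comm, h4, hl]; simp⟩
    have h2 : ∀ i, ∃ a : ℤ, ⟪v l, n i • v i⟫ = 2 * a := fun i => by
      by_cases hi : i = l
      · exact ⟨0, by rw [hi, hn0]; simp⟩
      · obtain ⟨a, ha'⟩ := h1 i hi
        exact ⟨n i * a, by rw [← Nat.cast_smul_eq_nsmul ℝ, inner_smul_right, ha']; push_cast; ring⟩
    choose a ha' using h2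
    refine ⟨1 + ∑ i, a i, ?_⟩
    rw [hn, inner_add_right, ← Nat.cast_smul_eq_nsmul ℝ 2, inner_smul_right, inner_sum,
      Finset.sum_congr rfl fun i _ => ha' i, ← Finset.mul_sum, inner_self_eq_nu, hl]
    push_cast; ring
  obtain ⟨a, ha1⟩ := hint _ hsm
  obtain ⟨b, hb⟩ := hlβ
  have h1 : ⟪α, β⟫ = ((4 * (a + b) : ℤ) : ℝ) := by
    rw [hm, inner_add_left, hb, ← Nat.cast_smul_eq_nsmul ℝ 2, inner_smul_left, ha1]
    simp; ring
  rcases inner_cases h.root (h.mem_of_pos hα) (h.mem_of_pos hβ) (by rw [hα2, hβ2]) hne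
    (h.ne_neg hα hβ) with h2 | h2 | h2
  · exact h2
  · rw [h1, hβ2] at h2
    have : 4 * (a + b) = 2 := by exact_mod_cast h2
    omega
  · rw [h1, hβ2] at h2
    have : 4 * (a + b) = -2 := by exact_mod_cast h2
    omega

omit hl ha in
/-- Reflection of a long root in a short simple root. -/
lemma long_add {α : V} (hα : α ∈ Rpos) (hα2 : nu α = 2) {i : κ} (hi : nu (v i) = 1) {c : ℤ}
    (hc : ⟪α, v i⟫ = -c) : α + (c : ℝ) • v i ∈ Rpos ∧ nu (α + (c : ℝ) • v i) = 2 := by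
  have h1 : ⟪α, v i⟫ = ((-c : ℤ) : ℝ) * nu (v i) := by rw [hc, hi]; push_cast; ring
  have h2 : α + (c : ℝ) • v i = α - ((-c : ℤ) : ℝ) • v i := by
    push_cast; rw [neg_smul, sub_neg_eq_add]
  have hne : α ≠ v i := fun h3 => by rw [h3, hi] at hα2; norm_num at hα2
  rw [h2]
  exact ⟨h.reflect_mem_pos hα hne h1, by rw [nu_reflect h1, hα2]⟩

omit hl in
lemma exists_long_sub {α : V} (hα : α ∈ Rpos) (hα2 : nu α = 2) (hne : α ≠ v l)
    (horth : ⟪α, v l⟫ = 0) : ∃ i, i ≠ l ∧ ⟪α, v i⟫ = 2 := by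
  obtain ⟨i, hi⟩ := h.exists_inner_pos hα
  have hil : i ≠ l := by rintro rfl; linarith
  refine ⟨i, hil, ?_⟩
  have hi1 := h.nu_of_ne ha hil
  have := inner_cases h.root (h.mem i) (h.mem_of_pos hα) (by rw [hα2, hi1]; norm_num)
    (fun h1 => by rw [← h1, hi1] at hα2; norm_num at hα2) (h.ne_neg (h.mem_pos i) hα)
  rw [real_inner_comm, hα2] at this
  rcases this with h2 | h2 | h2 <;> linarith

/-- Different simple roots lead from a long root to orthogonal long roots. -/
lemma eq_of_inner_eq {α : V} (hα : α ∈ Rpos) (hα2 : nu α = 2) {i j : κ} (hi : i ≠ l) (hj : j ≠ l)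
    {c : ℤ} (hc : c = 2 ∨ c = -2) (h1 : ⟪α, v i⟫ = -c) (h2 : ⟪α, v j⟫ = -c) : i = j := by
  by_contra hij
  obtain ⟨h3, h4⟩ := h.long_add hα hα2 (h.nu_of_ne ha hi) h1
  obtain ⟨h5, h6⟩ := h.long_add hα hα2 (h.nu_of_ne ha hj) h2
  have hc0 : (c : ℝ) ≠ 0 := by rcases hc with rfl | rfl <;> norm_num
  have hne : α + (c : ℝ) • v i ≠ α + (c : ℝ) • v j := fun h7 =>
    hij (h.injective (smul_right_injective V hc0 (add_left_cancel h7)))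
  have h7 := h.long_orthogonal hl ha h3 h4 h5 h6 hne
  rw [inner_add_left, inner_add_right, inner_add_right, inner_smul_left, inner_smul_right,
    inner_smul_left, inner_smul_right, inner_self_eq_nu, hα2, h2, real_inner_comm, h1] at h7
  have h8 := h.inner_simple_nonpos hij
  simp only [conj_trivial] at h7
  rcases hc with rfl | rfl <;> push_cast at h7 <;> linarith

lemma long_height {α : V} (hα : α ∈ Rpos) (hα2 : nu α = 2) :
    ∃ p : ℕ, ⟪r, α⟫ = 1 + 2 * p ∧ (p = 0 → α = v l) ∧
      ∃ m : κ → ℕ, m l = 0 ∧ α = v l + 2 • ∑ i, m i • v i ∧ p = ∑ i, m i := by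
  obtain ⟨m, hm0, hm⟩ := h.long_form hl ha hα hα2
  refine ⟨∑ i, m i, ?_, fun h0 => ?_, m, hm0, hm, rfl⟩
  · rw [hm, inner_add_right, h.height, ← Nat.cast_smul_eq_nsmul ℝ 2, inner_smul_right,
      h.inner_sum_nat]
    push_cast; ring
  · rw [hm, Finset.sum_eq_zero fun i _ => by
      rw [(Finset.sum_eq_zero_iff.1 h0) i (Finset.mem_univ i), zero_smul]]
    simp

/-- The predecessor of a long root. -/
lemma exists_pred {α : V} (hα : α ∈ Rpos) (hα2 : nu α = 2) (hne : α ≠ v l) :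
    ∃ i, i ≠ l ∧ ⟪α, v i⟫ = 2 ∧ α - (2 : ℝ) • v i ∈ Rpos ∧ nu (α - (2 : ℝ) • v i) = 2 ∧
      ⟪α - (2 : ℝ) • v i, v i⟫ = -2 := by
  obtain ⟨i, hi, h1⟩ := h.exists_long_sub ha hα hα2 hne
    (h.long_orthogonal hl ha hα hα2 (h.mem_pos l) hl hne)
  obtain ⟨h2, h3⟩ := h.long_add (c := -2) hα hα2 (h.nu_of_ne ha hi) (by rw [h1]; norm_num)
  have h4 : α + ((-2 : ℤ) : ℝ) • v i = α - (2 : ℝ) • v i := by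
    push_cast; rw [neg_smul, sub_eq_add_neg]
  rw [h4] at h2 h3
  refine ⟨i, hi, h1, h2, h3, ?_⟩
  rw [inner_sub_left, inner_smul_left, h1, inner_self_eq_nu, h.nu_of_ne ha hi]
  norm_num

/-- The predecessors have equal heights and coincide by induction, and by `eq_of_inner_eq` only one
short simple root leads upwards from a given long root. So the long positive roots form a chain. -/
lemma long_height_injective {α β : V} (hα : α ∈ Rpos) (hα2 : nu α = 2) (hβ : β ∈ Rpos)
    (hβ2 : nu β = 2) (heq : ⟪r, α⟫ = ⟪r, β⟫) : α = β := by
  obtain ⟨p, hp, hp0, -⟩ := h.long_height hl ha hα hα2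
  induction p generalizing α β with
  | zero =>
    obtain ⟨p', hp', hp0', -⟩ := h.long_height hl ha hβ hβ2
    rw [hp0 rfl, hp0' (by
      rw [← heq, hp] at hp'
      have : (p' : ℝ) = 0 := by push_cast at hp'; linarith
      exact_mod_cast this)]
  | succ p ih =>
    have hne : ∀ γ : V, ⟪r, γ⟫ = 1 + 2 * ((p + 1 : ℕ) : ℝ) → γ ≠ v l := fun γ hγ h1 => by
      rw [h1, h.height] at hγ
      push_cast at hγ
      have : (0 : ℝ) ≤ p := Nat.cast_nonneg _
      linarith
    obtain ⟨i, hi, -, h2, h3, h4⟩ := h.exists_pred hl ha hα hα2 (hne α hp)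
    obtain ⟨j, hj, -, h6, h7, h8⟩ := h.exists_pred hl ha hβ hβ2 (hne β (heq ▸ hp))
    have h9 : ⟪r, α - (2 : ℝ) • v i⟫ = 1 + 2 * p := by
      rw [inner_sub_right, inner_smul_right, h.height, hp]; push_cast; ring
    have h10 : ⟪r, α - (2 : ℝ) • v i⟫ = ⟪r, β - (2 : ℝ) • v j⟫ := by
      rw [h9, inner_sub_right, inner_smul_right, h.height, ← heq, hp]; push_cast; ring
    have h11 : α - (2 : ℝ) • v i = β - (2 : ℝ) • v j := by
      refine ih h2 h3 h6 h7 h10 h9 fun h0 => ?_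
      obtain ⟨p', hp', hp0', -⟩ := h.long_height hl ha h2 h3
      refine hp0' ?_
      rw [h9, h0] at hp'
      have : (p' : ℝ) = 0 := by push_cast at hp'; linarith
      exact_mod_cast this
    have h12 : i = j := h.eq_of_inner_eq hl ha h2 h3 hi hj (c := 2) (Or.inl rfl)
      (by rw [h4]; norm_num) (by rw [h11, h8]; norm_num)
    rw [h12] at h11
    exact sub_left_injective h11

/-- Half of the difference of a long positive root and the long simple root is a root. -/
lemma exists_half {α : V} (hα : α ∈ Rpos) (hα2 : nu α = 2) (hne : α ≠ v l) :
    ∃ σ ∈ R, α = v l + (2 : ℝ) • σ := by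
  obtain ⟨p, hp, -, -⟩ := h.long_height hl ha hα hα2
  induction p generalizing α with
  | zero =>
    refine absurd (h.long_height_injective hl ha hα hα2 (h.mem_pos l) hl ?_) hne
    rw [hp, h.height]; simp
  | succ p ih =>
    obtain ⟨i, hi, h1, h2, h3, h4⟩ := h.exists_pred hl ha hα hα2 hne
    by_cases hl' : α - (2 : ℝ) • v i = v l
    · exact ⟨v i, h.mem i, by rw [← hl']; abel⟩
    obtain ⟨σ, hσ, h5⟩ := ih h2 h3 hl' (by
      rw [inner_sub_right, inner_smul_right, h.height, hp]; push_cast; ring)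
    -- Both $\alpha$ and its predecessor are orthogonal to $v_l$, hence so is $v_i$. Then
    -- $(\sigma,v_i)=-1$, and reflecting $\sigma$ adds $v_i$.
    have h6 : ⟪v l, v i⟫ = 0 := by
      have h7 := h.long_orthogonal hl ha h2 h3 (h.mem_pos l) hl hl'
      have h8 := h.long_orthogonal hl ha hα hα2 (h.mem_pos l) hl hne
      rw [inner_sub_left, inner_smul_left, h8, real_inner_comm] at h7
      simpa using h7
    have h7 : ⟪σ, v i⟫ = -1 := by
      rw [h5, inner_add_left, h6, inner_smul_left] at h4
      simp only [conj_trivial] at h4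
      linarith
    have hi1 := h.nu_of_ne ha hi
    have h8 : σ - (-1 : ℝ) • v i ∈ R :=
      reflect_of_inner_eq h.root (h.mem i) hσ (by rw [h7, hi1]; norm_num)
    refine ⟨_, h8, ?_⟩
    rw [neg_one_smul, sub_neg_eq_add, smul_add, ← add_assoc, ← h5]
    abel

/-- The long roots are indexed by the simple roots. -/
lemma exists_long_index : ∃ μ : κ → V, (∀ i, μ i ∈ Rpos ∧ nu (μ i) = 2) ∧ μ l = v l ∧
    ∀ i, i ≠ l → ⟪μ i, v i⟫ = 2 := by
  have key : ∀ j, ∃ β ∈ Rpos, nu β = 2 ∧ (j = l → β = v l) ∧ (j ≠ l → ⟪β, v j⟫ = 2) := by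
    intro j
    refine h.connected (fun j => ∃ β ∈ Rpos, nu β = 2 ∧ (j = l → β = v l) ∧
      (j ≠ l → ⟪β, v j⟫ = 2)) l j ⟨v l, h.mem_pos l, hl, fun _ => rfl, fun h => absurd rfl h⟩ ?_
    rintro i j ⟨β, hβ, hβ2, h1, h2⟩ hij
    by_cases hj : j = l
    · exact ⟨v l, h.mem_pos l, hl, fun _ => rfl, fun h => absurd hj h⟩
    have hj1 := h.nu_of_ne ha hj
    -- Nonorthogonality is enough: the inner product is then $\pm2$, and the reflection in $v_j$
    -- changes its sign.
    suffices ∃ γ ∈ Rpos, nu γ = 2 ∧ ⟪γ, v j⟫ ≠ 0 by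
      obtain ⟨γ, hγ, hγ2, hne⟩ := this
      have := inner_cases h.root (h.mem j) (h.mem_of_pos hγ) (by rw [hγ2, hj1]; norm_num)
        (fun h3 => by rw [← h3, hj1] at hγ2; norm_num at hγ2) (h.ne_neg (h.mem_pos j) hγ)
      rw [real_inner_comm, hγ2] at this
      rcases this with h3 | h3 | h3
      · exact absurd h3 hne
      · exact ⟨γ, hγ, hγ2, fun h4 => absurd h4 hj, fun _ => h3⟩
      · obtain ⟨h4, h5⟩ := h.long_add (c := 2) hγ hγ2 hj1 (by rw [h3]; norm_num)
        refine ⟨_, h4, h5, fun h6 => absurd h6 hj, fun _ => ?_⟩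
        rw [inner_add_left, inner_smul_left, h3, inner_self_eq_nu, hj1]
        norm_num
    by_cases hi : i = l
    · exact ⟨v l, h.mem_pos l, hl, hi ▸ hij⟩
    by_cases h3 : ⟪β, v j⟫ = 0
    -- Reflecting $\beta$ in $v_i$ first destroys the orthogonality to $v_j$, because $v_i$ and
    -- $v_j$ are adjacent.
    · obtain ⟨h4, h5⟩ := h.long_add (c := -2) hβ hβ2 (h.nu_of_ne ha hi) (by rw [h2 hi]; norm_num)
      refine ⟨_, h4, h5, ?_⟩
      rw [inner_add_left, h3, inner_smul_left, zero_add]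
      exact mul_ne_zero (by norm_num) hij
    · exact ⟨β, hβ, hβ2, h3⟩
  choose μ hμ hμ2 h1 h2 using key
  exact ⟨μ, fun i => ⟨hμ i, hμ2 i⟩, h1 l rfl, h2⟩

/-- The long positive roots are enumerated by the simple roots; consecutive ones differ by twice a
short simple root. -/
lemma exists_long_enumeration : ∃ (μ : κ → V) (p : κ → ℕ), Function.Injective p ∧ p l = 0 ∧
    μ l = v l ∧ (∀ i, p i < Fintype.card κ) ∧ (∀ i, nu (μ i) = 2) ∧
    (∀ i j, i ≠ j → ⟪μ i, μ j⟫ = 0) ∧ (∀ i, i ≠ l → ∃ j, p i = p j + 1 ∧ μ i = μ j + (2 : ℝ) • v i) ∧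
    ∀ α ∈ Rpos, nu α = 2 → ∃ i, α = μ i ∧ ⟪r, α⟫ = 1 + 2 * p i := by
  obtain ⟨μ, hμ, hμl, hμi⟩ := h.exists_long_index hl ha
  have hinj : ∀ i j, i ≠ j → μ i ≠ μ j := by
    have h0 : ∀ j, j ≠ l → μ l ≠ μ j := fun j hj h1 => by
      have h2 := hμi j hj
      rw [← h1, hμl] at h2
      have := h.inner_simple_nonpos hj.symm
      linarith
    intro i j hij h1
    by_cases hi : i = l
    · exact h0 j (fun hj => hij (hi.trans hj.symm)) (hi ▸ h1)
    by_cases hj : j = l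
    · exact h0 i hi (hj ▸ h1.symm)
    exact hij (h.eq_of_inner_eq hl ha (hμ i).1 (hμ i).2 hi hj (c := -2) (Or.inr rfl)
      (by rw [hμi i hi]; norm_num) (by rw [h1, hμi j hj]; norm_num))
  have hsurj : ∀ α ∈ Rpos, nu α = 2 → ∃ i, α = μ i := by
    intro α hα hα2
    by_cases hne : α = v l
    · exact ⟨l, by rw [hne, hμl]⟩
    obtain ⟨i, hi, h1, h2, h3, h4⟩ := h.exists_pred hl ha hα hα2 hne
    refine ⟨i, ?_⟩
    -- Otherwise $\alpha$ and its predecessor are both orthogonal to $\mu_i$, and then so is $v_i$,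
    -- against $(\mu_i,v_i)=2$.
    by_contra h5
    have h6 := h.long_orthogonal hl ha hα hα2 (hμ i).1 (hμ i).2 h5
    have h7 := h.long_orthogonal hl ha h2 h3 (hμ i).1 (hμ i).2 fun h7 => by
      rw [h7, hμi i hi] at h4
      norm_num at h4
    rw [inner_sub_left, h6, inner_smul_left, real_inner_comm, hμi i hi] at h7
    norm_num at h7
  choose p hp _ _ using fun i => h.long_height hl ha (hμ i).1 (hμ i).2
  have hpinj : Function.Injective p := fun i j hij => by
    by_contra hne
    refine hinj i j hne (h.long_height_injective hl ha (hμ i).1 (hμ i).2 (hμ j).1 (hμ j).2 ?_)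
    rw [hp, hp, hij]
  have hpl : p l = 0 := by
    have := hp l
    rw [hμl, h.height] at this
    have h1 : (p l : ℝ) = 0 := by linarith
    exact_mod_cast h1
  have hpred : ∀ i, i ≠ l → ∃ j, p i = p j + 1 ∧ μ i = μ j + (2 : ℝ) • v i := by
    intro i hi
    obtain ⟨h2, h3⟩ := h.long_add (c := -2) (hμ i).1 (hμ i).2 (h.nu_of_ne ha hi)
      (by rw [hμi i hi]; norm_num)
    obtain ⟨j, hj⟩ := hsurj _ h2 h3
    have h4 : μ i = μ j + (2 : ℝ) • v i := by
      rw [← hj]; push_cast; rw [neg_smul, neg_add_cancel_right]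
    refine ⟨j, ?_, h4⟩
    have h5 := hp i
    rw [h4, inner_add_right, hp, inner_smul_right, h.height] at h5
    have h6 : (p i : ℝ) = p j + 1 := by linarith
    exact_mod_cast h6
  refine ⟨μ, p, hpinj, hpl, hμl, fun i => lt_card_of_lower (fun i x hx => ?_) i,
    fun i => (hμ i).2, fun i j hij =>
    h.long_orthogonal hl ha (hμ i).1 (hμ i).2 (hμ j).1 (hμ j).2 (hinj i j hij), hpred, ?_⟩
  · obtain ⟨j, hj, -⟩ := hpred i (by rintro rfl; omega)
    exact ⟨j, by omega⟩
  · intro α hα hα2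
    obtain ⟨i, rfl⟩ := hsurj α hα hα2
    exact ⟨i, rfl, hp i⟩

/-- The orthogonal vectors $\mu_i$ serve as the $2\varepsilon_i$ of the standard realization: short
simple roots are halves of differences of consecutive ones. Counting $p$ backwards puts the long
simple root at the last index. -/
lemma hasCartanC : HasCartanC v := by
  classical
  obtain ⟨μ, p, hinj, hpl, hμl, hlt, hμ2, horth, hpred, -⟩ := h.exists_long_enumeration hl ha
  have hinner : ∀ i j, ⟪μ i, μ j⟫ = if p i = p j then (4 : ℝ) else 0 := fun i j => by
    by_cases hij : i = j
    · rw [if_pos (by rw [hij]), hij, inner_self_eq_nu, hμ2]; norm_num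
    · rw [if_neg (fun h1 => hij (hinj h1)), horth i j hij]
  let f : κ → Fin (Fintype.card κ) := fun i => ⟨Fintype.card κ - 1 - p i, by have := hlt i; omega⟩
  have hf : Function.Bijective f := by
    rw [Fintype.bijective_iff_injective_and_card]
    refine ⟨fun i j hij => hinj ?_, by simp⟩
    have h1 := congrArg Fin.val hij
    have h2 := hlt i
    have h3 := hlt j
    simp only [f] at h1
    omega
  have hp0 : ∀ i, i ≠ l → p i ≠ 0 := fun i hi h0 => hi (hinj (by rw [h0, hpl]))
  have hhalf : ∀ i j, p i = p j + 1 → μ i = μ j + (2 : ℝ) • v i → v i = (2⁻¹ : ℝ) • (μ i - μ j) := by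
    intro i j _ h2
    rw [h2, add_sub_cancel_left, smul_smul]
    norm_num
  refine ⟨Equiv.ofBijective f hf, fun i j => ?_⟩
  have hi := hlt i
  have hj := hlt j
  simp only [Equiv.ofBijective_apply, f, CartanMatrix.C, Matrix.of_apply, Fin.mk.injEq]
  by_cases hil : i = l
  · by_cases hjl : j = l
    · rw [hil, hjl, if_pos rfl, inner_self_eq_nu, hl]; norm_num
    · obtain ⟨j', hj', hj2⟩ := hpred j hjl
      have hj0 := hp0 j hjl
      rw [hil, ← hμl, hhalf j j' hj' hj2, ← hhalf j j' hj' hj2, h.nu_of_ne ha hjl,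
        hhalf j j' hj' hj2, inner_smul_right, inner_sub_right, hinner, hinner]
      split_ifs <;> first | omega | norm_num
  · obtain ⟨i', hi', hi2⟩ := hpred i hil
    have hi0 := hp0 i hil
    by_cases hjl : j = l
    · rw [hjl, hl, ← hμl, hhalf i i' hi' hi2, inner_smul_left, inner_sub_left, hinner, hinner]
      split_ifs <;> first | omega | norm_num
    · obtain ⟨j', hj', hj2⟩ := hpred j hjl
      have hj0 := hp0 j hjl
      rw [h.nu_of_ne ha hjl, hhalf i i' hi' hi2, hhalf j j' hj' hj2, inner_smul_right,
        inner_smul_left, inner_sub_right, inner_sub_left, inner_sub_left, hinner, hinner, hinner,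
        hinner]
      split_ifs <;> first | omega | norm_num

end SimpleData

namespace Specialization

variable (hT : Specialization R v 2 T ts tl) (h : SimpleData R Rpos r v 2) (hl : nu (v l) = 2)
  (ha : ∀ i, nu (v i) = 2 → i = l)
include hT h hl ha

/-- The system has one long simple root: long roots. -/
lemma long_of_unique_long (hC : HasCartanC v → ∀ j, 1 ≤ j → j < Fintype.card κ → ts ^ j ≠ -1)
    {α : V} (hα : α ∈ Rpos) (hα2 : nu α = 2) (hns : ∀ i, α ≠ v i) : T α ≠ tl := by
  intro hTα
  obtain ⟨_, p, -, -, -, hlt, -, -, -, hsurj⟩ := h.exists_long_enumeration hl ha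
  obtain ⟨i, -, hi⟩ := hsurj α hα hα2
  obtain ⟨a, h1, h2, m, hm0, hm, ham⟩ := h.long_height hl ha hα hα2
  have hai : a = p i := by
    rw [h1] at hi
    have : (a : ℝ) = p i := by linarith
    exact_mod_cast this
  obtain ⟨σ, hσ, hσα⟩ := h.exists_half hl ha hα hα2 (hns l)
  have hσm : σ = ∑ i, m i • v i := by
    rw [hm, add_left_cancel_iff, ← Nat.cast_smul_eq_nsmul ℝ] at hσα
    exact (smul_right_injective V (two_ne_zero (α := ℝ)) (by simpa using hσα)).symm
  have hTσ : T σ = ts ^ a := by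
    have h3 : ∀ s : Finset κ, T (∑ i ∈ s, m i • v i) = ts ^ ∑ i ∈ s, m i := by
      classical
      intro s
      induction s using Finset.induction_on with
      | empty => simp [hT.map_zero]
      | insert j s hj ih =>
        rw [Finset.sum_insert hj, Finset.sum_insert hj, hT.map_add, hT.map_nsmul, ih, pow_add]
        by_cases hjl : j = l
        · rw [hjl, hm0]; simp
        · rw [hT.short j (h.nu_of_ne ha hjl)]
    rw [hσm, h3, ham]
  have hTl : T (v l) = tl := hT.long l (by rw [hl]; norm_num)
  -- With the root $\sigma=(\alpha-v_l)/2$, the assumption gives $T(\sigma)^2=1$, so $T(\sigma)=-1$.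
  -- But $T(\sigma)$ is the power of $t_{sht}$ with exponent the height of $\sigma$, which is less
  -- than $n$.
  have h4 : T α = tl * T σ ^ 2 := by
    rw [hm, ← hσm, hT.map_add, hT.map_nsmul, hTl]
  rw [hTα] at h4
  have h5 : T σ ^ 2 = 1 := (mul_eq_left₀ (hTl ▸ hT.ne_zero _)).1 h4.symm
  have h6 : T σ = -1 := (sq_eq_one_iff.1 h5).resolve_left (hT.ne_one σ hσ)
  refine hC (h.hasCartanC hl ha) a ?_ (hai ▸ hlt i) (hTσ ▸ h6)
  by_contra h7
  exact hns l (h2 (by omega))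

/-- The system has one long simple root: short roots. -/
lemma short_of_unique_long {α : V} (hα : α ∈ Rpos) (hα1 : nu α = 1) (hns : ∀ i, α ≠ v i) :
    T α ≠ ts := by
  intro hTα
  have hopp : ∀ i, i ≠ l → ⟪α, v i⟫ ≤ 0 := fun i hi =>
    hT.inner_nonpos_of_eq h hα hns (by rw [hTα, hT.short i (h.nu_of_ne ha hi)])
  obtain ⟨i, hi⟩ := h.exists_inner_pos hα
  have hil : i = l := by
    by_contra h1
    exact absurd hi (not_lt.2 (hopp i h1))
  subst hil
  have hin : ⟪α, v i⟫ = 2 := by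
    have := inner_cases h.root (h.mem_of_pos hα) (h.mem i) (by rw [hl, hα1]; norm_num)
      (hns i) (h.ne_neg hα (h.mem_pos i))
    rw [hl] at this
    rcases this with h1 | h1 | h1 <;> linarith
  have hc : ⟪α, v i⟫ = ((1 : ℤ) : ℝ) * nu (v i) := by rw [hin, hl]; norm_num
  have hβ := h.reflect_mem_pos hα (hns i) hc
  have hβ1 := nu_reflect hc
  rw [Int.cast_one, one_smul] at hβ hβ1
  rw [hα1] at hβ1
  have hβi : ∀ j, ⟪α - v i, v j⟫ = ⟪α, v j⟫ - ⟪v i, v j⟫ := fun j => inner_sub_left _ _ _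
  by_cases hβs : ∃ j, α - v i = v j
  · obtain ⟨j, hj⟩ := hβs
    refine hT.ne_one _ (h.mem i) ?_
    have h1 : T α = T (v j) * T (v i) := by rw [← hj, ← hT.map_add, sub_add_cancel]
    rw [hTα, hT.short j (by rw [← hj, hβ1])] at h1
    exact (mul_eq_left₀ (hTα ▸ hT.ne_zero α)).1 h1.symm
  push Not at hβs
  -- The vector $\alpha-v_l/2$ is obtuse to all simple roots, while its inner product with the
  -- positive root $\alpha-v_l$ is $1$.
  have hx : ∀ j, ⟪α - v i + (2⁻¹ : ℝ) • v i, v j⟫ ≤ 0 := by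
    intro j
    rw [inner_add_left, hβi, inner_smul_left]
    by_cases hj : j = i
    · rw [hj, hin, inner_self_eq_nu, hl]; norm_num
    · have hj1 := h.nu_of_ne ha hj
      have h3 := hopp j hj
      have h4 := h.inner_simple hj (by rw [hj1, hl]; norm_num)
      rw [real_inner_comm, hl] at h4
      have h5 := inner_cases h.root (h.mem_of_pos hβ) (h.mem j) (by rw [hβ1, hj1]) (hβs j)
        (h.ne_neg hβ (h.mem_pos j))
      rw [hβi, hj1] at h5
      simp only [conj_trivial]
      rcases h4 with h4 | h4 <;> rw [h4] at h5 ⊢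
      · linarith
      · rcases h5 with h5 | h5 | h5 <;> linarith
  have h1 := h.inner_nonpos hx hβ
  rw [inner_add_left, inner_self_eq_nu, hβ1, inner_smul_left, inner_sub_right, real_inner_comm, hin,
    inner_self_eq_nu, hl] at h1
  norm_num at h1

end Specialization


end UniqueLong

/-! ### Two root lengths: adjacent simple roots and type G₂ -/

section TwoLengths

variable {V : Type*} [NormedAddCommGroup V] [InnerProductSpace ℝ V] {R Rpos : Set V} {r : V}
  {κ : Type*} [Fintype κ] {v : κ → V} {νlng : ℕ} {T : V → ℂ} {ts tl : ℂ}

namespace SimpleData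

variable (h : SimpleData R Rpos r v νlng)
include h

/-- Positive definiteness of the inner product at combinations of five simple roots. -/
lemma inner_self_pos₅ (i₁ i₂ i₃ i₄ i₅ : κ) {a₁ a₂ a₃ a₄ a₅ : ℝ} (h₁ : 0 < a₁) (h₂ : 0 ≤ a₂)
    (h₃ : 0 ≤ a₃) (h₄ : 0 ≤ a₄) (h₅ : 0 ≤ a₅) :
    0 < a₁ ^ 2 * nu (v i₁) + a₂ ^ 2 * nu (v i₂) + a₃ ^ 2 * nu (v i₃) + a₄ ^ 2 * nu (v i₄) +
      a₅ ^ 2 * nu (v i₅) + a₁ * a₂ * ⟪v i₁, v i₂⟫ + a₁ * a₃ * ⟪v i₁, v i₃⟫ +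
      a₁ * a₄ * ⟪v i₁, v i₄⟫ + a₁ * a₅ * ⟪v i₁, v i₅⟫ + a₂ * a₃ * ⟪v i₂, v i₃⟫ +
      a₂ * a₄ * ⟪v i₂, v i₄⟫ + a₂ * a₅ * ⟪v i₂, v i₅⟫ + a₃ * a₄ * ⟪v i₃, v i₄⟫ +
      a₃ * a₅ * ⟪v i₃, v i₅⟫ + a₄ * a₅ * ⟪v i₄, v i₅⟫ := by
  have h1 := inner_self_pos_of_inner_pos (r := r)
    (w := a₁ • v i₁ + a₂ • v i₂ + a₃ • v i₃ + a₄ • v i₄ + a₅ • v i₅) (by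
      simp only [inner_add_right, inner_smul_right, h.height]
      linarith)
  simp only [inner_add_left, inner_add_right, inner_smul_left, inner_smul_right, conj_trivial,
    inner_self_eq_nu, real_inner_comm (v i₁), real_inner_comm (v i₂) (v i₃),
    real_inner_comm (v i₂) (v i₄), real_inner_comm (v i₂) (v i₅), real_inner_comm (v i₃) (v i₄),
    real_inner_comm (v i₃) (v i₅), real_inner_comm (v i₄) (v i₅)] at h1
  linarith

lemma exists_edge {i j : κ} (hij : nu (v i) ≠ nu (v j)) : ∃ i' j', nu (v i') = nu (v i) ∧
    nu (v j') ≠ nu (v i) ∧ ⟪v i', v j'⟫ ≠ 0 := by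
  by_contra! hcon
  exact hij (h.connected (fun x => nu (v x) = nu (v i)) i j rfl fun x y hx hxy => by
    by_contra h1
    exact hxy (hcon x y hx h1)).symm

omit [Fintype κ] h in
lemma ne_of_nu_ne {i j : κ} (hij : nu (v i) ≠ nu (v j)) : i ≠ j := fun h => hij (by rw [h])

lemma exists_long_short {i j : κ} (hi : nu (v i) = νlng) (hj : nu (v j) = 1)
    (hν : (νlng : ℝ) ≠ 1) : ∃ i' j', nu (v i') = νlng ∧ nu (v j') = 1 ∧ ⟪v i', v j'⟫ = -νlng := by
  obtain ⟨i', j', hi', hj', h1⟩ := h.exists_edge (i := i) (j := j) (by rw [hi, hj]; exact hν)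
  rw [hi] at hi' hj'
  have hj'' := (h.nu_eq _ (h.mem j')).resolve_right hj'
  refine ⟨i', j', hi', hj'', ?_⟩
  have := h.inner_simple (i := j') (j := i') (ne_of_nu_ne (by rw [hi', hj'']; exact hν.symm))
    (by rw [hi', hj'']; exact h.one_le_nulng)
  rw [real_inner_comm, hi'] at this
  exact this.resolve_left h1

lemma inner_eq_neg_nu {i j : κ} (hij : i ≠ j) (hle : nu (v i) ≤ nu (v j)) (hne : ⟪v i, v j⟫ ≠ 0) :
    ⟪v i, v j⟫ = -nu (v j) := (h.inner_simple hij hle).resolve_left hne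

end SimpleData

namespace Specialization

variable (hT : Specialization R v νlng T ts tl) (h : SimpleData R Rpos r v νlng)
include hT h

/-- Equal values of $T$ make the root obtuse to the simple roots of its own length; since it is
acute to some simple root, that one has the other length. -/
lemma exists_inner_pos_nu_ne {α : V} (hα : α ∈ Rpos) (hns : ∀ i, α ≠ v i)
    (hs : nu α = 1 → T α = ts) (hl : nu α = νlng → T α = tl) :
    (∃ i, 0 < ⟪α, v i⟫ ∧ nu (v i) ≠ nu α) ∧ ∀ i, nu (v i) = nu α → ⟪α, v i⟫ ≤ 0 := by
  have h1 : ∀ i, nu (v i) = nu α → ⟪α, v i⟫ ≤ 0 := fun i hi => by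
    refine hT.inner_nonpos_of_eq h hα hns ?_
    rcases h.nu_eq α (h.mem_of_pos hα) with h1 | h1
    · rw [hs h1, hT.short i (by rw [hi, h1])]
    · rw [hl h1, hT.long i (by rw [hi, h1])]
  obtain ⟨i, hi⟩ := h.exists_inner_pos hα
  exact ⟨⟨i, hi, fun h2 => absurd hi (not_lt.2 (h1 i h2))⟩, h1⟩

end Specialization

/-! ### Type `G₂` -/

/-- A third simple root adjacent to the triple edge would produce a positive combination of simple
roots with nonpositive squared norm; each case below lists the coefficients. -/
lemma SimpleData.exists_equiv_of_three (h : SimpleData R Rpos r v 3) {i j : κ} (hi : nu (v i) = 3)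
    (hj : nu (v j) = 1) : ∃ f : Fin 2 ≃ κ, ∀ i j, ⟪v (f i), v (f j)⟫ =
      (!![6, -3; -3, 2] : Matrix (Fin 2) (Fin 2) ℝ) i j := by
  obtain ⟨l, s, hl, hs, hls⟩ := h.exists_long_short (i := i) (j := j) (by rw [hi]; norm_num) hj
    (by norm_num)
  norm_num at hl hls
  have hne : l ≠ s := ne_of_nu_ne (by rw [hl, hs]; norm_num)
  have hν : ∀ x, nu (v x) = 1 ∨ nu (v x) = 3 := fun x => by simpa using h.nu_eq _ (h.mem x)
  have hall : ∀ x, x = l ∨ x = s := by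
    intro x
    refine h.connected (fun x => x = l ∨ x = s) l x (Or.inl rfl) ?_
    rintro y x hy hxy
    by_contra! hx
    have h1 := h.inner_simple_nonpos hx.1
    have h2 := h.inner_simple_nonpos hx.2
    rw [real_inner_comm] at hxy
    rcases hy with rfl | rfl <;> rcases hν x with h3 | h3
    · have h4 := h.inner_eq_neg_nu hx.1 (by rw [h3, hl]; norm_num) hxy
      have := h.inner_self_pos₅ x s y x x (a₁ := 1) (a₂ := 1) (a₃ := 1) (a₄ := 0) (a₅ := 0)
        one_pos zero_le_one zero_le_one le_rfl le_rfl
      simp only [h3, hl, hs, h4, real_inner_comm (v y) (v s), hls] at this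
      linarith
    · have h4 := h.inner_eq_neg_nu hx.1 (by rw [h3, hl]) hxy
      have := h.inner_self_pos₅ x y s x x (a₁ := 1) (a₂ := 2) (a₃ := 3) (a₄ := 0) (a₅ := 0)
        one_pos zero_le_two zero_le_three le_rfl le_rfl
      simp only [h3, hl, hs, h4, hls] at this
      linarith
    · have h4 := h.inner_eq_neg_nu hx.2 (by rw [h3, hs]) hxy
      have := h.inner_self_pos₅ x l y x x (a₁ := 1) (a₂ := 1) (a₃ := 2) (a₄ := 0) (a₅ := 0)
        one_pos zero_le_one zero_le_two le_rfl le_rfl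
      simp only [h3, hl, hs, h4, hls] at this
      linarith
    · have h4 := h.inner_eq_neg_nu hx.2.symm (by rw [h3, hs]; norm_num)
        (by rwa [real_inner_comm])
      rw [real_inner_comm] at h4
      have := h.inner_self_pos₅ x l y x x (a₁ := 1) (a₂ := 1) (a₃ := 2) (a₄ := 0) (a₅ := 0)
        one_pos zero_le_one zero_le_two le_rfl le_rfl
      simp only [h3, hl, hs, h4, hls] at this
      linarith
  have hf : Function.Bijective ![l, s] := by
    constructor
    · intro a b
      fin_cases a <;> fin_cases b <;> simp [hne, hne.symm]
    · intro x
      rcases hall x with rfl | rfl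
      · exact ⟨0, rfl⟩
      · exact ⟨1, rfl⟩
  refine ⟨Equiv.ofBijective _ hf, fun a b => ?_⟩
  fin_cases a <;> fin_cases b
  · change ⟪v l, v l⟫ = 6
    rw [inner_self_eq_nu, hl]; norm_num
  · exact hls
  · exact (real_inner_comm _ _).trans hls
  · change ⟪v s, v s⟫ = 2
    rw [inner_self_eq_nu, hs]; norm_num

/-- Obtuseness and the norm leave $v_l+v_s$ among the short roots and $v_l+3v_s$ among the long
ones. The former would give $T(v_l)=1$, the latter $t_{sht}^3=1$. -/
lemma Specialization.false_of_three (hT : Specialization R v 3 T ts tl)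
    (h : SimpleData R Rpos r v 3) {f : Fin 2 ≃ κ}
    (hf : ∀ i j, ⟪v (f i), v (f j)⟫ = (!![6, -3; -3, 2] : Matrix (Fin 2) (Fin 2) ℝ) i j)
    (hts : ts ^ 3 ≠ 1) {α : V} (hα : α ∈ Rpos) (hns : ∀ i, α ≠ v i)
    (hs : nu α = 1 → T α = ts) (hl : nu α = 3 → T α = tl) : False := by
  obtain ⟨⟨i, hi, hiν⟩, hopp⟩ := hT.exists_inner_pos_nu_ne h hα hns hs (by simpa using hl)
  obtain ⟨m, hm⟩ := h.exists_nat hα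
  rw [← f.sum_comp, Fin.sum_univ_two] at hm
  have hν0 : nu (v (f 0)) = 3 := by rw [nu, hf]; norm_num
  have hν1 : nu (v (f 1)) = 1 := by rw [nu, hf]; norm_num
  generalize m (f 0) = d at hm
  generalize m (f 1) = c at hm
  have hin : ∀ j, ⟪α, v (f j)⟫ = d * ⟪v (f 0), v (f j)⟫ + c * ⟪v (f 1), v (f j)⟫ := fun j => by
    rw [hm, inner_add_left, ← Nat.cast_smul_eq_nsmul ℝ, ← Nat.cast_smul_eq_nsmul ℝ,
      inner_smul_left, inner_smul_left]
    simp
  have h0 : ⟪α, v (f 0)⟫ = 6 * d - 3 * c := by rw [hin, hf, hf]; norm_num; ring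
  have h1 : ⟪α, v (f 1)⟫ = -3 * d + 2 * c := by rw [hin, hf, hf]; norm_num; ring
  have hαα : 2 * nu α = d * (6 * d - 3 * c) + c * (-3 * d + 2 * c) := by
    rw [← inner_self_eq_nu, ← h0, ← h1]
    nth_rw 2 [hm]
    rw [inner_add_right, ← Nat.cast_smul_eq_nsmul ℝ, ← Nat.cast_smul_eq_nsmul ℝ,
      inner_smul_right, inner_smul_right]
  have hTα : T α = T (v (f 0)) ^ d * T (v (f 1)) ^ c := by
    rw [hm, hT.map_add, hT.map_nsmul, hT.map_nsmul]
  have hT0 : T (v (f 0)) = tl := hT.long _ (by rw [hν0]; norm_num)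
  have hT1 : T (v (f 1)) = ts := hT.short _ hν1
  rw [hT0, hT1] at hTα
  have hν : nu α = 1 ∨ nu α = 3 := by simpa using h.nu_eq _ (h.mem_of_pos hα)
  obtain ⟨i, rfl⟩ := f.surjective i
  rcases hν with hν | hν
  · have hi0 : i = 0 := by
      fin_cases i
      · rfl
      · exact absurd (by rw [hν]; exact hν1) hiν
    subst hi0
    have h2 := hopp (f 1) (by rw [hν1, hν])
    rw [h0] at hi
    rw [h1] at h2
    rw [hν] at hαα
    have e0 : (3 : ℤ) * c < 6 * d := by exact_mod_cast (by linarith : (3 * c : ℝ) < 6 * d)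
    have e1 : (2 : ℤ) * c ≤ 3 * d := by exact_mod_cast (by linarith : (2 * c : ℝ) ≤ 3 * d)
    have e2 : (d : ℤ) * (6 * d - 3 * c) + c * (-3 * d + 2 * c) = 2 := by
      exact_mod_cast (by linarith : (d * (6 * d - 3 * c) + c * (-3 * d + 2 * c) : ℝ) = 2)
    have e3 : (d : ℤ) ≤ 1 := by nlinarith [sq_nonneg ((2 : ℤ) * c - 3 * d)]
    have e4 : d = 1 := by omega
    subst e4
    have e5 : c = 1 := by
      have : c ≤ 1 := by omega
      interval_cases c
      · norm_num at e2
      · rfl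
    subst e5
    rw [hs hν, pow_one, pow_one] at hTα
    refine hT.ne_one _ (h.mem (f 0)) ?_
    rw [hT0]
    exact (mul_eq_right₀ (hT1 ▸ hT.ne_zero _)).1 hTα.symm
  · have hi0 : i = 1 := by
      fin_cases i
      · exact absurd (by rw [hν]; exact hν0) hiν
      · rfl
    subst hi0
    have h2 := hopp (f 0) (by rw [hν0, hν])
    rw [h1] at hi
    rw [h0] at h2
    rw [hν] at hαα
    have e1 : (2 : ℤ) * d ≤ c := by exact_mod_cast (by linarith : (2 * d : ℝ) ≤ c)
    have e2 : (d : ℤ) * (6 * d - 3 * c) + c * (-3 * d + 2 * c) = 6 := by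
      exact_mod_cast (by linarith : (d * (6 * d - 3 * c) + c * (-3 * d + 2 * c) : ℝ) = 6)
    obtain ⟨e, he⟩ : ∃ e : ℕ, c = 2 * d + e := ⟨c - 2 * d, by omega⟩
    subst he
    push_cast at e2
    have e0 : (0 : ℤ) ≤ d * e := mul_nonneg (Nat.cast_nonneg d) (Nat.cast_nonneg e)
    have e3 : (d : ℤ) ≤ 1 := by nlinarith
    have e4 : (e : ℤ) ≤ 1 := by nlinarith
    have e5 : d = 1 ∧ e = 1 := by
      have : d ≤ 1 := by omega
      have : e ≤ 1 := by omega
      interval_cases d <;> interval_cases e <;> first | exact ⟨rfl, rfl⟩ | (exfalso; norm_num at e2)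
    rw [e5.1, e5.2, hl hν, pow_one] at hTα
    exact hts ((mul_eq_left₀ (hT0 ▸ hT.ne_zero _)).1 hTα.symm)

end TwoLengths

/-! ### At least two simple roots of each length: type F₄ -/

section TypeF

variable {V : Type*} [NormedAddCommGroup V] [InnerProductSpace ℝ V] {R Rpos : Set V} {r : V}
  {κ : Type*} [Fintype κ] {v : κ → V} {T : V → ℂ} {ts tl : ℂ}

/-- The simple roots `i` and `j` belong to a set of simple roots of the same length whose sum is
not longer than they are. -/
def EqualLengthPath (v : κ → V) (i j : κ) : Prop :=
  ∃ S : Finset κ, i ∈ S ∧ j ∈ S ∧ (∀ x ∈ S, nu (v x) = nu (v i)) ∧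
    ⟪∑ x ∈ S, v x, ∑ x ∈ S, v x⟫ ≤ 2 * nu (v i)

omit [Fintype κ] in
lemma EqualLengthPath.refl (i : κ) : EqualLengthPath v i i :=
  ⟨{i}, by simp, by simp, by simp, by rw [Finset.sum_singleton, inner_self_eq_nu]⟩

/-- The Cartan integers of the simple roots `v` are those of type `F₄`. -/
def HasCartanF (v : κ → V) : Prop :=
  ∃ e : κ ≃ Fin 4, ∀ i j, (CartanMatrix.F₄ (e i) (e j) : ℝ) = ⟪v i, v j⟫ / nu (v j)

/-- The Gram matrix of the simple roots of type `F₄`. -/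
def gramF : Matrix (Fin 4) (Fin 4) ℝ := !![4, -2, 0, 0; -2, 4, -2, 0; 0, -2, 2, -1; 0, 0, -1, 2]

lemma gramF_apply : gramF 0 0 = 4 ∧ gramF 0 1 = -2 ∧ gramF 0 2 = 0 ∧ gramF 0 3 = 0 ∧
    gramF 1 0 = -2 ∧ gramF 1 1 = 4 ∧ gramF 1 2 = -2 ∧ gramF 1 3 = 0 ∧
    gramF 2 0 = 0 ∧ gramF 2 1 = -2 ∧ gramF 2 2 = 2 ∧ gramF 2 3 = -1 ∧
    gramF 3 0 = 0 ∧ gramF 3 1 = 0 ∧ gramF 3 2 = -1 ∧ gramF 3 3 = 2 :=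
  ⟨rfl, rfl, rfl, rfl, rfl, rfl, rfl, rfl, rfl, rfl, rfl, rfl, rfl, rfl, rfl, rfl⟩

/-- The inner products with the simple roots take at most three values each, which leaves finitely
many linear systems for the coefficients. Integrality, obtuseness and the norm eliminate all but
three. -/
lemma gramF_short_cases {a b c d : ℕ}
    (h0 : (4 * a - 2 * b : ℤ) = 0 ∨ (4 * a - 2 * b : ℤ) = 2 ∨ (4 * a - 2 * b : ℤ) = -2)
    (h1 : (4 * b - 2 * a - 2 * c : ℤ) = 0 ∨ (4 * b - 2 * a - 2 * c : ℤ) = 2 ∨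
      (4 * b - 2 * a - 2 * c : ℤ) = -2)
    (h2 : (2 * c - 2 * b - d : ℤ) = 0 ∨ (2 * c - 2 * b - d : ℤ) = 1 ∨
      (2 * c - 2 * b - d : ℤ) = -1)
    (h3 : (2 * d - c : ℤ) = 0 ∨ (2 * d - c : ℤ) = 1 ∨ (2 * d - c : ℤ) = -1)
    (h2' : (2 * c - 2 * b - d : ℤ) ≤ 0) (h3' : (2 * d - c : ℤ) ≤ 0)
    (hn : (a * (4 * a - 2 * b) + b * (4 * b - 2 * a - 2 * c) + c * (2 * c - 2 * b - d) +
      d * (2 * d - c) : ℤ) = 2) :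
    (a = 0 ∧ b = 1 ∧ c = 1 ∧ d = 0) ∨ (a = 1 ∧ b = 1 ∧ c = 1 ∧ d = 0) ∨
      (a = 1 ∧ b = 2 ∧ c = 2 ∧ d = 1) := by
  rcases h0 with h0 | h0 | h0 <;> rcases h1 with h1 | h1 | h1 <;>
    rcases h2 with h2 | h2 | h2 <;> rcases h3 with h3 | h3 | h3 <;>
    first
    | omega
    | (rw [h0, h1, h2, h3] at hn; omega)

lemma gramF_long_cases {a b c d : ℕ}
    (h0 : (4 * a - 2 * b : ℤ) = 0 ∨ (4 * a - 2 * b : ℤ) = 2 ∨ (4 * a - 2 * b : ℤ) = -2)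
    (h1 : (4 * b - 2 * a - 2 * c : ℤ) = 0 ∨ (4 * b - 2 * a - 2 * c : ℤ) = 2 ∨
      (4 * b - 2 * a - 2 * c : ℤ) = -2)
    (h2 : (2 * c - 2 * b - d : ℤ) = 0 ∨ (2 * c - 2 * b - d : ℤ) = 2 ∨
      (2 * c - 2 * b - d : ℤ) = -2)
    (h3 : (2 * d - c : ℤ) = 0 ∨ (2 * d - c : ℤ) = 2 ∨ (2 * d - c : ℤ) = -2)
    (h0' : (4 * a - 2 * b : ℤ) ≤ 0) (h1' : (4 * b - 2 * a - 2 * c : ℤ) ≤ 0)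
    (hn : (a * (4 * a - 2 * b) + b * (4 * b - 2 * a - 2 * c) + c * (2 * c - 2 * b - d) +
      d * (2 * d - c) : ℤ) = 4) :
    (a = 0 ∧ b = 1 ∧ c = 2 ∧ d = 0) ∨ (a = 0 ∧ b = 1 ∧ c = 2 ∧ d = 2) ∨
      (a = 1 ∧ b = 2 ∧ c = 4 ∧ d = 2) := by
  rcases h0 with h0 | h0 | h0 <;> rcases h1 with h1 | h1 | h1 <;>
    rcases h2 with h2 | h2 | h2 <;> rcases h3 with h3 | h3 | h3 <;>
    first
    | omega
    | (rw [h0, h1, h2, h3] at hn; omega)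

namespace SimpleData

section

variable {νlng : ℕ} (h : SimpleData R Rpos r v νlng)
include h

lemma inner_sum_le {S : Finset κ} {y j : κ} (hy : y ∉ S) (hj : j ∈ S) :
    ⟪∑ x ∈ S, v x, v y⟫ ≤ ⟪v j, v y⟫ := by
  classical
  rw [← Finset.add_sum_erase S v hj, inner_add_left, sum_inner]
  have := Finset.sum_nonpos (s := S.erase j) (f := fun x => ⟪v x, v y⟫) fun x hx =>
    h.inner_simple_nonpos (i := x) (j := y) fun h1 => hy (h1 ▸ Finset.mem_of_mem_erase hx)
  linarith

lemma inner_sum_height_pos {S : Finset κ} {j : κ} (hj : j ∈ S) : 0 < ⟪r, ∑ x ∈ S, v x⟫ := by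
  rw [inner_sum]
  exact Finset.sum_pos (fun x _ => by rw [h.height]; exact one_pos) ⟨j, hj⟩

/-- A new adjacent root contributes $2\nu$ to the squared norm and at least $2\nu$ with the opposite
sign through its neighbour, so the bound persists. -/
lemma _root_.DoubleAffine.EqualLengthPath.extend {i j y : κ} (hij : EqualLengthPath v i j)
    (hy : nu (v y) = nu (v i)) (hjy : ⟪v j, v y⟫ ≠ 0) : EqualLengthPath v i y := by
  classical
  obtain ⟨S, hi, hj, hS, hle⟩ := hij
  by_cases hyS : y ∈ S
  · exact ⟨S, hi, hyS, hS, hle⟩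
  refine ⟨insert y S, Finset.mem_insert_of_mem hi, Finset.mem_insert_self _ _, ?_, ?_⟩
  · intro x hx
    rcases Finset.mem_insert.1 hx with rfl | hx
    · exact hy
    · exact hS x hx
  · rw [Finset.sum_insert hyS, inner_add_left, inner_add_right, inner_add_right,
      real_inner_comm (∑ x ∈ S, v x) (v y), inner_self_eq_nu, hy]
    have h1 := h.inner_sum_le hyS hj
    have h2 := h.inner_eq_neg_nu (i := j) (j := y) (fun h1 => hyS (h1 ▸ hj))
      (by rw [hy, hS j hj]) hjy
    rw [hy] at h2
    linarith

end

variable (h : SimpleData R Rpos r v 2)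
include h

lemma nu_one_or_two (i : κ) : nu (v i) = 1 ∨ nu (v i) = 2 := by simpa using h.nu_eq _ (h.mem i)

lemma inner_long_short {i j : κ}
    (hi : nu (v i) = 2) (hj : nu (v j) = 1) (hne : ⟪v i, v j⟫ ≠ 0) : ⟪v i, v j⟫ = -2 := by
  rw [real_inner_comm] at hne ⊢
  rw [h.inner_eq_neg_nu (ne_of_nu_ne (by rw [hi, hj]; norm_num)) (by rw [hi, hj]; norm_num) hne, hi]

/-- Two different short roots attached to a path of long ones would give the sum of all these roots
squared norm at most $4+2+2-4-4=0$. -/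
lemma short_eq_of_path {i j s y : κ} (hij : EqualLengthPath v i j) (hi : nu (v i) = 2)
    (hs : nu (v s) = 1) (hy : nu (v y) = 1) (his : ⟪v i, v s⟫ ≠ 0) (hjy : ⟪v j, v y⟫ ≠ 0) :
    y = s := by
  by_contra hne
  obtain ⟨S, hiS, hjS, hS, hle⟩ := hij
  have hsS : s ∉ S := fun h1 => by have := hS s h1; rw [hs, hi] at this; norm_num at this
  have hyS : y ∉ S := fun h1 => by have := hS y h1; rw [hy, hi] at this; norm_num at this
  have h1 := h.inner_sum_le hsS hiS
  have h2 := h.inner_sum_le hyS hjS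
  rw [h.inner_long_short hi hs his] at h1
  rw [h.inner_long_short (by rw [hS j hjS, hi]) hy hjy] at h2
  have h3 := h.inner_simple_nonpos hne
  have h4 := inner_self_pos_of_inner_pos (r := r) (w := ∑ x ∈ S, v x + v s + v y) (by
    simp only [inner_add_right, h.height]
    linarith [h.inner_sum_height_pos hiS])
  simp only [inner_add_left, inner_add_right] at h4
  rw [inner_self_eq_nu (v s), inner_self_eq_nu (v y), real_inner_comm (∑ x ∈ S, v x) (v s),
    real_inner_comm (∑ x ∈ S, v x) (v y), real_inner_comm (v y) (v s), hs, hy] at h4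
  rw [hi] at hle
  linarith

/-- For two different long roots attached to a path of short ones, twice the path sum plus the two
roots would have squared norm at most $8+4+4-8-8=0$. -/
lemma long_eq_of_path {i j l y : κ} (hij : EqualLengthPath v i j) (hi : nu (v i) = 1)
    (hl : nu (v l) = 2) (hy : nu (v y) = 2) (hil : ⟪v i, v l⟫ ≠ 0) (hjy : ⟪v j, v y⟫ ≠ 0) :
    y = l := by
  by_contra hne
  obtain ⟨S, hiS, hjS, hS, hle⟩ := hij
  have hlS : l ∉ S := fun h1 => by have := hS l h1; rw [hl, hi] at this; norm_num at this
  have hyS : y ∉ S := fun h1 => by have := hS y h1; rw [hy, hi] at this; norm_num at this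
  have h1 := h.inner_sum_le hlS hiS
  have h2 := h.inner_sum_le hyS hjS
  rw [real_inner_comm] at hil hjy
  rw [real_inner_comm (v l) (v i), h.inner_long_short hl hi hil] at h1
  rw [real_inner_comm (v y) (v j), h.inner_long_short hy (by rw [hS j hjS, hi]) hjy] at h2
  have h3 := h.inner_simple_nonpos hne
  have h4 := inner_self_pos_of_inner_pos (r := r) (w := (2 : ℝ) • ∑ x ∈ S, v x + v l + v y) (by
    simp only [inner_add_right, inner_smul_right, h.height]
    linarith [h.inner_sum_height_pos hiS])
  simp only [inner_add_left, inner_add_right, inner_smul_left, inner_smul_right,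
    conj_trivial] at h4
  rw [inner_self_eq_nu (v l), inner_self_eq_nu (v y), real_inner_comm (∑ x ∈ S, v x) (v l),
    real_inner_comm (∑ x ∈ S, v x) (v y), real_inner_comm (v y) (v l), hl, hy] at h4
  rw [hi] at hle
  linarith

/-- Otherwise $l$ and the short simple roots joined to $s$ would be closed under adjacency, and by
connectedness $l$ would be the only long simple root. -/
lemma exists_long_neighbor {l s l' : κ} (hl : nu (v l) = 2) (hs : nu (v s) = 1)
    (hls : ⟪v l, v s⟫ ≠ 0) (hl' : nu (v l') = 2) (hne : l' ≠ l) :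
    ∃ x, x ≠ l ∧ nu (v x) = 2 ∧ ⟪v l, v x⟫ ≠ 0 := by
  by_contra! hcon
  refine absurd (h.connected (fun x => x = l ∨ (nu (v x) = 1 ∧ EqualLengthPath v s x)) l l'
    (Or.inl rfl) ?_) ?_
  swap
  · rintro (h1 | h1)
    · exact hne h1
    · rw [hl'] at h1; norm_num at h1
  rintro x y (rfl | ⟨hx, hp⟩) hxy
  · rcases h.nu_one_or_two y with hy | hy
    · exact Or.inr ⟨hy, h.short_eq_of_path (.refl x) hl hs hy hls hxy ▸ .refl y⟩
    · by_contra! h1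
      exact hxy (hcon y h1.1 hy)
  · rcases h.nu_one_or_two y with hy | hy
    · exact Or.inr ⟨hy, hp.extend h (by rw [hy, hs]) hxy⟩
    · exact Or.inl (h.long_eq_of_path hp hs hl hy (by rwa [real_inner_comm]) hxy)

lemma exists_short_neighbor {l s s' : κ} (hl : nu (v l) = 2) (hs : nu (v s) = 1)
    (hls : ⟪v l, v s⟫ ≠ 0) (hs' : nu (v s') = 1) (hne : s' ≠ s) :
    ∃ x, x ≠ s ∧ nu (v x) = 1 ∧ ⟪v s, v x⟫ ≠ 0 := by
  by_contra! hcon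
  refine absurd (h.connected (fun x => x = s ∨ (nu (v x) = 2 ∧ EqualLengthPath v l x)) s s'
    (Or.inl rfl) ?_) ?_
  swap
  · rintro (h1 | h1)
    · exact hne h1
    · rw [hs'] at h1; norm_num at h1
  rintro x y (rfl | ⟨hx, hp⟩) hxy
  · rcases h.nu_one_or_two y with hy | hy
    · by_contra! h1
      exact hxy (hcon y h1.1 hy)
    · exact Or.inr ⟨hy, h.long_eq_of_path (.refl x) hs hl hy (by rwa [real_inner_comm]) hxy ▸
        .refl y⟩
  · rcases h.nu_one_or_two y with hy | hy
    · exact Or.inl (h.short_eq_of_path hp hl hs hy hls hxy)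
    · exact Or.inr ⟨hy, hp.extend h (by rw [hy, hl]) hxy⟩

/-- If there are two long and two short simple roots, then the type is `F₄`. -/
lemma exists_equiv_gramF {l₁ l₂ s₁ s₂ : κ} (hl₁ : nu (v l₁) = 2) (hl₂ : nu (v l₂) = 2)
    (hl : l₁ ≠ l₂) (hs₁ : nu (v s₁) = 1) (hs₂ : nu (v s₂) = 1) (hs : s₁ ≠ s₂) :
    ∃ f : Fin 4 ≃ κ, ∀ i j, ⟪v (f i), v (f j)⟫ = gramF i j := by
  obtain ⟨b, c, hb, hc, hbc⟩ := h.exists_long_short (i := l₁) (j := s₁) (by rw [hl₁]; norm_num) hs₁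
    (by norm_num)
  norm_num at hb hbc
  obtain ⟨a, hab', ha, hab⟩ : ∃ x, x ≠ b ∧ nu (v x) = 2 ∧ ⟪v b, v x⟫ ≠ 0 := by
    by_cases h1 : l₁ = b
    · exact h.exists_long_neighbor hb hc (by rw [hbc]; norm_num) hl₂ fun h2 => hl (h1.trans h2.symm)
    · exact h.exists_long_neighbor hb hc (by rw [hbc]; norm_num) hl₁ h1
  obtain ⟨d, hdc', hd, hcd⟩ : ∃ x, x ≠ c ∧ nu (v x) = 1 ∧ ⟪v c, v x⟫ ≠ 0 := by
    by_cases h1 : s₁ = c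
    · exact h.exists_short_neighbor hb hc (by rw [hbc]; norm_num) hs₂
        fun h2 => hs (h1.trans h2.symm)
    · exact h.exists_short_neighbor hb hc (by rw [hbc]; norm_num) hs₁ h1
  have hab2 : ⟪v a, v b⟫ = -2 := by
    rw [real_inner_comm] at hab
    rw [h.inner_eq_neg_nu hab' (by rw [ha, hb]) hab, hb]
  have hcd2 : ⟪v c, v d⟫ = -1 := by
    rw [h.inner_eq_neg_nu hdc'.symm (by rw [hc, hd]) hcd, hd]
  have hLS : ∀ {x y : κ}, nu (v x) = 2 → nu (v y) = 1 → x ≠ y := fun hx hy =>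
    ne_of_nu_ne (by rw [hx, hy]; norm_num)
  have hac' := hLS ha hc
  have had' := hLS ha hd
  have hbc' := hLS hb hc
  have hbd' := hLS hb hd
  have hac : ⟪v a, v c⟫ = 0 := by
    by_contra h1
    have h2 := h.inner_long_short ha hc h1
    have := h.inner_self_pos₅ a b c c c (a₁ := 1) (a₂ := 1) (a₃ := 1) (a₄ := 0) (a₅ := 0)
      one_pos zero_le_one zero_le_one le_rfl le_rfl
    simp only [ha, hb, hc, h2, hab2, hbc] at this
    linarith
  have hbd : ⟪v b, v d⟫ = 0 := by
    by_contra h1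
    have h2 := h.inner_long_short hb hd h1
    have := h.inner_self_pos₅ b c d d d (a₁ := 1) (a₂ := 1) (a₃ := 1) (a₄ := 0) (a₅ := 0)
      one_pos zero_le_one zero_le_one le_rfl le_rfl
    simp only [hb, hc, hd, h2, hcd2, hbc] at this
    linarith
  have had : ⟪v a, v d⟫ = 0 := by
    by_contra h1
    have h2 := h.inner_long_short ha hd h1
    have := h.inner_self_pos₅ a b c d d (a₁ := 1) (a₂ := 1) (a₃ := 1) (a₄ := 1) (a₅ := 0)
      one_pos zero_le_one zero_le_one zero_le_one le_rfl
    simp only [ha, hb, hc, hd, h2, hab2, hac, hbd, hcd2, hbc] at this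
    linarith
  -- A fifth simple root adjacent to one of the four is excluded by a combination of nonpositive
  -- squared norm. For the two ends of the diagram the coefficients are the marks of the affine
  -- diagrams extending $F_4$.
  have hall : ∀ x, x = a ∨ x = b ∨ x = c ∨ x = d := by
    intro x
    refine h.connected (fun x => x = a ∨ x = b ∨ x = c ∨ x = d) a x (Or.inl rfl) ?_
    intro y x hy hxy
    by_contra! hx
    obtain ⟨hxa, hxb, hxc, hxd⟩ := hx
    have na := h.inner_simple_nonpos hxa
    have nb := h.inner_simple_nonpos hxb
    have nc := h.inner_simple_nonpos hxc
    have nd := h.inner_simple_nonpos hxd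
    rw [real_inner_comm] at hxy
    rcases h.nu_one_or_two x with h3 | h3 <;> rcases hy with rfl | rfl | rfl | rfl
    · have h4 := h.inner_eq_neg_nu hxa (by rw [h3, ha]; norm_num) hxy
      have := h.inner_self_pos₅ x y b c c (a₁ := 1) (a₂ := 1) (a₃ := 1) (a₄ := 1) (a₅ := 0)
        one_pos zero_le_one zero_le_one zero_le_one le_rfl
      simp only [h3, h4, ha, hb, hc, hab2, hac, hbc] at this
      linarith
    · have h4 := h.inner_eq_neg_nu hxb (by rw [h3, hb]; norm_num) hxy
      have := h.inner_self_pos₅ x y c c c (a₁ := 1) (a₂ := 1) (a₃ := 1) (a₄ := 0) (a₅ := 0)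
        one_pos zero_le_one zero_le_one le_rfl le_rfl
      simp only [h3, h4, hb, hc, hbc] at this
      linarith
    · have h4 := h.inner_eq_neg_nu hxc (by rw [h3, hc]) hxy
      have := h.inner_self_pos₅ x b y d d (a₁ := 1) (a₂ := 1) (a₃ := 2) (a₄ := 1) (a₅ := 0)
        one_pos zero_le_one zero_le_two zero_le_one le_rfl
      simp only [h3, h4, hb, hc, hd, hbc, hbd, hcd2] at this
      linarith
    · have h4 := h.inner_eq_neg_nu hxd (by rw [h3, hd]) hxy
      have := h.inner_self_pos₅ x a b c y (a₁ := 1) (a₂ := 1) (a₃ := 2) (a₄ := 3) (a₅ := 2)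
        one_pos zero_le_one zero_le_two zero_le_three zero_le_two
      simp only [h3, h4, ha, hb, hc, hd, hab2, hac, had, hbc, hbd, hcd2] at this
      linarith
    · have h4 := h.inner_eq_neg_nu hxa (by rw [h3, ha]) hxy
      have := h.inner_self_pos₅ x y b c d (a₁ := 1) (a₂ := 2) (a₃ := 3) (a₄ := 4) (a₅ := 2)
        one_pos zero_le_two zero_le_three zero_le_four zero_le_two
      simp only [h3, h4, ha, hb, hc, hd, hab2, hac, had, hbc, hbd, hcd2] at this
      linarith
    · have h4 := h.inner_eq_neg_nu hxb (by rw [h3, hb]) hxy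
      have := h.inner_self_pos₅ x a y c c (a₁ := 1) (a₂ := 1) (a₃ := 2) (a₄ := 2) (a₅ := 0)
        one_pos zero_le_one zero_le_two zero_le_two le_rfl
      simp only [h3, h4, ha, hb, hc, hab2, hac, hbc] at this
      linarith
    · have h4 := h.inner_long_short h3 hc hxy
      have := h.inner_self_pos₅ x b y y y (a₁ := 1) (a₂ := 1) (a₃ := 2) (a₄ := 0) (a₅ := 0)
        one_pos zero_le_one zero_le_two le_rfl le_rfl
      simp only [h3, h4, hb, hc, hbc] at this
      linarith
    · have h4 := h.inner_long_short h3 hd hxy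
      have := h.inner_self_pos₅ x b c y y (a₁ := 1) (a₂ := 1) (a₃ := 2) (a₄ := 2) (a₅ := 0)
        one_pos zero_le_one zero_le_two zero_le_two le_rfl
      simp only [h3, h4, hb, hc, hd, hbc, hbd, hcd2] at this
      linarith
  have hf : Function.Bijective ![a, b, c, d] := by
    constructor
    · intro i j
      fin_cases i <;> fin_cases j <;>
        simp [hab', hab'.symm, hac', hac'.symm, had', had'.symm, hbc', hbc'.symm, hbd', hbd'.symm,
          hdc', hdc'.symm]
    · intro x
      rcases hall x with rfl | rfl | rfl | rfl
      · exact ⟨0, rfl⟩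
      · exact ⟨1, rfl⟩
      · exact ⟨2, rfl⟩
      · exact ⟨3, rfl⟩
  have haa : ⟪v a, v a⟫ = 4 := by rw [inner_self_eq_nu, ha]; norm_num
  have hbb : ⟪v b, v b⟫ = 4 := by rw [inner_self_eq_nu, hb]; norm_num
  have hcc : ⟪v c, v c⟫ = 2 := by rw [inner_self_eq_nu, hc]; norm_num
  have hdd : ⟪v d, v d⟫ = 2 := by rw [inner_self_eq_nu, hd]; norm_num
  refine ⟨Equiv.ofBijective _ hf, fun i j => ?_⟩
  fin_cases i <;> fin_cases j <;> first
    | exact haa | exact hbb | exact hcc | exact hdd | exact hab2 | exact hac | exact had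
    | exact hbc | exact hbd | exact hcd2
    | exact (real_inner_comm _ _).trans hab2 | exact (real_inner_comm _ _).trans hac
    | exact (real_inner_comm _ _).trans had | exact (real_inner_comm _ _).trans hbc
    | exact (real_inner_comm _ _).trans hbd | exact (real_inner_comm _ _).trans hcd2

omit h [Fintype κ] in
lemma hasCartanF {f : Fin 4 ≃ κ} (hf : ∀ i j, ⟪v (f i), v (f j)⟫ = gramF i j) : HasCartanF v := by
  refine ⟨f.symm, fun i j => ?_⟩
  obtain ⟨i, rfl⟩ := f.surjective i
  obtain ⟨j, rfl⟩ := f.surjective j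
  rw [nu, hf, hf, f.symm_apply_apply, f.symm_apply_apply]
  fin_cases i <;> fin_cases j <;> norm_num [gramF, CartanMatrix.F₄]

end SimpleData

namespace Specialization

variable (hT : Specialization R v 2 T ts tl) (h : SimpleData R Rpos r v 2) {f : Fin 4 ≃ κ}
  (hf : ∀ i j, ⟪v (f i), v (f j)⟫ = gramF i j)
include hT h hf

/-- Six coefficient vectors survive. The short ones $0110$, $1110$, $1221$ would give $T=1$ at the
roots $1000$, $1100$, $1220$. The long ones $0120$, $0122$ give $t_{sht}^4=1$, and $1242$ gives
$(t_{lng}t_{sht}^3)^2=1$, where the root $0121$ excludes $+1$ and the assumption $-1$. -/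
lemma false_of_gramF (hts : ts ^ 4 ≠ 1) (htl : tl * ts ^ 3 ≠ -1) {α : V} (hα : α ∈ Rpos)
    (hns : ∀ i, α ≠ v i) (hs : nu α = 1 → T α = ts) (hl : nu α = 2 → T α = tl) : False := by
  obtain ⟨-, hopp⟩ := hT.exists_inner_pos_nu_ne h hα hns hs (by simpa using hl)
  obtain ⟨m, hm⟩ := h.exists_nat hα
  rw [← f.sum_comp, Fin.sum_univ_four] at hm
  have hν : nu (v (f 0)) = 2 ∧ nu (v (f 1)) = 2 ∧ nu (v (f 2)) = 1 ∧ nu (v (f 3)) = 1 := by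
    simp only [nu, hf]
    norm_num [gramF_apply]
  obtain ⟨hν0, hν1, hν2, hν3⟩ := hν
  have hT0 : T (v (f 0)) = tl := hT.long _ (by rw [hν0]; norm_num)
  have hT1 : T (v (f 1)) = tl := hT.long _ (by rw [hν1]; norm_num)
  have hT2 : T (v (f 2)) = ts := hT.short _ hν2
  have hT3 : T (v (f 3)) = ts := hT.short _ hν3
  have htl0 : tl ≠ 0 := hT0 ▸ hT.ne_zero _
  have hts0 : ts ≠ 0 := hT2 ▸ hT.ne_zero _
  generalize m (f 0) = a at hm
  generalize m (f 1) = b at hm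
  generalize m (f 2) = c at hm
  generalize m (f 3) = d at hm
  have hTα : T α = tl ^ a * tl ^ b * ts ^ c * ts ^ d := by
    rw [hm, hT.map_add, hT.map_add, hT.map_add, hT.map_nsmul, hT.map_nsmul, hT.map_nsmul,
      hT.map_nsmul, hT0, hT1, hT2, hT3]
  have hin : ∀ j, ⟪α, v (f j)⟫ = a * gramF 0 j + b * gramF 1 j + c * gramF 2 j + d * gramF 3 j :=
    fun j => by
    simp only [hm, inner_add_left, ← Nat.cast_smul_eq_nsmul ℝ, inner_smul_left, hf]
    simp
  have hin' : ∀ (j : Fin 4) (z N : ℤ), ⟪α, v (f j)⟫ = z → max (nu α) (nu (v (f j))) = N →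
      z = 0 ∨ z = N ∨ z = -N := fun j z N hz hN => by
    have : ⟪α, v (f j)⟫ = 0 ∨ ⟪α, v (f j)⟫ = max (nu α) (nu (v (f j))) ∨
        ⟪α, v (f j)⟫ = -max (nu α) (nu (v (f j))) := by
      rcases le_total (nu α) (nu (v (f j))) with h1 | h1
      · rw [max_eq_right h1]
        exact inner_cases h.root (h.mem_of_pos hα) (h.mem (f j)) h1 (hns _)
          (h.ne_neg hα (h.mem_pos _))
      · rw [max_eq_left h1, real_inner_comm]
        exact inner_cases h.root (h.mem (f j)) (h.mem_of_pos hα) h1 (hns _).symm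
          (h.ne_neg (h.mem_pos _) hα)
    rw [hz, hN] at this
    exact_mod_cast this
  have hαα : 2 * nu α = a * ⟪α, v (f 0)⟫ + b * ⟪α, v (f 1)⟫ + c * ⟪α, v (f 2)⟫ +
      d * ⟪α, v (f 3)⟫ := by
    rw [← inner_self_eq_nu]
    nth_rw 2 [hm]
    simp only [inner_add_right, ← Nat.cast_smul_eq_nsmul ℝ, inner_smul_right]
  have g0 : ⟪α, v (f 0)⟫ = ((4 * a - 2 * b : ℤ) : ℝ) := by rw [hin]; simp [gramF_apply]; ring
  have g1 : ⟪α, v (f 1)⟫ = ((4 * b - 2 * a - 2 * c : ℤ) : ℝ) := by rw [hin]; simp [gramF_apply]; ring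
  have g2 : ⟪α, v (f 2)⟫ = ((2 * c - 2 * b - d : ℤ) : ℝ) := by rw [hin]; simp [gramF_apply]; ring
  have g3 : ⟪α, v (f 3)⟫ = ((2 * d - c : ℤ) : ℝ) := by rw [hin]; simp [gramF_apply]; ring
  have hadd : ∀ {β : V} {i : κ}, β ∈ R → ⟪β, v i⟫ = -nu (v i) → β + v i ∈ R := fun {β i} h1 h2 => by
    have := reflect_of_inner_eq h.root (h.mem i) h1 (c := -1) (by rw [h2]; ring)
    rwa [neg_one_smul, sub_neg_eq_add] at this
  have hmem : ∀ i j, gramF i j = -nu (v (f j)) → v (f i) + v (f j) ∈ R := fun i j h1 =>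
    hadd (h.mem _) (by rw [hf, h1])
  have r01 : v (f 0) + v (f 1) ∈ R := hmem 0 1 (by rw [hν1]; norm_num [gramF_apply])
  have r12 : v (f 2) + v (f 1) ∈ R := hmem 2 1 (by rw [hν1]; norm_num [gramF_apply])
  have r123 : v (f 2) + v (f 1) + v (f 3) ∈ R := hadd r12 (by
    rw [hν3, inner_add_left, hf, hf]; norm_num [gramF_apply])
  have r1223 : v (f 2) + v (f 1) + v (f 3) + v (f 2) ∈ R := hadd r123 (by
    rw [hν2, inner_add_left, inner_add_left, hf, hf, hf]; norm_num [gramF_apply])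
  have r122 : v (f 1) + (2 : ℝ) • v (f 2) ∈ R := by
    have := reflect_of_inner_eq h.root (h.mem (f 2)) (h.mem (f 1)) (c := -2) (by
      rw [hf, hν2]; norm_num [gramF_apply])
    rwa [neg_smul, sub_neg_eq_add] at this
  have r0122 : v (f 1) + (2 : ℝ) • v (f 2) + v (f 0) ∈ R := hadd r122 (by
    rw [inner_add_left, inner_smul_left, hf, hf, hν0]; norm_num [gramF_apply])
  have r01122 : v (f 1) + (2 : ℝ) • v (f 2) + v (f 0) + v (f 1) ∈ R := hadd r0122 (by
    rw [inner_add_left, inner_add_left, inner_smul_left, hf, hf, hf, hν1]; norm_num [gramF_apply])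
  have hν : nu α = 1 ∨ nu α = 2 := by simpa using h.nu_eq _ (h.mem_of_pos hα)
  rcases hν with hν | hν
  · have o2 := hopp (f 2) (by rw [hν2, hν])
    have o3 := hopp (f 3) (by rw [hν3, hν])
    rw [g2, Int.cast_nonpos] at o2
    rw [g3, Int.cast_nonpos] at o3
    have key := gramF_short_cases (hin' 0 _ 2 g0 (by rw [hν, hν0]; norm_num))
      (hin' 1 _ 2 g1 (by rw [hν, hν1]; norm_num)) (hin' 2 _ 1 g2 (by rw [hν, hν2]; norm_num))
      (hin' 3 _ 1 g3 (by rw [hν, hν3]; norm_num)) o2 o3 (by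
        rw [g0, g1, g2, g3, hν] at hαα
        exact_mod_cast hαα.symm)
    rw [hs hν] at hTα
    rcases key with ⟨rfl, rfl, rfl, rfl⟩ | ⟨rfl, rfl, rfl, rfl⟩ | ⟨rfl, rfl, rfl, rfl⟩
    · refine hT.ne_one _ (h.mem (f 0)) ?_
      rw [hT0]
      refine mul_right_cancel₀ hts0 ?_
      rw [one_mul]; nth_rw 2 [hTα]; ring
    · refine hT.ne_one _ r01 ?_
      rw [hT.map_add, hT0, hT1]
      refine mul_right_cancel₀ hts0 ?_
      rw [one_mul]; nth_rw 2 [hTα]; ring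
    · refine hT.ne_one _ r01122 ?_
      rw [two_smul, hT.map_add, hT.map_add, hT.map_add, hT.map_add, hT0, hT1, hT2]
      refine mul_right_cancel₀ hts0 ?_
      rw [one_mul]; nth_rw 4 [hTα]; ring
  · have o0 := hopp (f 0) (by rw [hν0, hν])
    have o1 := hopp (f 1) (by rw [hν1, hν])
    rw [g0, Int.cast_nonpos] at o0
    rw [g1, Int.cast_nonpos] at o1
    have key := gramF_long_cases (hin' 0 _ 2 g0 (by rw [hν, hν0]; norm_num))
      (hin' 1 _ 2 g1 (by rw [hν, hν1]; norm_num)) (hin' 2 _ 2 g2 (by rw [hν, hν2]; norm_num))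
      (hin' 3 _ 2 g3 (by rw [hν, hν3]; norm_num)) o0 o1 (by
        rw [g0, g1, g2, g3, hν] at hαα
        have : ((2 * 2 : ℤ) : ℝ) = 2 * 2 := by norm_num
        rw [← this] at hαα
        exact_mod_cast hαα.symm)
    rw [hl hν] at hTα
    rcases key with ⟨rfl, rfl, rfl, rfl⟩ | ⟨rfl, rfl, rfl, rfl⟩ | ⟨rfl, rfl, rfl, rfl⟩
    · have h1 : ts ^ 2 = 1 := mul_left_cancel₀ htl0 (by rw [mul_one]; nth_rw 2 [hTα]; ring)
      exact hts (by rw [pow_mul ts 2 2, h1, one_pow])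
    · exact hts (mul_left_cancel₀ htl0 (by rw [mul_one]; nth_rw 2 [hTα]; ring))
    · have h1 : (tl * ts ^ 3) ^ 2 = 1 :=
        mul_left_cancel₀ htl0 (by rw [mul_one]; nth_rw 3 [hTα]; ring)
      refine htl ((sq_eq_one_iff.1 h1).resolve_left fun h2 => hT.ne_one _ r1223 ?_)
      rw [hT.map_add, hT.map_add, hT.map_add, hT1, hT2, hT3, ← h2]
      ring

end Specialization

end TypeF

/-! ### Positive roots with the same values as the simple ones -/

section Simple

variable {V : Type*} [NormedAddCommGroup V] [InnerProductSpace ℝ V] {R Rpos : Set V} {r : V}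
  {κ : Type*} [Fintype κ] {v : κ → V} {νlng : ℕ} {T : V → ℂ} {ts tl : ℂ}

/-- A positive root at which `T` takes the same value as at the simple roots of the same length is
simple. -/
theorem Specialization.exists_eq_simple (hT : Specialization R v νlng T ts tl)
    (h : SimpleData R Rpos r v νlng) (hts : ts ^ νlng ≠ 1)
    (hC : HasCartanC v → ∀ j, 1 ≤ j → j < Fintype.card κ → ts ^ j ≠ -1)
    (hF : HasCartanF v → ts ^ 4 ≠ 1 ∧ tl * ts ^ 3 ≠ -1) {α : V} (hα : α ∈ Rpos)
    (hs : nu α = 1 → T α = ts) (hl : nu α = νlng → T α = tl) : ∃ i, α = v i := by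
  by_contra! hns
  obtain ⟨⟨i, -, hi⟩, -⟩ := hT.exists_inner_pos_nu_ne h hα hns hs hl
  obtain ⟨j, hj⟩ := h.exists_simple_nu_eq hα
  have hνα := h.nu_eq α (h.mem_of_pos hα)
  have hνi := h.nu_eq _ (h.mem i)
  obtain ⟨⟨l, hl'⟩, s, hs'⟩ : (∃ l, nu (v l) = νlng) ∧ ∃ s, nu (v s) = 1 := by
    rcases hνα with h1 | h1
    · exact ⟨⟨i, hνi.resolve_left fun h2 => hi (h2.trans h1.symm)⟩, j, hj.trans h1⟩
    · exact ⟨⟨j, hj.trans h1⟩, i, hνi.resolve_right fun h2 => hi (h2.trans h1.symm)⟩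
  rcases h.nulng with rfl | rfl | rfl
  · rw [Nat.cast_one, or_self] at hνα hνi
    exact hi (hνi.trans hνα.symm)
  · rw [Nat.cast_two] at hl hl' hνα
    -- The three possibilities are one long simple root, one short simple root, and at least two of
    -- each length; the last forces $F_4$.
    by_cases ha : ∀ i, nu (v i) = 2 → i = l
    · rcases hνα with h1 | h1
      · exact hT.short_of_unique_long h hl' ha hα h1 hns (hs h1)
      · exact hT.long_of_unique_long h hl' ha hC hα h1 hns (hl h1)
    by_cases hb : ∀ i j, nu (v i) = 1 → nu (v j) = 1 → i = j
    · rcases hνα with h1 | h1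
      · exact hT.short_of_unique_short h rfl hb hα h1 hns (hs h1)
      · exact hT.long_of_unique_short h rfl hb hts hα h1 hns (hl h1)
    push Not at ha hb
    obtain ⟨l₂, hl₂, hne⟩ := ha
    obtain ⟨s₁, s₂, hs₁, hs₂, hne'⟩ := hb
    obtain ⟨f, hf⟩ := h.exists_equiv_gramF hl₂ hl' hne hs₁ hs₂ hne'
    obtain ⟨h1, h2⟩ := hF (SimpleData.hasCartanF hf)
    exact hT.false_of_gramF h hf h1 h2 hα hns hs hl
  · obtain ⟨f, hf⟩ := h.exists_equiv_of_three (by rw [hl']; norm_num) hs'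
    exact hT.false_of_three h hf hts hα hns hs (by simpa using hl)

end Simple

/-! ### From root pairings to Euclidean root sets -/

section RootPairing

variable {V N ι : Type*} [NormedAddCommGroup V] [InnerProductSpace ℝ V] [AddCommGroup N]
  [Module ℝ N] {P : RootPairing ι ℝ V N}

lemma reflection_eq (hEuc : ∀ (i : ι) (x : V),
      P.coroot' i x = 2 * ⟪x, P.root i⟫ / ⟪P.root i, P.root i⟫) (i : ι) (x : V) :
    P.reflection i x = x - (⟪x, P.root i⟫ / nu (P.root i)) • P.root i := by
  rw [RootPairing.reflection_apply, hEuc, nu]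
  congr 2
  field_simp

lemma inner_reflection {α : V} (hα : α ≠ 0) (x y : V) :
    ⟪x - (⟪x, α⟫ / nu α) • α, y - (⟪y, α⟫ / nu α) • α⟫ = ⟪x, y⟫ := by
  have h1 : nu α ≠ 0 := by
    rw [nu]; exact (div_pos (real_inner_self_pos.2 hα) two_pos).ne'
  simp only [inner_sub_left, inner_sub_right, inner_smul_left, inner_smul_right, conj_trivial,
    inner_self_eq_nu, real_inner_comm y α]
  field_simp
  ring

/-- The inner product as an invariant form. -/
def invariantForm [P.IsRootSystem] (hEuc : ∀ (i : ι) (x : V),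
      P.coroot' i x = 2 * ⟪x, P.root i⟫ / ⟪P.root i, P.root i⟫) : P.InvariantForm where
  form := innerₗ V
  symm := ⟨fun x y => real_inner_comm _ _⟩
  ne_zero i := (real_inner_self_pos.2 (P.ne_zero i)).ne'
  isOrthogonal_reflection i x y := by
    simp only [reflection_eq hEuc, innerₗ_apply_apply]
    exact inner_reflection (P.ne_zero i) x y

variable [Fintype ι] [P.IsRootSystem] [P.IsCrystallographic] [P.IsReduced] [P.IsIrreducible]
  {b : P.Base}
  (hEuc : ∀ (i : ι) (x : V), P.coroot' i x = 2 * ⟪x, P.root i⟫ / ⟪P.root i, P.root i⟫)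
  (hsht : IsLeast (Set.range fun i => nu (P.root i)) 1) {νlng : ℕ}
  (hlng : IsGreatest (Set.range fun i => nu (P.root i)) (νlng : ℝ))

section
include hEuc

omit [Fintype ι] [P.IsReduced] [P.IsIrreducible] [P.IsRootSystem] in
lemma pairingIn_eq (i j : ι) :
    (P.pairingIn ℤ i j : ℝ) = ⟪P.root i, P.root j⟫ / nu (P.root j) := by
  have h1 := P.algebraMap_pairingIn ℤ i j
  rw [eq_intCast] at h1
  rw [h1, ← RootPairing.root_coroot'_eq_pairing, hEuc, nu]
  field_simp

include hsht hlng

-- In an irreducible system the ratios of squared lengths belong to $\{1,2,3\}$ or are inverses of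
-- these, and there are at most two lengths. Both facts are applied to the Euclidean inner product
-- as an invariant form.
omit b in
lemma nu_root_eq_or : (νlng = 1 ∨ νlng = 2 ∨ νlng = 3) ∧
    ∀ i, nu (P.root i) = 1 ∨ nu (P.root i) = νlng := by
  obtain ⟨⟨i₀, hi₀⟩, hmin⟩ := hsht
  obtain ⟨⟨i₁, hi₁⟩, hmax⟩ := hlng
  simp only at hi₀ hi₁
  have hform : ∀ i, (invariantForm hEuc).form (P.root i) (P.root i) = 2 * nu (P.root i) :=
    fun i => inner_self_eq_nu _
  have h1 : (1 : ℝ) ≤ νlng := hmin ⟨i₁, hi₁⟩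
  have h2 := (invariantForm hEuc).apply_eq_or i₁ i₀
  simp only [hform, hi₀, hi₁] at h2
  have h3 : νlng = 1 ∨ νlng = 2 ∨ νlng = 3 := by
    have h4 : (νlng : ℝ) = 1 ∨ (νlng : ℝ) = 2 ∨ (νlng : ℝ) = 3 := by
      rcases h2 with h2 | h2 | h2 | h2 | h2
      · left; linarith
      · right; left; linarith
      · right; right; linarith
      · linarith
      · linarith
    exact_mod_cast h4
  refine ⟨h3, fun i => ?_⟩
  by_cases h4 : (νlng : ℝ) = 1
  · have h5 : nu (P.root i) ≤ νlng := hmax ⟨i, rfl⟩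
    have h6 : 1 ≤ nu (P.root i) := hmin ⟨i, rfl⟩
    left; linarith
  · have h5 := (invariantForm hEuc).apply_eq_or_of_apply_ne (i := i₁) (j := i₀)
      (by rw [hform, hform, hi₀, hi₁]; intro h; apply h4; linarith) i
    simp only [hform, hi₀, hi₁] at h5
    rcases h5 with h5 | h5
    · right; linarith
    · left; linarith

omit b in
lemma isRootSet_range : IsRootSet (Set.range P.root) where
  finite := Set.finite_range _
  ne_zero := by rintro _ ⟨i, rfl⟩; exact P.ne_zero i
  exists_nu := by
    rintro _ ⟨i, rfl⟩
    obtain ⟨h1, h2⟩ := nu_root_eq_or hEuc hsht hlng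
    rcases h2 i with h3 | h3
    · exact ⟨1, one_pos, by rw [h3, Nat.cast_one]⟩
    · exact ⟨νlng, by omega, h3⟩
  reflect := by
    rintro _ ⟨i, rfl⟩ _ ⟨j, rfl⟩
    rw [← reflection_eq hEuc, ← P.root_reflectionPerm]
    exact ⟨_, rfl⟩
  integral := by
    rintro _ ⟨i, rfl⟩ _ ⟨j, rfl⟩
    refine ⟨P.pairingIn ℤ j i, ?_⟩
    have h1 : nu (P.root i) ≠ 0 := by
      rw [nu]; exact (div_pos (real_inner_self_pos.2 (P.ne_zero i)) two_pos).ne'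
    rw [pairingIn_eq hEuc]
    field_simp

end

omit [Fintype ι] [P.IsReduced] [P.IsIrreducible] [P.IsCrystallographic] in
lemma card_support (b : P.Base) : Fintype.card b.support = Module.finrank ℝ V :=
  (Module.finrank_eq_card_basis b.toWeightBasis).symm

omit [Fintype ι] [P.IsReduced] [P.IsIrreducible] [P.IsCrystallographic] [P.IsRootSystem] in
lemma isSimpleSystem_support (b : P.Base) :
    IsSimpleSystem (Set.range P.root) fun i : b.support => P.root i := by
  refine ⟨b.linearIndepOn_root, fun i => ⟨i, rfl⟩, ?_⟩
  rintro _ ⟨i, rfl⟩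
  obtain ⟨f, -, hf⟩ := b.exists_root_eq_sum_nat_or_neg i
  refine ⟨fun j => f j, ?_⟩
  rwa [← Finset.sum_coe_sort b.support (fun j => f j • P.root j)] at hf

-- The vector $r$ has inner product $1$ with all simple roots, so pairing with it is the height, and
-- its sign is the sign of the root.
include hEuc hsht hlng in
lemma exists_simpleData [FiniteDimensional ℝ V] (b : P.Base) :
    ∃ r, SimpleData (Set.range P.root) (P.root '' {i | b.IsPos i}) r
      (fun i : b.support => P.root i) νlng := by
  obtain ⟨r, hr⟩ := exists_inner_eq (β := fun i : b.support => (P.root i, (0 : ℝ)))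
    b.linearIndepOn_root (card_support b) fun _ => 1
  have hht : ∀ i, ⟪r, P.root i⟫ = b.height i := by
    intro i
    obtain ⟨f, -, -, hf⟩ := b.exists_root_eq_sum_int i
    rw [RootPairing.Base.height_eq_sum hf, hf, inner_sum]
    push_cast
    refine Finset.sum_congr rfl fun j hj => ?_
    rw [← Int.cast_smul_eq_zsmul ℝ, inner_smul_right, hr ⟨j, hj⟩, mul_one]
  obtain ⟨h1, h2⟩ := nu_root_eq_or hEuc hsht hlng
  refine ⟨r, isRootSet_range hEuc hsht hlng, isSimpleSystem_support b, ⟨fun α => ?_, ?_⟩, hr, ?_,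
    h1, fun p i j hi hp => b.induction_on_cartanMatrix p hi fun i j hpi hij => hp i j hpi ?_⟩
  · constructor
    · rintro ⟨i, hi, rfl⟩
      exact ⟨⟨i, rfl⟩, by rw [hht]; exact_mod_cast hi⟩
    · rintro ⟨⟨i, rfl⟩, h3⟩
      rw [hht] at h3
      exact ⟨i, by exact_mod_cast h3, rfl⟩
  · rintro _ ⟨i, rfl⟩
    rw [hht]
    exact_mod_cast b.height_ne_zero i
  · rintro _ ⟨i, rfl⟩
    exact h2 i
  · intro h0
    refine hij ?_
    have h3 := pairingIn_eq hEuc (j : ι) (i : ι)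
    rw [real_inner_comm, h0, zero_div] at h3
    exact_mod_cast h3

omit [Fintype ι] [P.IsReduced] [P.IsIrreducible] in
include hEuc in
lemma isTypeC_of_hasCartanC
    (h : HasCartanC fun i : b.support => P.root i) : IsTypeC P b := by
  rw [HasCartanC, card_support] at h
  obtain ⟨e, he⟩ := h
  refine ⟨e, fun i j => ?_⟩
  have h1 := (pairingIn_eq hEuc (i : ι) (j : ι)).trans (he i j).symm
  exact_mod_cast h1

omit [Fintype ι] [P.IsRootSystem] [P.IsReduced] [P.IsIrreducible] in
include hEuc in
lemma isTypeF_of_hasCartanF (h : HasCartanF fun i : b.support => P.root i) : IsTypeF P b := by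
  obtain ⟨e, he⟩ := h
  refine ⟨e, fun i j => ?_⟩
  have h1 := (pairingIn_eq hEuc (i : ι) (j : ι)).trans (he i j).symm
  exact_mod_cast h1

end RootPairing

/-! ### Characterization of the elements $\pi_b$ -/

section Weyl

variable {V : Type*} [NormedAddCommGroup V] [InnerProductSpace ℝ V] {R Rpos : Set V} {r : V}
  {κ : Type*} [Fintype κ] {v : κ → V} {νlng : ℕ} {W : Subgroup (V ≃ₗ[ℝ] V)}

/-- The group `W` acts on `R` by isometries and contains the reflections. -/
structure IsReflectionGroup (R : Set V) (W : Subgroup (V ≃ₗ[ℝ] V)) : Prop where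
  inner_map : ∀ w ∈ W, ∀ x y, ⟪w x, w y⟫ = ⟪x, y⟫
  map_mem : ∀ w ∈ W, ∀ α ∈ R, w α ∈ R
  exists_reflection : ∀ α ∈ R, ∃ s ∈ W, ∀ x, s x = x - (⟪x, α⟫ / nu α) • α

lemma IsReflectionGroup.extElt (hW : IsReflectionGroup R W) {c : V} (hc : c ∈ weights R)
    {w : V ≃ₗ[ℝ] V} (hw : w ∈ W) : IsAffineIsometry (extElt c w) ∧
      (∀ γ ∈ affRoots R, DoubleAffine.extElt c w γ ∈ affRoots R) ∧
      ∀ γ ∈ affRoots R, (DoubleAffine.extElt c w)⁻¹ γ ∈ affRoots R := by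
  have hnu : ∀ w ∈ W, ∀ x, nu (w x) = nu x := fun w hw x => by rw [nu, nu, hW.inner_map w hw]
  have hcα : ∀ α ∈ R, ∃ m : ℤ, ⟪α, c⟫ = nu α * m := fun α hα => by
    obtain ⟨m, hm⟩ := hc α hα
    refine ⟨m, ?_⟩
    by_cases h0 : α = 0
    · simp [h0, nu]
    · have := real_inner_self_pos.2 h0
      rw [← hm, nu, real_inner_comm]
      field_simp
  refine ⟨⟨c, w, hW.inner_map w hw, rfl⟩, fun γ hγ => ?_, fun γ hγ => ?_⟩
  · obtain ⟨j, hj⟩ := hγ.2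
    obtain ⟨m, hm⟩ := hcα _ (hW.map_mem w hw _ hγ.1)
    refine ⟨hW.map_mem w hw _ hγ.1, j - m, ?_⟩
    change γ.2 - ⟪w γ.1, c⟫ = nu (w γ.1) * _
    rw [hm, hj, hnu w hw]
    push_cast; ring
  · obtain ⟨j, hj⟩ := hγ.2
    obtain ⟨m, hm⟩ := hcα _ hγ.1
    refine ⟨hW.map_mem w⁻¹ (inv_mem hw) _ hγ.1, j + m, ?_⟩
    change γ.2 + ⟪γ.1, c⟫ = nu (w⁻¹ γ.1) * _
    rw [hm, hj, hnu _ (inv_mem hw)]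
    push_cast; ring

/-- The affine root $cu^{-1}(\alpha_i)$ is $[u^{-1}\alpha_i,-(\alpha_i,u(c))]$. Its positivity for
all $i$ says that $u(c)$ is antidominant and that $u^{-1}$ keeps positive the simple roots
orthogonal to $u(c)$, which is minimality of the length. -/
lemma isMinAntidominant_iff (h : SimpleData R Rpos r v νlng) (hW : IsReflectionGroup R W) {c : V}
    (hc : c ∈ weights R) {u : V ≃ₗ[ℝ] V} (hu : u ∈ W) :
    IsMinAntidominant W Rpos c u ↔ ∀ i, extElt c u⁻¹ (v i, 0) ∈ affPos R Rpos := by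
  have hadj : ∀ w ∈ W, ∀ x y, ⟪w⁻¹ x, y⟫ = ⟪x, w y⟫ := fun w hw x y => by
    rw [← hW.inner_map w hw, show w (w⁻¹ x) = x from w.apply_symm_apply x]
  have hiu : ∀ w : V ≃ₗ[ℝ] V, ∀ x, w⁻¹ (w x) = x := fun w x => w.symm_apply_apply x
  have hui : ∀ w : V ≃ₗ[ℝ] V, ∀ x, w (w⁻¹ x) = x := fun w x => w.apply_symm_apply x
  have hext : ∀ i, extElt c u⁻¹ (v i, 0) = (u⁻¹ (v i), -⟪v i, u c⟫) := fun i => by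
    change (u⁻¹ (v i), (0 : ℝ) - ⟪u⁻¹ (v i), c⟫) = _
    rw [hadj u hu, zero_sub]
  have hmem : ∀ i, extElt c u⁻¹ (v i, 0) ∈ affPos R Rpos ↔
      ⟪v i, u c⟫ < 0 ∨ ⟪v i, u c⟫ = 0 ∧ u⁻¹ (v i) ∈ Rpos := fun i => by
    have h1 := (hW.extElt hc (inv_mem hu)).2.1 (v i, 0) ⟨h.mem i, 0, by simp⟩
    rw [hext] at h1 ⊢
    change _ ∧ (0 < -_ ∨ -_ = (0 : ℝ) ∧ _) ↔ _
    rw [neg_pos, neg_eq_zero]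
    exact and_iff_right h1
  have hfin : ∀ w : V ≃ₗ[ℝ] V, {α | α ∈ Rpos ∧ -(w α) ∈ Rpos}.Finite := fun w =>
    h.root.finite.subset fun α hα => h.mem_of_pos hα.1
  constructor
  · rintro ⟨⟨-, hanti⟩, hmin⟩ i
    rw [hmem]
    have h1 : ⟪v i, u c⟫ ≤ 0 := by rw [real_inner_comm]; exact hanti _ (h.mem_pos i)
    rcases h1.lt_or_eq with h2 | h2
    · exact Or.inl h2
    refine Or.inr ⟨h2, ?_⟩
    by_contra hneg
    have hβ := h.neg_mem_pos (hW.map_mem _ (inv_mem hu) _ (h.mem i)) hneg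
    obtain ⟨s, hs, hsx⟩ := hW.exists_reflection _ (h.mem i)
    have hsc : s (u c) = u c := by rw [hsx, real_inner_comm, h2]; simp
    have hsimple : ∀ α ∈ Rpos, α ≠ v i → s α ∈ Rpos := fun α hα hne => by
      obtain ⟨m, hm⟩ := h.root.integral _ (h.mem i) α (h.mem_of_pos hα)
      have hν := h.root.nu_pos (h.mem i)
      have := h.reflect_mem_pos hα hne (by rw [hm, mul_comm])
      rwa [hsx, hm, mul_div_cancel_left₀ _ hν.ne']
    have hss : ∀ x, s (s x) = x := fun x => by
      have hν := h.root.nu_pos (h.mem i)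
      rw [hsx (s x), hsx x, inner_sub_left, inner_smul_left, inner_self_eq_nu]
      simp only [conj_trivial]
      rw [sub_sub, ← add_smul]
      have : ⟪x, v i⟫ / nu (v i) + (⟪x, v i⟫ - ⟪x, v i⟫ / nu (v i) * (2 * nu (v i))) / nu (v i) =
          0 := by field_simp; ring
      rw [this, zero_smul, sub_zero]
    -- The reflection $s$ fixes $u(c)$ and permutes the positive roots other than $v_i$. So $su$ is
    -- also admissible and has fewer inversions: it loses $-u^{-1}v_i$.
    have hsub : {α | α ∈ Rpos ∧ -((s * u) α) ∈ Rpos} ⊂ {α | α ∈ Rpos ∧ -(u α) ∈ Rpos} := by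
      refine ⟨fun α ⟨hα, hα'⟩ => ⟨hα, ?_⟩, fun hsub => ?_⟩
      · have h3 : s (-(s * u) α) = -(u α) := by
          rw [map_neg]
          exact congrArg _ (hss _)
        rw [← h3]
        refine hsimple _ hα' fun h4 => hneg ?_
        rw [h4, hsx, inner_self_eq_nu, mul_div_assoc, div_self (h.root.nu_pos (h.mem i)).ne',
          mul_one, two_smul, sub_add_cancel_left, neg_inj] at h3
        rw [h3, hiu]
        exact hα
      · have h3 := (hsub (show -(u⁻¹ (v i)) ∈ {α | α ∈ Rpos ∧ -(u α) ∈ Rpos} from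
          ⟨hβ, by rw [map_neg, hui, neg_neg]; exact h.mem_pos i⟩)).2
        refine h.neg_notMem_pos (h.mem_pos i) ?_
        have h4 : -((s * u) (-(u⁻¹ (v i)))) = -(v i) := by
          rw [map_neg, neg_neg]
          change s (u (u⁻¹ (v i))) = _
          rw [hui, hsx, inner_self_eq_nu, mul_div_assoc, div_self (h.root.nu_pos (h.mem i)).ne',
            mul_one, two_smul, sub_add_cancel_left]
        rwa [h4] at h3
    exact absurd (hmin _ (mul_mem hs hu) fun α hα => by
      change ⟪s (u c), α⟫ ≤ 0
      rw [hsc]; exact hanti α hα) (not_le.2 (Set.ncard_lt_ncard hsub (hfin u)))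
  · intro hall
    simp only [hmem] at hall
    have hle : ∀ i, ⟪u c, v i⟫ ≤ 0 := fun i => by
      rw [real_inner_comm]
      rcases hall i with h1 | h1
      · exact h1.le
      · exact h1.1.le
    have hpos : ∀ α ∈ Rpos, ⟪u c, α⟫ = 0 → u⁻¹ α ∈ Rpos := by
      intro α hα h0
      have h1 : u⁻¹ α ∈ R := hW.map_mem _ (inv_mem hu) _ (h.mem_of_pos hα)
      refine (h.pos.mem_iff _).2 ⟨h1, lt_of_le_of_ne ?_ (h.pos.inner_ne _ h1).symm⟩
      obtain ⟨m, rfl⟩ := h.exists_nat hα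
      rw [inner_sum] at h0
      have h2 : ∀ i, ⟪u c, m i • v i⟫ ≤ 0 := fun i => by
        rw [← Nat.cast_smul_eq_nsmul ℝ, inner_smul_right]
        exact mul_nonpos_of_nonneg_of_nonpos (Nat.cast_nonneg _) (hle i)
      have h3 := (Finset.sum_eq_zero_iff_of_nonpos fun i _ => h2 i).1 h0
      rw [map_sum, inner_sum]
      refine Finset.sum_nonneg fun i hi => ?_
      have h4 := h3 i hi
      rw [← Nat.cast_smul_eq_nsmul ℝ, inner_smul_right, mul_eq_zero] at h4
      rw [← Nat.cast_smul_eq_nsmul ℝ, map_smul, inner_smul_right]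
      rcases h4 with h4 | h4
      · rw [h4, zero_mul]
      · refine mul_nonneg (Nat.cast_nonneg _) ?_
        rw [real_inner_comm] at h4
        exact ((h.pos.mem_iff _).1 ((hall i).resolve_left (by rw [h4]; exact lt_irrefl _)).2).2.le
    -- An inversion $\alpha$ of $u$ has $(c,\alpha)>0$, so it is an inversion of every $w$ with
    -- $w(c)$ antidominant.
    refine ⟨⟨hu, fun α hα => h.inner_nonpos hle hα⟩, fun w hw hanti =>
      Set.ncard_le_ncard (fun α ⟨hα, hα'⟩ => ⟨hα, ?_⟩) (hfin w)⟩
    have h1 : ⟪u c, -(u α)⟫ < 0 := lt_of_le_of_ne (h.inner_nonpos hle hα') fun h0 =>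
      h.neg_notMem_pos hα (by simpa [hiu] using hpos _ hα' h0)
    rw [inner_neg_right, hW.inner_map u hu] at h1
    refine h.neg_mem_pos (hW.map_mem w hw _ (h.mem_of_pos hα)) fun h2 => ?_
    have h3 := hanti _ h2
    rw [hW.inner_map w hw] at h3
    linarith

end Weyl

/-! ### The values of $\rho_k$ at simple roots -/

section Rho

variable {V : Type*} [NormedAddCommGroup V] [InnerProductSpace ℝ V] {R Rpos : Set V} {r : V}
  {κ : Type*} [Fintype κ] {v : κ → V} {νlng : ℕ} {q : ℝ} {k : ℝ → ℂ}

/-- The reflection in $v_i$ permutes the other positive roots, preserves their lengths and changes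
the sign of their inner products with $v_i$. Their contributions cancel, and only $v_i$ itself
remains. -/
lemma SimpleData.rho_apply (h : SimpleData R Rpos r v νlng) (k : ℝ → ℂ) (i : κ) :
    rho k Rpos (v i) = nu (v i) * k (nu (v i)) := by
  classical
  have hfin : Rpos.Finite := h.root.finite.subset fun α hα => h.mem_of_pos hα
  have hi := h.root.nu_pos (h.mem i)
  rw [rho, finsum_mem_eq_finite_toFinset_sum _ hfin]
  simp only [smul_apply, sum_apply, ContinuousLinearMap.coe_comp,
    Function.comp_apply, innerSL_apply_apply, Complex.ofRealCLM_apply, smul_eq_mul]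
  rw [← Finset.add_sum_erase _ _ (hfin.mem_toFinset.2 (h.mem_pos i))]
  let s : V → V := fun x => x - (⟪x, v i⟫ / nu (v i)) • v i
  have hsν : ∀ x, nu (s x) = nu x := fun x =>
    nu_reflect (by rw [div_mul_cancel₀ _ hi.ne'])
  have hsin : ∀ x, ⟪s x, v i⟫ = -⟪x, v i⟫ := fun x => by
    simp only [s, inner_sub_left, inner_smul_left, inner_self_eq_nu, conj_trivial]
    field_simp; ring
  have hss : ∀ x, s (s x) = x := fun x => by
    change s x - (⟪s x, v i⟫ / nu (v i)) • v i = x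
    rw [hsin, neg_div, neg_smul, sub_neg_eq_add]
    exact sub_add_cancel _ _
  have hmem : ∀ α ∈ hfin.toFinset.erase (v i), s α ∈ hfin.toFinset.erase (v i) := by
    intro α hα
    rw [Finset.mem_erase, hfin.mem_toFinset] at hα ⊢
    obtain ⟨m, hm⟩ := h.root.integral _ (h.mem i) α (h.mem_of_pos hα.2)
    have h1 := h.reflect_mem_pos hα.2 hα.1 (by rw [hm, mul_comm])
    have h2 : s α = α - (m : ℝ) • v i := by
      change α - _ • v i = _
      rw [hm, mul_div_cancel_left₀ _ hi.ne']
    refine ⟨fun h3 => ?_, h2 ▸ h1⟩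
    have h4 := hss α
    rw [h3] at h4
    refine h.ne_neg hα.2 (h.mem_pos i) ?_
    rw [← h4]
    change v i - _ • v i = _
    rw [inner_self_eq_nu, mul_div_assoc, div_self hi.ne', mul_one, two_smul, sub_add_cancel_left]
  have hsum : ∑ α ∈ hfin.toFinset.erase (v i), k (nu α) * ((⟪α, v i⟫ : ℝ) : ℂ) = 0 := by
    have h1 : ∑ α ∈ hfin.toFinset.erase (v i), k (nu α) * ((⟪α, v i⟫ : ℝ) : ℂ) =
        ∑ α ∈ hfin.toFinset.erase (v i), -(k (nu α) * ((⟪α, v i⟫ : ℝ) : ℂ)) := by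
      refine Finset.sum_bij' (fun α _ => s α) (fun α _ => s α) hmem hmem (fun α _ => hss α)
        (fun α _ => hss α) fun α _ => ?_
      rw [hsν, hsin]; push_cast; ring
    rw [Finset.sum_neg_distrib] at h1
    exact self_eq_neg.1 h1
  rw [hsum, inner_self_eq_nu]
  push_cast
  ring

lemma X_zero_apply (q : ℝ) (α : V) (x : V →L[ℝ] ℂ) : X q (α, 0) x = (q : ℂ) ^ x α := by
  simp [X, affEval]

lemma X_neg_apply (q : ℝ) (γ : V × ℝ) (x : V →L[ℝ] ℂ) : X q γ (-x) = X q (-γ.1, γ.2) x := by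
  simp [X, affEval]

lemma SimpleData.X_rho (h : SimpleData R Rpos r v νlng) (q : ℝ) (k : ℝ → ℂ) (i : κ) :
    X q (v i, 0) (rho k Rpos) = tPar q k (v i, 0) := by
  rw [X_zero_apply, h.rho_apply]; rfl

end Rho

/-! ### Poles and residues on the orbit of $-\rho_k$ -/

section Spherical

variable {V : Type*} [NormedAddCommGroup V] [InnerProductSpace ℝ V] {R Rpos : Set V} {r : V}
  {κ : Type*} [Fintype κ] {v : κ → V} {νlng : ℕ} {q : ℝ} {k : ℝ → ℂ} {ξ : V →L[ℝ] ℂ}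
  {W : Subgroup (V ≃ₗ[ℝ] V)}

/-- The point `-ρ_k`, under the assumptions on the parameters. -/
structure SphericalData (R Rpos : Set V) (r : V) (v : κ → V) (νlng : ℕ) (q : ℝ) (k : ℝ → ℂ)
    (ξ : V →L[ℝ] ℂ) : Prop where
  simple : SimpleData R Rpos r v νlng
  q_pos : 0 < q
  q_lt_one : q < 1
  generic : ∀ m l₁ l₂ : ℤ, m ≠ 0 → (q : ℂ) ^ m ≠ tOf q k 1 ^ l₁ * tOf q k νlng ^ l₂
  point : ξ = -rho k Rpos
  numerator : ∀ γ ∈ affPos R Rpos, 1 - X q γ ξ ≠ 0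
  opposite : ∀ α ∈ Rpos, 1 - (tPar q k (α, 0))⁻¹ * X q (α, 0) ξ ≠ 0
  short : tOf q k 1 ^ νlng ≠ 1
  typeC : HasCartanC v → ∀ j, 1 ≤ j → j < Fintype.card κ → tOf q k 1 ^ j ≠ -1
  typeF : HasCartanF v → tOf q k 1 ^ 4 ≠ 1 ∧ tOf q k νlng * tOf q k 1 ^ 3 ≠ -1

namespace SphericalData

variable (h : SphericalData R Rpos r v νlng q k ξ)
include h

lemma isHalf : IsHalf (affRoots R) (affPos R Rpos) := isHalf_affPos h.simple.root h.simple.pos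

lemma simple_mem (i : κ) : (v i, (0 : ℝ)) ∈ affPos R Rpos :=
  ⟨⟨h.simple.mem i, 0, by simp⟩, Or.inr ⟨rfl, h.simple.mem_pos i⟩⟩

lemma X_eq (γ : V × ℝ) : X q γ ξ = X q (-γ.1, γ.2) (rho k Rpos) := by
  rw [h.point, X_neg_apply]

lemma pole (i : κ) : tPar q k (v i, 0) * X q (v i, 0) ξ = 1 := by
  have h1 : ((-v i, 0) : V × ℝ) = -(v i, 0) := by simp
  rw [h.X_eq, h1, X_neg h.q_pos, h.simple.X_rho, mul_inv_cancel₀ (tPar_ne_zero h.q_pos k _)]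

lemma specialization : Specialization R v νlng (fun α => X q (α, 0) (rho k Rpos)) (tOf q k 1)
    (tOf q k νlng) where
  map_add x y := by
    rw [← X_add h.q_pos]; simp
  ne_zero x := X_ne_zero h.q_pos _ _
  ne_one α hα h1 := by
    have h2 : X q (-α, 0) ξ = 1 := by rw [h.X_eq]; simpa using h1
    have h3 : (-α, (0 : ℝ)) ∈ affRoots R := ⟨h.simple.root.neg_mem hα, 0, by simp⟩
    rcases h.isHalf.total _ h3 with h4 | h4
    · exact h.numerator _ h4 (by rw [h2, sub_self])
    · exact h.numerator _ h4 (by rw [X_neg h.q_pos, h2, inv_one, sub_self])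
  short i hi := by rw [h.simple.X_rho, tPar, hi]
  long i hi := by rw [h.simple.X_rho, tPar, hi]

/-- The binomials that vanish at `-ρ_k` are those of the simple roots. -/
lemma eq_simple_of_pole {δ : V × ℝ} (hδ : δ ∈ affRoots R) (hp : tPar q k δ * X q δ ξ = 1) :
    ∃ i, δ = (v i, 0) := by
  obtain ⟨m, hm⟩ : ∃ m : κ → ℤ, δ.1 = ∑ i, m i • v i := by
    obtain ⟨m, hm | hm⟩ := h.simple.simple.2.2 δ.1 hδ.1
    · exact ⟨fun i => m i, by simpa using hm⟩
    · exact ⟨fun i => -m i, by simpa using hm⟩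
  -- By genericity $\delta$ is a combination of the $[v_i,0]$, so its affine component is $0$ and
  -- only roots of the finite system have to be examined.
  obtain ⟨h1, -⟩ := eq_sum_of_pole h.simple.root h.simple.nu_eq h.q_pos h.generic
    (β := fun i => (v i, (0 : ℝ))) (fun i => (h.simple_mem i).1) h.pole hδ hp hm
  have h2 : δ.2 = 0 := by rw [h1, Prod.snd_sum]; simp
  have h3 : δ = (δ.1, 0) := Prod.ext rfl h2
  have hX : X q δ ξ = (X q (δ.1, 0) (rho k Rpos))⁻¹ := by
    rw [h.X_eq, ← X_neg h.q_pos, h2]; simp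
  have hT : X q (δ.1, 0) (rho k Rpos) = tOf q k (nu δ.1) := by
    rw [hX, mul_inv_eq_one₀ (X_ne_zero h.q_pos _ _)] at hp
    exact hp.symm
  by_cases hpos : δ.1 ∈ Rpos
  · obtain ⟨i, hi⟩ := h.specialization.exists_eq_simple h.simple h.short h.typeC h.typeF hpos
      (fun h4 => by rw [hT, h4]) fun h4 => by rw [hT, h4]
    exact ⟨i, by rw [h3, hi]⟩
  -- A negative root is excluded by $t_\alpha q^{(\alpha,\rho_k)}\ne1$.
  · refine absurd ?_ (h.opposite _ (h.simple.neg_mem_pos hδ.1 hpos))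
    have h4 : ((-δ.1, 0) : V × ℝ) = -δ := by rw [h3]; simp
    rw [h4, tPar_neg, X_neg h.q_pos, ← mul_inv, hp, inv_one, sub_self]


lemma mem_closure : ξ ∈ closure (regularPts q k R) :=
  mem_closure_regularPts h.q_pos h.q_lt_one k h.simple.root.finite h.simple.pos.inner_ne ξ

lemma admissible : Admissible q (affPos R Rpos) :=
  admissible_affPos h.simple.root h.q_pos h.q_lt_one

lemma vanishing_point : vanishing q k (affPos R Rpos) ξ = Set.range fun i => (v i, (0 : ℝ)) := by
  ext γ
  constructor
  · rintro ⟨hγ, h1⟩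
    obtain ⟨i, hi⟩ := h.eq_simple_of_pole hγ.1 (sub_eq_zero.1 h1).symm
    exact ⟨i, hi.symm⟩
  · rintro ⟨i, rfl⟩
    exact ⟨h.simple_mem i, by rw [h.pole, sub_self]⟩

lemma injective_extElt (c : V) (w : V ≃ₗ[ℝ] V) :
    Function.Injective fun i => extElt c w (v i, (0 : ℝ)) := fun i j hij => by
  have := (extElt c w).injective hij
  exact h.simple.injective (Prod.ext_iff.1 this).1

variable [FiniteDimensional ℝ V]

/-- The residue at `-ρ_k`. -/
lemma exists_residue [DecidableEq κ] (hcard : Fintype.card κ = Module.finrank ℝ V) :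
    ∃ r₀ : ℂ,
      HasProd (fun γ : affPos R Rpos => deletedFactor q k (Set.range fun i => (v i, (0 : ℝ))) ξ γ)
        r₀ ∧
      HasMuResidue q k (mu q k (affPos R Rpos)) (fun i => (v i, (0 : ℝ))) ξ r₀ :=
  ⟨_, (h.admissible.multipliable_deletedFactor h.q_pos k _ ξ).hasProd,
    h.admissible.hasMuResidue h.q_pos h.q_lt_one k h.simple.simple.1 hcard ξ h.vanishing_point
      (h.admissible.multipliable_deletedFactor h.q_pos k _ ξ).hasProd⟩

variable (hW : IsReflectionGroup R W)
include hW

variable {c : V} (hc : c ∈ weights R) {w : V ≃ₗ[ℝ] V} (hw : w ∈ W)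
include hc hw

/-- The value of $X_\gamma$ at the image point is that of $X_{g^{-1}\gamma}$ at $-\rho_k$, where the
only poles are the simple roots. -/
lemma vanishing_actPt : vanishing q k (affPos R Rpos) (actPt (extElt c w) ξ) =
    {γ | γ ∈ affPos R Rpos ∧ ∃ i, γ = extElt c w (v i, 0)} := by
  obtain ⟨hg, -, hg'⟩ := hW.extElt hc hw
  ext γ
  refine and_congr_right fun hγ => ?_
  rw [sub_eq_zero, hg.X_actPt', ← hg.inv.tPar_map]
  constructor
  · intro h1
    obtain ⟨i, hi⟩ := h.eq_simple_of_pole (hg' _ hγ.1) h1.symm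
    exact ⟨i, by rw [← hi]; exact ((extElt c w).apply_symm_apply γ).symm⟩
  · rintro ⟨i, rfl⟩
    rw [show (extElt c w)⁻¹ (extElt c w (v i, 0)) = (v i, 0) from
      (extElt c w).symm_apply_apply _, h.pole]

lemma vanishing_of_min (hm : IsMinAntidominant W Rpos c w⁻¹) :
    vanishing q k (affPos R Rpos) (actPt (extElt c w) ξ) =
      Set.range fun i => extElt c w (v i, (0 : ℝ)) := by
  rw [isMinAntidominant_iff h.simple hW hc (inv_mem hw), inv_inv] at hm
  rw [h.vanishing_actPt hW hc hw]
  ext γ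
  constructor
  · rintro ⟨-, i, rfl⟩; exact ⟨i, rfl⟩
  · rintro ⟨i, rfl⟩; exact ⟨hm i, i, rfl⟩

lemma encard_vanishing_of_min (hm : IsMinAntidominant W Rpos c w⁻¹) :
    (vanishing q k (affPos R Rpos) (actPt (extElt c w) ξ)).encard = Fintype.card κ := by
  rw [h.vanishing_of_min hW hc hw hm, ← Set.image_univ,
    (h.injective_extElt c w).encard_image, Set.encard_univ, ENat.card_eq_coe_fintype_card]

lemma encard_vanishing_lt (hm : ¬ IsMinAntidominant W Rpos c w⁻¹) :
    (vanishing q k (affPos R Rpos) (actPt (extElt c w) ξ)).encard < Fintype.card κ := by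
  rw [isMinAntidominant_iff h.simple hW hc (inv_mem hw), inv_inv] at hm
  push Not at hm
  obtain ⟨i, hi⟩ := hm
  have h1 : (Set.range fun i => extElt c w (v i, (0 : ℝ))).encard = Fintype.card κ := by
    rw [← Set.image_univ, (h.injective_extElt c w).encard_image, Set.encard_univ,
      ENat.card_eq_coe_fintype_card]
  rw [← h1, h.vanishing_actPt hW hc hw]
  refine Set.Finite.encard_lt_encard ((Set.finite_range
    fun i => extElt c w (v i, (0 : ℝ))).subset ?_) ⟨?_, fun hsub => hi ?_⟩
  · rintro γ ⟨-, i, rfl⟩; exact ⟨i, rfl⟩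
  · rintro γ ⟨-, i, rfl⟩; exact ⟨i, rfl⟩
  · exact (hsub ⟨i, rfl⟩).1

/-- A zero of $1-t^{-1}X_\gamma$ would make $-\gamma$ a pole, hence a simple root, although $\gamma$
is positive. -/
lemma hasValueAt_mu_actPt_prod : HasValueAt (regularPts q k R)
    (fun x => mu q k (affPos R Rpos) (actPt (extElt c w) x) / mu q k (affPos R Rpos) x) ξ
    (∏ᶠ γ ∈ lambdaSet (affPos R Rpos) (extElt c w),
      ((tPar q k γ)⁻¹ - X q γ ξ) / (1 - (tPar q k γ)⁻¹ * X q γ ξ)) := by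
  obtain ⟨hg, hg1, hg2⟩ := hW.extElt hc hw
  refine hasValueAt_mu_actPt h.q_pos h.isHalf h.admissible hg hg1 hg2
    (finite_lambdaSet h.simple.root le_rfl hg) le_rfl h.mem_closure fun γ hγ h1 => ?_
  obtain ⟨i, hi⟩ := h.eq_simple_of_pole (h.simple.root.neg_mem_aff hγ.1.1) (by
    rw [tPar_neg, X_neg h.q_pos, ← inv_inv (tPar q k γ), ← mul_inv, ← sub_eq_zero.1 h1, inv_one])
  exact h.isHalf.disjoint _ hγ.1 (hi ▸ h.simple_mem i)

/-- Some simple root is made negative, so it lies in $\Lambda(g)$, and its factor $t^{-1}-X$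
vanishes at $-\rho_k$. -/
lemma hasValueAt_mu_actPt_zero (hm : ¬ IsMinAntidominant W Rpos c w⁻¹) :
    HasValueAt (regularPts q k R)
      (fun x => mu q k (affPos R Rpos) (actPt (extElt c w) x) / mu q k (affPos R Rpos) x) ξ 0 := by
  obtain ⟨hg, hg1, -⟩ := hW.extElt hc hw
  have h1 := h.hasValueAt_mu_actPt_prod hW hc hw
  rw [isMinAntidominant_iff h.simple hW hc (inv_mem hw), inv_inv] at hm
  push Not at hm
  obtain ⟨i, hi⟩ := hm
  have hfin := finite_lambdaSet h.simple.root (le_refl (affPos R Rpos)) hg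
  have hmem : (v i, (0 : ℝ)) ∈ lambdaSet (affPos R Rpos) (extElt c w) :=
    ⟨h.simple_mem i, (h.isHalf.total _ (hg1 _ (h.simple_mem i).1)).resolve_left hi⟩
  rw [finprod_mem_eq_finite_toFinset_prod _ hfin,
    Finset.prod_eq_zero (hfin.mem_toFinset.2 hmem)] at h1
  · exact h1
  · rw [eq_inv_of_mul_eq_one_right (h.pole i), sub_self, zero_div]

-- Passing from $[\alpha,m]$ to $[-\alpha,m]$ turns values at $-\rho_k$ into values at $\rho_k$, and
-- $t^{-1}-X=t^{-1}(1-tX)$ splits off the factors $t^{-1}$.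
omit [FiniteDimensional ℝ V] in
lemma prod_lambdaSet_eq :
    ∏ᶠ γ ∈ lambdaSet (affPos R Rpos) (extElt c w),
      ((tPar q k γ)⁻¹ - X q γ ξ) / (1 - (tPar q k γ)⁻¹ * X q γ ξ) =
    (∏ᶠ γ ∈ lambdaSet (affPos R Rpos) (extElt c w), tPar q k γ)⁻¹ *
      ∏ᶠ γ ∈ lambdaSet' (affPos R Rpos) (extElt c w),
        (1 - tPar q k γ * X q γ (rho k Rpos)) /
          (1 - (tPar q k γ)⁻¹ * X q γ (rho k Rpos)) := by
  obtain ⟨hg, -, -⟩ := hW.extElt hc hw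
  have hfin := finite_lambdaSet h.simple.root (le_refl (affPos R Rpos)) hg
  let σ : V × ℝ → V × ℝ := fun γ => (-γ.1, γ.2)
  have hσσ : ∀ γ, σ (σ γ) = γ := fun γ => by simp [σ]
  have hσ : Set.BijOn σ (lambdaSet (affPos R Rpos) (extElt c w))
      (lambdaSet' (affPos R Rpos) (extElt c w)) := by
    refine ⟨fun γ hγ => ?_, fun γ _ δ _ hγδ => ?_, fun γ hγ => ⟨σ γ, hγ, hσσ γ⟩⟩
    · change σ (σ γ) ∈ lambdaSet _ _
      rwa [hσσ]
    · rw [← hσσ γ, hγδ, hσσ]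
  have h1 : ∏ᶠ γ ∈ lambdaSet (affPos R Rpos) (extElt c w), (1 - tPar q k γ * X q γ ξ) /
      (1 - (tPar q k γ)⁻¹ * X q γ ξ) = ∏ᶠ γ ∈ lambdaSet' (affPos R Rpos) (extElt c w),
        (1 - tPar q k γ * X q γ (rho k Rpos)) / (1 - (tPar q k γ)⁻¹ * X q γ (rho k Rpos)) := by
    refine finprod_mem_eq_of_bijOn σ hσ fun γ _ => ?_
    have ht : tPar q k (σ γ) = tPar q k γ := by simp [σ, tPar, nu_neg]
    rw [h.X_eq, ht]
  rw [← h1, finprod_mem_eq_finite_toFinset_prod _ hfin, finprod_mem_eq_finite_toFinset_prod _ hfin,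
    finprod_mem_eq_finite_toFinset_prod _ hfin, ← Finset.prod_inv_distrib,
    ← Finset.prod_mul_distrib]
  refine Finset.prod_congr rfl fun γ _ => ?_
  have := tPar_ne_zero h.q_pos k γ
  rw [mul_div_assoc', mul_sub, mul_one, inv_mul_cancel_left₀ this]

/-- Minimality keeps all simple roots positive, so $\Lambda(g)$ contains none of the poles at
$-\rho_k$ and the deleted binomials correspond to each other under $g$. -/
lemma hasMuResidue_actPt [DecidableEq κ] (hcard : Fintype.card κ = Module.finrank ℝ V)
    (hm : IsMinAntidominant W Rpos c w⁻¹) {r₀ : ℂ}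
    (hr : HasProd (fun γ : affPos R Rpos =>
      deletedFactor q k (Set.range fun i => (v i, (0 : ℝ))) ξ γ) r₀) :
    HasMuResidue q k (mu q k (affPos R Rpos)) (fun i => extElt c w (v i, (0 : ℝ)))
      (actPt (extElt c w) ξ)
      ((∏ᶠ γ ∈ lambdaSet (affPos R Rpos) (extElt c w),
        ((tPar q k γ)⁻¹ - X q γ ξ) / (1 - (tPar q k γ)⁻¹ * X q γ ξ)) * r₀) := by
  obtain ⟨hg, hg1, hg2⟩ := hW.extElt hc hw
  have hmin := (isMinAntidominant_iff h.simple hW hc (inv_mem hw)).1 hm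
  rw [inv_inv] at hmin
  refine h.admissible.hasMuResidue h.q_pos h.q_lt_one k
    (hg.linearIndependent_fst h.simple.simple.1) hcard _ (h.vanishing_of_min hW hc hw hm) ?_
  have himg : (Set.range fun i => extElt c w (v i, (0 : ℝ))) =
      extElt c w '' Set.range fun i => (v i, (0 : ℝ)) := by
    rw [← Set.range_comp]; rfl
  rw [himg]
  refine hasProd_deletedFactor_actPt h.q_pos h.isHalf hg hg1 hg2
    (finite_lambdaSet h.simple.root le_rfl hg) ?_ ?_ (fun γ hγ h1 => ?_) hr
  · rintro _ ⟨i, rfl⟩; exact h.simple_mem i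
  · rw [← himg]; rintro _ ⟨i, rfl⟩; exact hmin i
  · obtain ⟨i, rfl⟩ := h.eq_simple_of_pole hγ.1.1 (sub_eq_zero.1 h1).symm
    exact h.isHalf.disjoint _ (hmin i) hγ.2

end SphericalData

end Spherical

/-! ### The Weyl group as a group of isometries -/

section RootPairing

variable {V N ι : Type*} [NormedAddCommGroup V] [InnerProductSpace ℝ V] [AddCommGroup N]
  [Module ℝ N] {P : RootPairing ι ℝ V N}

lemma isReflectionGroup_closure
    (hEuc : ∀ (i : ι) (x : V), P.coroot' i x = 2 * ⟪x, P.root i⟫ / ⟪P.root i, P.root i⟫)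
    (hR : IsRootSet (Set.range P.root)) :
    IsReflectionGroup (Set.range P.root) (Subgroup.closure (Set.range P.reflection)) := by
  have key : ∀ w ∈ Subgroup.closure (Set.range P.reflection),
      (∀ x y, ⟪w x, w y⟫ = ⟪x, y⟫) ∧ (∀ α ∈ Set.range P.root, w α ∈ Set.range P.root) ∧
        ∀ α ∈ Set.range P.root, w⁻¹ α ∈ Set.range P.root := by
    intro w hw
    induction hw using Subgroup.closure_induction with
    | mem w hw =>
      obtain ⟨i, rfl⟩ := hw
      refine ⟨fun x y => ?_, ?_, ?_⟩
      · rw [reflection_eq hEuc, reflection_eq hEuc, inner_reflection (hR.ne_zero _ ⟨i, rfl⟩)]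
      · rintro _ ⟨j, rfl⟩
        exact ⟨P.reflectionPerm i j, P.root_reflectionPerm i j⟩
      · rintro _ ⟨j, rfl⟩
        rw [P.reflection_inv]
        exact ⟨P.reflectionPerm i j, P.root_reflectionPerm i j⟩
    | one => exact ⟨fun _ _ => rfl, fun _ h => h, fun _ h => h⟩
    | mul w w' _ _ hw hw' =>
      refine ⟨fun x y => (hw.1 _ _).trans (hw'.1 _ _), fun α hα => hw.2.1 _ (hw'.2.1 _ hα),
        fun α hα => ?_⟩
      rw [mul_inv_rev]
      exact hw'.2.2 _ (hw.2.2 _ hα)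
    | inv w _ hw =>
      refine ⟨fun x y => ?_, hw.2.2, fun α hα => by rw [inv_inv]; exact hw.2.1 _ hα⟩
      rw [← hw.1]
      exact congrArg₂ _ (w.apply_symm_apply x) (w.apply_symm_apply y)
  refine ⟨fun w hw => (key w hw).1, fun w hw => (key w hw).2.1, ?_⟩
  rintro _ ⟨i, rfl⟩
  exact ⟨P.reflection i, Subgroup.subset_closure ⟨i, rfl⟩, reflection_eq hEuc i⟩

end RootPairing

/-! ### Independence of the choice of positivity -/

section Positivity

variable {V : Type*} [NormedAddCommGroup V] [InnerProductSpace ℝ V] {Φ Ψ : Set (V × ℝ)} {q : ℝ}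

lemma one_sub_X_ne_zero_of_half (hq : 0 < q) (ht : ∀ γ ∈ Φ, γ ∈ Ψ ∨ -γ ∈ Ψ) {ξ : V →L[ℝ] ℂ}
    (h : ∀ γ ∈ Ψ, 1 - X q γ ξ ≠ 0) : ∀ γ ∈ Φ, X q γ ξ ≠ 1 := by
  intro γ hγ h1
  rcases ht γ hγ with h2 | h2
  · exact h γ h2 (by rw [h1, sub_self])
  · exact h _ h2 (by rw [X_neg hq, h1, inv_one, sub_self])

end Positivity

end DoubleAffine

end

/-! ### The theorem -/

open DoubleAffine

theorem mainTheorem6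
    {V N ι : Type*} [NormedAddCommGroup V] [InnerProductSpace ℝ V] [FiniteDimensional ℝ V]
    [AddCommGroup N] [Module ℝ N] [Fintype ι] [DecidableEq ι]
    -- a reduced irreducible root system in the Euclidean space `V`, with a base
    (P : RootPairing ι ℝ V N) [P.IsRootSystem] [P.IsCrystallographic] [P.IsReduced]
    [P.IsIrreducible] (b : P.Base)
    -- the coroots are `2 α / (α, α)`
    (hEuc : ∀ (i : ι) (v : V),
      P.coroot' i v = 2 * inner ℝ v (P.root i) / inner ℝ (P.root i) (P.root i))
    -- the twisted normalization: `ν = 1` for short roots; `νlng = 1` if all roots are short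
    (hsht : IsLeast (Set.range fun i => DoubleAffine.nu (P.root i)) 1)
    (νlng : ℕ) (hlng : IsGreatest (Set.range fun i => DoubleAffine.nu (P.root i)) (νlng : ℝ))
    (n : ℕ) (hn : n = Module.finrank ℝ V)
    (R Rpos : Set V) (hR : R = Set.range P.root) (hRpos : Rpos = P.root '' {i | b.IsPos i})
    (W : Subgroup (V ≃ₗ[ℝ] V)) (hW : W = Subgroup.closure (Set.range P.reflection))
    (Rt Rtpos : Set (V × ℝ)) (hRt : Rt = DoubleAffine.affRoots R)
    (hRtpos : Rtpos = DoubleAffine.affPos R Rpos)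
    -- the parameters
    (q : ℝ) (hq0 : 0 < q) (hq1 : q < 1) (k : ℝ → ℂ)
    (tsht tlng : ℂ) (htsht : tsht = DoubleAffine.tOf q k 1)
    (htlng : tlng = DoubleAffine.tOf q k νlng)
    (hgen : ∀ m l₁ l₂ : ℤ, m ≠ 0 → (q : ℂ) ^ m ≠ tsht ^ l₁ * tlng ^ l₂) :
    -- convergence of the product `μ`
    (∀ x : V →L[ℝ] ℂ, Multipliable fun γ : Rtpos => DoubleAffine.muFactor q k x γ) ∧
    -- the non-vanishing of the numerator does not depend on the choice of the positivity
    (∀ (ξ : V →L[ℝ] ℂ) (Ψ : Set (V × ℝ)), Ψ ⊆ Rt → (∀ γ ∈ Rt, γ ∈ Ψ ∨ -γ ∈ Ψ) →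
      ((∀ γ ∈ Rtpos, 1 - DoubleAffine.X q γ ξ ≠ 0) ↔ ∀ γ ∈ Ψ, 1 - DoubleAffine.X q γ ξ ≠ 0)) ∧
    -- (i) and the first half of (iv)
    (∀ ξ : V →L[ℝ] ℂ, ξ = -DoubleAffine.rho k Rpos →
      (∀ γ ∈ Rtpos, 1 - DoubleAffine.X q γ ξ ≠ 0) →
      (∀ α ∈ Rpos, 1 - (DoubleAffine.tPar q k (α, 0))⁻¹ * DoubleAffine.X q (α, 0) ξ ≠ 0) →
      tsht ^ νlng ≠ 1 →
      (DoubleAffine.IsTypeC P b → ∀ j : ℕ, 1 ≤ j → j < n → tsht ^ j ≠ -1) →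
      (DoubleAffine.IsTypeF P b → tsht ^ 4 ≠ 1 ∧ tlng * tsht ^ 3 ≠ -1) →
      (∀ c ∈ DoubleAffine.weights R, ∀ w ∈ W,
        ((DoubleAffine.vanishing q k Rtpos
            (DoubleAffine.actPt (DoubleAffine.extElt c w) ξ)).encard = n ↔
          DoubleAffine.IsMinAntidominant W Rpos c w⁻¹) ∧
        (DoubleAffine.IsMinAntidominant W Rpos c w⁻¹ →
          DoubleAffine.vanishing q k Rtpos (DoubleAffine.actPt (DoubleAffine.extElt c w) ξ) =
            (fun i => DoubleAffine.extElt c w (P.root i, 0)) '' (b.support : Set ι)) ∧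
        (¬ DoubleAffine.IsMinAntidominant W Rpos c w⁻¹ →
          (DoubleAffine.vanishing q k Rtpos
            (DoubleAffine.actPt (DoubleAffine.extElt c w) ξ)).encard < n ∧
          DoubleAffine.HasValueAt (DoubleAffine.regularPts q k R)
            (fun x => DoubleAffine.mu q k Rtpos (DoubleAffine.actPt (DoubleAffine.extElt c w) x) /
              DoubleAffine.mu q k Rtpos x) ξ 0)) ∧
      (∃ r₀ : ℂ,
        HasProd (fun γ : Rtpos => DoubleAffine.deletedFactor q k
          ((fun i => (P.root i, (0 : ℝ))) '' (b.support : Set ι)) ξ γ) r₀ ∧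
        DoubleAffine.HasMuResidue q k (DoubleAffine.mu q k Rtpos)
          (fun i : b.support => (P.root i, (0 : ℝ))) ξ r₀ ∧
        ∀ c ∈ DoubleAffine.weights R, ∀ u : V ≃ₗ[ℝ] V,
          DoubleAffine.IsMinAntidominant W Rpos c u →
          ∃ v : ℂ,
            v = (∏ᶠ γ ∈ DoubleAffine.lambdaSet Rtpos (DoubleAffine.extElt c u⁻¹),
                  DoubleAffine.tPar q k γ)⁻¹ *
                ∏ᶠ γ ∈ DoubleAffine.lambdaSet' Rtpos (DoubleAffine.extElt c u⁻¹),
                  (1 - DoubleAffine.tPar q k γ *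
                      DoubleAffine.X q γ (DoubleAffine.rho k Rpos)) /
                  (1 - (DoubleAffine.tPar q k γ)⁻¹ *
                      DoubleAffine.X q γ (DoubleAffine.rho k Rpos)) ∧
            DoubleAffine.HasValueAt (DoubleAffine.regularPts q k R)
              (fun x =>
                DoubleAffine.mu q k Rtpos (DoubleAffine.actPt (DoubleAffine.extElt c u⁻¹) x) /
                  DoubleAffine.mu q k Rtpos x) ξ v ∧
            DoubleAffine.HasMuResidue q k (DoubleAffine.mu q k Rtpos)
              (fun i : b.support => DoubleAffine.extElt c u⁻¹ (P.root i, (0 : ℝ)))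
              (DoubleAffine.actPt (DoubleAffine.extElt c u⁻¹) ξ) (v * r₀))) ∧
    -- (ii), (iii) and the second half of (iv)
    (∀ ξ : V →L[ℝ] ℂ, (∀ γ ∈ Rtpos, 1 - DoubleAffine.X q γ ξ ≠ 0) →
      (tsht = tlng ∨ tsht ^ νlng = tlng) →
      ∀ β : Fin n → V × ℝ, Function.Injective β →
      Set.range β = DoubleAffine.vanishing q k Rtpos ξ →
      ∀ (Rdag : Set (V × ℝ)) (R' : Set V), Rdag = DoubleAffine.affSpanRoots R β →
      R' = DoubleAffine.spanRoots R β →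
      -- (ii)
      (LinearIndependent ℝ (fun i => (β i).1) ∧
        Rdag.Finite ∧ DoubleAffine.IsClosedSubsystem Rt Rdag ∧
        Module.finrank ℝ (Submodule.span ℝ (Prod.fst '' Rdag)) = n ∧
        DoubleAffine.IsSimpleSystem Rdag β ∧
        ((¬ ∃ i j, DoubleAffine.nu (β i).1 = 1 ∧ DoubleAffine.nu (β j).1 = 1 ∧
            (β i - β j).1 ∈ R ∧ DoubleAffine.nu (β i - β j).1 = νlng ∧
            ¬ ∃ m : ℤ, (β i - β j).2 = νlng * m) →
          DoubleAffine.IsSimpleSystem R' (fun i => (β i).1))) ∧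
      -- (iii)
      (1 < ‖tsht‖ → q < (‖tlng‖ ^ DoubleAffine.maxCoxeterNumber β Rdag)⁻¹ →
        ∀ (Rt' Rtpos' : Set (V × ℝ)), Rt' = DoubleAffine.affRoots R' → Rtpos' = Rt' ∩ Rtpos →
        ∃ w' ∈ DoubleAffine.affWeyl Rt',
          (∀ i, w'⁻¹ (β i) ∈ DoubleAffine.simpleRoots Rtpos') ∧
          (∀ C : Set V, DoubleAffine.IsComponent (fun x y => inner ℝ x y) R' C →
            ∃! γ : V × ℝ, γ ∈ DoubleAffine.simpleRoots (DoubleAffine.affRoots C ∩ Rtpos) ∧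
              γ ∉ Set.range fun i => w'⁻¹ (β i)) ∧
          -- (iv): the residue at `ξ`, which is the image under `w'` of the point `ξ₀`
          -- where the simple roots of the subsystem take the values `t⁻¹`
          (∀ ξ₀ : V →L[ℝ] ℂ, ξ₀ = DoubleAffine.actPt w'⁻¹ ξ →
            ∃ s v r₀ : ℂ,
              HasProd (fun γ : Rtpos' => DoubleAffine.deletedFactor q k
                (Set.range fun i => w'⁻¹ (β i)) ξ₀ γ) r₀ ∧
              DoubleAffine.HasMuResidue q k (DoubleAffine.mu q k Rtpos')
                (fun i => w'⁻¹ (β i)) ξ₀ r₀ ∧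
              v = ∏ᶠ γ ∈ DoubleAffine.lambdaSet Rtpos' w',
                ((DoubleAffine.tPar q k γ)⁻¹ - DoubleAffine.X q γ ξ₀) /
                (1 - (DoubleAffine.tPar q k γ)⁻¹ * DoubleAffine.X q γ ξ₀) ∧
              DoubleAffine.HasValueAt (DoubleAffine.regularPts q k R)
                (fun x => DoubleAffine.mu q k Rtpos' (DoubleAffine.actPt w' x) /
                  DoubleAffine.mu q k Rtpos' x) ξ₀ v ∧
              DoubleAffine.HasMuResidue q k (DoubleAffine.mu q k Rtpos') β ξ (v * r₀) ∧
              s ≠ 0 ∧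
              DoubleAffine.HasValueAt (DoubleAffine.regularPts q k R)
                (fun x => DoubleAffine.mu q k Rtpos x / DoubleAffine.mu q k Rtpos' x) ξ s ∧
              DoubleAffine.HasMuResidue q k (DoubleAffine.mu q k Rtpos) β ξ
                (s * (v * r₀))))) := by
  subst hR hRpos hW hRt hRtpos htsht htlng hn
  obtain ⟨r, hS⟩ := exists_simpleData hEuc hsht hlng b
  have hWg := isReflectionGroup_closure hEuc hS.root
  have hadm := admissible_affPos (Rpos := P.root '' {i | b.IsPos i}) hS.root hq0 hq1
  have hhalf := isHalf_affPos hS.root hS.pos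
  have hcard := card_support b
  refine ⟨fun x => hadm.multipliable_muFactor hq0 k x, fun ξ Ψ hΨ htot => ⟨fun h γ hγ => ?_,
    fun h γ hγ => ?_⟩, ?_, ?_⟩
  · exact fun h1 => one_sub_X_ne_zero_of_half hq0 hhalf.total h γ (hΨ hγ) (sub_eq_zero.1 h1).symm
  · exact fun h1 => one_sub_X_ne_zero_of_half hq0 htot h γ hγ.1 (sub_eq_zero.1 h1).symm
  · intro ξ hξ hnum hopp hts hC hF
    have h : SphericalData (Set.range P.root) (P.root '' {i | b.IsPos i}) r
        (fun i : b.support => P.root i) νlng q k ξ :=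
      ⟨hS, hq0, hq1, hgen, hξ, hnum, hopp, hts,
        fun hC' j h1 h2 => hC (isTypeC_of_hasCartanC hEuc hC') j h1 (hcard ▸ h2),
        fun hF' => hF (isTypeF_of_hasCartanF hEuc hF')⟩
    have himg : ∀ f : V × ℝ → V × ℝ, (fun i => f (P.root i, 0)) '' (b.support : Set ι) =
        Set.range fun i : b.support => f (P.root i, 0) := fun f => by
      ext γ
      simp
    constructor
    · intro c hc w hw
      rw [← hcard]
      refine ⟨⟨fun h1 => ?_, h.encard_vanishing_of_min hWg hc hw⟩, fun hm => ?_, fun hm =>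
        ⟨h.encard_vanishing_lt hWg hc hw hm, h.hasValueAt_mu_actPt_zero hWg hc hw hm⟩⟩
      · by_contra hm
        exact (h.encard_vanishing_lt hWg hc hw hm).ne h1
      · rw [himg (extElt c w)]
        exact h.vanishing_of_min hWg hc hw hm
    · obtain ⟨r₀, hr₀, hres⟩ := h.exists_residue hcard
      refine ⟨r₀, ?_, hres, fun c hc u hm => ?_⟩
      · rw [show (fun i => (P.root i, (0 : ℝ))) '' (b.support : Set ι) =
          Set.range fun i : b.support => (P.root i, (0 : ℝ)) from himg id]
        exact hr₀
      · have hu := inv_mem hm.1.1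
        have hm' : IsMinAntidominant (Subgroup.closure (Set.range P.reflection))
            (P.root '' {i | b.IsPos i}) c (u⁻¹)⁻¹ := by rwa [inv_inv]
        refine ⟨_, rfl, ?_, ?_⟩
        · rw [← h.prod_lambdaSet_eq hWg hc hu]
          exact h.hasValueAt_mu_actPt_prod hWg hc hu
        · rw [← h.prod_lambdaSet_eq hWg hc hu]
          exact h.hasMuResidue_actPt hWg hc hu hcard hm' hr₀
  · rintro ξ hnum hpar β hinj hv Rdag R' rfl rfl
    have hβv : ∀ i, β i ∈ vanishing q k (affPos (Set.range P.root) (P.root '' {i | b.IsPos i})) ξ :=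
      fun i => hv.subset ⟨i, rfl⟩
    have hν := nu_root_eq_or hEuc hsht hlng
    have h : PoleData (Set.range P.root) q k νlng ξ β :=
      ⟨hS.root, hS.nu_eq, by have := hν.1; omega, hq0, hgen,
        one_sub_X_ne_zero_of_half hq0 hhalf.total hnum, hpar, hinj, fun i => (hβv i).1.1,
        fun i => (sub_eq_zero.1 (hβv i).2).symm⟩
    have hcard' : Fintype.card (Fin (Module.finrank ℝ V)) = Module.finrank ℝ V :=
      Fintype.card_fin _
    have hli := h.linearIndependent hS.pos (fun i => (hβv i).1) b.toWeightBasis (fun α hα => by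
      obtain ⟨m, hm | hm⟩ := hS.simple.2.2 α hα
      · exact ⟨fun i => m i, by simpa using hm⟩
      · exact ⟨fun i => -m i, by simpa using hm⟩) (hcard'.trans hcard.symm)
    refine ⟨⟨hli, h.finite_affSpanRoots hli, h.isClosedSubsystem_affSpanRoots, ?_,
      h.isSimpleSystem_affSpanRoots hli, h.isSimpleSystem_spanRoots hli⟩, ?_⟩
    · rw [h.span_fst_affSpanRoots hli hcard', finrank_top]
    · intro hn1 _ Rt' Rtpos' hRt' hRtpos'
      exact h.exists_affWeyl_residue hS.pos hq1 hli hcard' hv hn1 hRt' hRtpos'
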